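/- Let $K$ be a field, $\mathcal V$ a finite non-empty set, $R=R_{\mathcal V}=\bigoplus_{\lambda\in\mathcal V}K\lambda$ the $K$-algebra with $\lambda\mu=\delta_{\lambda\mu}\lambda$, $\mathring R=\bigoplus_\lambda K\mathring\lambda$ a copy of $R$, and $E=\mathring R\otimes_K R$, regarded also as a coalgebra via $\Delta(\mathring\lambda\mu)=\sum_{\nu}\mathring\lambda\nu\otimes\mathring\nu\mu$, $\varepsilon(\mathring\lambda\mu)=\delta_{\lambda\mu}$. All bimodules are bimodules of $K$-algebras ($K$ acts centrally); $\mathbf{bmd}(R)$ is the monoidal category (under $\otimes_R$, with unit $R$) of $R$-bimodules that are finite-dimensional over $K$. *Face algebras and comodules.* A $\mathcal V$-face algebra is a $K$-algebra $\mathfrak H$ that is also a coalgebra, together with an algebra-coalgebra map $E\to\mathfrak H$ (images of elements are denoted by the same symbols), such that $\Delta(ab)=\Delta(a)\Delta(b)$ and $\varepsilon(ab)=\sum_{\nu}\varepsilon(a\nu)\varepsilon(\mathring\nu b)$ for all $a,b$. An antipode of $\mathfrak H$ is a linear map $S:\mathfrak H\to\mathfrak H$ with $\sum S(a_{(1)})a_{(2)}=\sum_\nu\varepsilon(a\nu)\nu$,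 $\sum a_{(1)}S(a_{(2)})=\sum_\nu\varepsilon(\nu a)\mathring\nu$ and $\sum S(a_{(1)})a_{(2)}S(a_{(3)})=S(a)$ for all $a$. Let $\mathbf{com}(\mathfrak H)$ be the category of finite-dimensional right $\mathfrak H$-comodules. A comodule $M$ is an $R$-bimodule via $\lambda m\mu=\sum m_{(0)}\varepsilon(\lambda m_{(1)}\mu)$, and $\mathbf{com}(\mathfrak H)$ is monoidal under $\otimes_R$ with coaction $m\otimes_R n\mapsto\sum (m_{(0)}\otimes_R n_{(0)})\otimes m_{(1)}n_{(1)}$; the unit is $R$ with coaction $\mu\mapsto\sum_\nu\nu\otimes\mathring\nu\mu$, and the constraints are those of $R$-bimodules. *Tensor categories.* A tensor category over $K$ is a monoidal category that is also a $K$-linear abelian category and whose tensor product is bi-additive. An equivalence of tensor categories is a $K$-linear monoidal functor that is an equivalence of categories. A monoidal category is rigid if each of its objects has a left and a right dual. *The coend.* For a functor $\Omega:\mathbf C\to\mathbf{bmd}(R)$ let $\Omega(X)^*$ be the $K$-dual of $\Omega(X)$ with $\langle\mathring\lambda m^*\mathring\mu,m\rangle=\langle m^*,\lambda m\mu\rangle$,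 so that $(X,Y)\mapsto\Omega(X)^*\otimes_K\Omega(Y)$ is a functor from $\mathbf C^{\mathrm{op}}\times\mathbf C$ to the category of all $E$-bimodules, where $\mathring\lambda\mu(n\otimes m)\mathring\lambda'\mu'=\mathring\lambda n\mathring\lambda'\otimes\mu m\mu'$. Let $C(\Omega)$ denote its coend, if it exists, with structure maps $\kappa_X:\Omega(X)^*\otimes_K\Omega(X)\to C(\Omega)$. **Theorem.** Let $\mathbf C$ be an essentially small tensor category over $K$ and let $\Omega:\mathbf C\to\mathbf{bmd}(R_{\mathcal V})$ be a faithful $K$-linear exact monoidal functor. Then the coend $C(\Omega)$ exists, and it carries a structure of a $\mathcal V$-face algebra, whose left and right multiplication by elements of $E$ is the $E$-bimodule structure of $C(\Omega)$, such that the following holds. 1. $\mathbf{com}(C(\Omega))$ is a tensor category over $K$, and $\Omega$ gives an equivalence of tensor categories from $\mathbf C$ to $\mathbf{com}(C(\Omega))$. More precisely, there are an equivalence of tensor categories $F:\mathbf C\to\mathbf{com}(C(\Omega))$ and a monoidal natural isomorphism $\alpha$ from the composite of $F$ with the forgetful functor from comodules to $R$-bimodules to $\Omega$, such that for every object $X$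 of $\mathbf C$ the map $\alpha_X$ carries the coaction of $F(X)$ to $$\delta_X:\Omega(X)\to\Omega(X)\otimes_K C(\Omega),\qquad \delta_X(m)=\sum_i m_i\otimes\kappa_X(m^i\otimes m),$$ where $(m_i)$ is a basis of $\Omega(X)$ and $(m^i)$ is its dual basis. 2. If, in addition, $\mathbf C$ is rigid, then $C(\Omega)$ has a bijective antipode. -/

import Mathlib

open CategoryTheory TensorProduct MonoidalCategory Limits

universe u v₁ u₁

noncomputable section

namespace VTannaka

/-- A bimodule over a commutative `K`-algebra `A` on which `K` acts centrally: a `K`-vector space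
with commuting left and right `K`-linear actions of `A`. (As `A` is commutative, a right action is
again an algebra map from `A` to the endomorphism algebra.) -/
structure Bimod (K A : Type u) [Field K] [CommRing A] [Algebra K A] where
  carrier : Type u
  [addCommGroup : AddCommGroup carrier]
  [module : Module K carrier]
  left : A →ₐ[K] Module.End K carrier
  right : A →ₐ[K] Module.End K carrier
  left_right : ∀ (a b : A) (m : carrier), left a (right b m) = right b (left a m)

namespace Bimod

variable {K A : Type u} [Field K] [CommRing A] [Algebra K A]

instance : CoeSort (Bimod K A) (Type u) := ⟨Bimod.carrier⟩

attribute [instance] Bimod.addCommGroup Bimod.module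

/-- Maps of bimodules. -/
structure Hom (M N : Bimod K A) where
  lin : M →ₗ[K] N
  map_left : ∀ a m, lin (M.left a m) = N.left a (lin m)
  map_right : ∀ a m, lin (M.right a m) = N.right a (lin m)

attribute [simp] Hom.map_left Hom.map_right

/-- The category of `A`-bimodules. -/
instance : Category (Bimod K A) where
  Hom M N := Hom M N
  id M := ⟨LinearMap.id, fun _ _ => rfl, fun _ _ => rfl⟩
  comp f g := ⟨g.lin ∘ₗ f.lin, fun a m => by simp, fun a m => by simp⟩

@[simp] lemma lin_id (M : Bimod K A) : Hom.lin (𝟙 M) = LinearMap.id := rfl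

@[simp] lemma lin_comp {M N P : Bimod K A} (f : M ⟶ N) (g : N ⟶ P) :
    Hom.lin (f ≫ g) = g.lin ∘ₗ f.lin := rfl

lemma Hom.lin_injective {M N : Bimod K A} :
    Function.Injective (fun f : M ⟶ N => f.lin) := by
  rintro ⟨f, _, _⟩ ⟨g, _, _⟩ (h : f = g)
  subst h
  rfl

lemma hom_ext {M N : Bimod K A} {f g : M ⟶ N} (h : ∀ m, f.lin m = g.lin m) : f = g :=
  Hom.lin_injective (LinearMap.ext h)

section

variable {M N : Bimod K A}

instance : Zero (M ⟶ N) := ⟨⟨0, by simp, by simp⟩⟩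
instance : Add (M ⟶ N) := ⟨fun f g => ⟨f.lin + g.lin, by simp, by simp⟩⟩
instance : Neg (M ⟶ N) := ⟨fun f => ⟨-f.lin, by simp, by simp⟩⟩
instance : Sub (M ⟶ N) := ⟨fun f g => ⟨f.lin - g.lin, by simp, by simp⟩⟩
instance : SMul K (M ⟶ N) := ⟨fun c f => ⟨c • f.lin, by simp, by simp⟩⟩
instance : SMul ℕ (M ⟶ N) := ⟨fun c f => ⟨c • f.lin, by simp, by simp⟩⟩
instance : SMul ℤ (M ⟶ N) := ⟨fun c f => ⟨c • f.lin, by simp, by simp⟩⟩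

instance : AddCommGroup (M ⟶ N) :=
  Hom.lin_injective.addCommGroup _ rfl (fun _ _ => rfl) (fun _ => rfl)
    (fun _ _ => rfl) (fun _ _ => rfl) (fun _ _ => rfl)

instance : Module K (M ⟶ N) :=
  Hom.lin_injective.module K ⟨⟨fun f : M ⟶ N => f.lin, rfl⟩, fun _ _ => rfl⟩ (fun _ _ => rfl)

end

instance : Preadditive (Bimod K A) where
  add_comp _ _ _ _ _ g := Hom.lin_injective (LinearMap.comp_add _ _ g.lin)
  comp_add _ _ _ _ _ _ := Hom.lin_injective (LinearMap.add_comp _ _ _)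

instance : Linear K (Bimod K A) where
  smul_comp _ _ _ _ _ g := Hom.lin_injective (LinearMap.comp_smul g.lin _ _)
  comp_smul _ _ _ _ _ _ := Hom.lin_injective (LinearMap.smul_comp _ _ _)

/-- An invertible bimodule map from mutually inverse linear maps. -/
def isoMk {M N : Bimod K A} (f : M ⟶ N) (g : N →ₗ[K] M)
    (h₁ : ∀ m, g (f.lin m) = m) (h₂ : ∀ n, f.lin (g n) = n) : M ≅ N where
  hom := f
  inv := ⟨g,
    fun a n => by rw [← h₁ (M.left a (g n)), f.map_left, h₂],
    fun a n => by rw [← h₁ (M.right a (g n)), f.map_right, h₂]⟩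
  hom_inv_id := hom_ext h₁
  inv_hom_id := hom_ext h₂

/-! ### The tensor product over `A` -/

/-- The span of all `m a ⊗ n - m ⊗ a n`. -/
def balanced (M N : Bimod K A) : Submodule K (M ⊗[K] N) :=
  Submodule.span K {x | ∃ (m : M) (a : A) (n : N), x = M.right a m ⊗ₜ n - m ⊗ₜ N.left a n}

/-- The underlying space of `M ⊗_A N`. -/
abbrev Tens (M N : Bimod K A) : Type u := (M ⊗[K] N) ⧸ balanced M N

/-- The class `m ⊗_A n`, as a bilinear map. -/
def preMul (M N : Bimod K A) : M →ₗ[K] N →ₗ[K] Tens M N :=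
  (TensorProduct.mk K M N).compr₂ (balanced M N).mkQ

lemma preMul_balanced {M N : Bimod K A} (m : M) (a : A) (n : N) :
    preMul M N (M.right a m) n = preMul M N m (N.left a n) := by
  change Submodule.Quotient.mk _ = Submodule.Quotient.mk _
  rw [Submodule.Quotient.eq]
  exact Submodule.subset_span ⟨m, a, n, rfl⟩

lemma pre_ext {M N : Bimod K A} {P : Type*} [AddCommGroup P] [Module K P]
    {f g : Tens M N →ₗ[K] P} (h : ∀ m n, f (preMul M N m n) = g (preMul M N m n)) : f = g := by
  apply Submodule.linearMap_qext
  exact TensorProduct.ext' h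

/-- The universal property of `M ⊗_A N`. -/
def preLift {M N : Bimod K A} {P : Type*} [AddCommGroup P] [Module K P] (f : M →ₗ[K] N →ₗ[K] P)
    (h : ∀ m a n, f (M.right a m) n = f m (N.left a n)) : Tens M N →ₗ[K] P :=
  (balanced M N).liftQ (TensorProduct.lift f) (by
    rw [balanced, Submodule.span_le]
    rintro _ ⟨m, a, n, rfl⟩
    simp [h])

@[simp] lemma preLift_mul {M N : Bimod K A} {P : Type*} [AddCommGroup P] [Module K P]
    (f : M →ₗ[K] N →ₗ[K] P) (h) (m : M) (n : N) : preLift f h (preMul M N m n) = f m n := by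
  simp [preLift, preMul]

/-- The map `f ⊗_A g` for `K`-linear `f` and `g` that commute with the inner actions. -/
def preMap {M N M' N' : Bimod K A} (f : M →ₗ[K] M') (g : N →ₗ[K] N')
    (hf : ∀ a m, f (M.right a m) = M'.right a (f m))
    (hg : ∀ a n, g (N.left a n) = N'.left a (g n)) : Tens M N →ₗ[K] Tens M' N' :=
  preLift ((preMul M' N').compl₁₂ f g) (fun m a n => by simp [hf, hg, preMul_balanced])

@[simp] lemma preMap_mul {M N M' N' : Bimod K A} (f : M →ₗ[K] M') (g : N →ₗ[K] N') (hf hg)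
    (m : M) (n : N) : preMap f g hf hg (preMul M N m n) = preMul M' N' (f m) (g n) := by
  simp [preMap]

/-- The tensor product bimodule, with `a (m ⊗ n) b = a m ⊗ n b`. -/
def tens (M N : Bimod K A) : Bimod K A where
  carrier := Tens M N
  left :=
    AlgHom.ofLinearMap
      { toFun a := preMap (M.left a) LinearMap.id (fun b m => M.left_right a b m) (fun _ _ => rfl)
        map_add' a b := pre_ext (by simp)
        map_smul' c a := pre_ext (by simp) }
      (pre_ext (by simp)) (fun a b => pre_ext (by simp))
  right :=
    AlgHom.ofLinearMap
      { toFun a := preMap LinearMap.id (N.right a) (fun _ _ => rfl)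
          (fun b n => (N.left_right b a n).symm)
        map_add' a b := pre_ext (by simp)
        map_smul' c a := pre_ext (by simp) }
      (pre_ext (by simp)) (fun a b => pre_ext (by simp))
  left_right a b x := by
    have h : (preMap (M.left a) LinearMap.id (fun b m => M.left_right a b m) (fun _ _ => rfl)) ∘ₗ
        (preMap LinearMap.id (N.right b) (fun _ _ => rfl)
          (fun c n => (N.left_right c b n).symm) : Tens M N →ₗ[K] Tens M N) =
        (preMap LinearMap.id (N.right b) (fun _ _ => rfl)
          (fun c n => (N.left_right c b n).symm) : Tens M N →ₗ[K] Tens M N) ∘ₗ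
        (preMap (M.left a) LinearMap.id (fun b m => M.left_right a b m) (fun _ _ => rfl)) :=
      pre_ext (by simp)
    exact LinearMap.congr_fun h x

/-- The class `m ⊗_A n`, as a bilinear map. -/
def tmul (M N : Bimod K A) : M →ₗ[K] N →ₗ[K] tens M N := preMul M N

@[simp] lemma tens_left (M N : Bimod K A) (a : A) (m : M) (n : N) :
    (tens M N).left a (tmul M N m n) = tmul M N (M.left a m) n := rfl

@[simp] lemma tens_right (M N : Bimod K A) (a : A) (m : M) (n : N) :
    (tens M N).right a (tmul M N m n) = tmul M N m (N.right a n) := rfl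

lemma tmul_balanced {M N : Bimod K A} (m : M) (a : A) (n : N) :
    tmul M N (M.right a m) n = tmul M N m (N.left a n) := preMul_balanced m a n

lemma tens_ext {M N : Bimod K A} {P : Type*} [AddCommGroup P] [Module K P]
    {f g : tens M N →ₗ[K] P} (h : ∀ m n, f (tmul M N m n) = g (tmul M N m n)) : f = g :=
  pre_ext h

lemma tens_ind {M N : Bimod K A} {P : Type*} [AddCommGroup P] [Module K P]
    (f g : tens M N →ₗ[K] P) (h : ∀ m n, f (tmul M N m n) = g (tmul M N m n)) (x : tens M N) :
    f x = g x := LinearMap.congr_fun (tens_ext h) x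

/-- The universal property of `M ⊗_A N`. -/
def lift {M N : Bimod K A} {P : Type*} [AddCommGroup P] [Module K P] (f : M →ₗ[K] N →ₗ[K] P)
    (h : ∀ m a n, f (M.right a m) n = f m (N.left a n)) : tens M N →ₗ[K] P := preLift f h

@[simp] lemma lift_tmul {M N : Bimod K A} {P : Type*} [AddCommGroup P] [Module K P]
    (f : M →ₗ[K] N →ₗ[K] P) (h) (m : M) (n : N) : lift f h (tmul M N m n) = f m n :=
  preLift_mul f h m n

/-- The regular bimodule. -/
def unit (K A : Type u) [Field K] [CommRing A] [Algebra K A] : Bimod K A where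
  carrier := A
  left := Algebra.lmul K A
  right := Algebra.lmul K A
  left_right a b m := by simp [mul_left_comm]

/-- Maps out of a tensor product are bimodule maps if they are so on pure tensors. -/
def tensMk {M N P : Bimod K A} (f : tens M N →ₗ[K] P)
    (hl : ∀ a m n, f (tmul M N (M.left a m) n) = P.left a (f (tmul M N m n)))
    (hr : ∀ a m n, f (tmul M N m (N.right a n)) = P.right a (f (tmul M N m n))) :
    tens M N ⟶ P where
  lin := f
  map_left a := tens_ind (f ∘ₗ (tens M N).left a) (P.left a ∘ₗ f) (hl a)
  map_right a := tens_ind (f ∘ₗ (tens M N).right a) (P.right a ∘ₗ f) (hr a)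

@[simp] lemma tensMk_lin {M N P : Bimod K A} (f : tens M N →ₗ[K] P) (hl hr) :
    (tensMk f hl hr : tens M N ⟶ P).lin = f := rfl

/-- The induced map on tensor products. -/
def tensHom {M N M' N' : Bimod K A} (f : M ⟶ M') (g : N ⟶ N') : tens M N ⟶ tens M' N' :=
  tensMk (lift ((tmul M' N').compl₁₂ f.lin g.lin) (fun m a n => by simp [tmul_balanced]))
    (fun a m n => by simp) (fun a m n => by simp)

@[simp] lemma tensHom_tmul {M N M' N' : Bimod K A} (f : M ⟶ M') (g : N ⟶ N') (m : M) (n : N) :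
    (tensHom f g).lin (tmul M N m n) = tmul M' N' (f.lin m) (g.lin n) := by
  simp [tensHom]

/-- The map `m ⊗ n ↦ (p ↦ m ⊗ (n ⊗ p))`. -/
def assocAux (M N P : Bimod K A) : tens M N →ₗ[K] P →ₗ[K] tens M (tens N P) :=
  lift (LinearMap.mk₂ K (fun m n => (tmul M (tens N P) m).comp (tmul N P n))
      (fun _ _ _ => LinearMap.ext fun _ => by simp) (fun _ _ _ => LinearMap.ext fun _ => by simp)
      (fun _ _ _ => LinearMap.ext fun _ => by simp) (fun _ _ _ => LinearMap.ext fun _ => by simp))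
    (fun m a n => LinearMap.ext fun p => by simp [tmul_balanced])

@[simp] lemma assocAux_tmul (M N P : Bimod K A) (m : M) (n : N) (p : P) :
    assocAux M N P (tmul _ _ m n) p = tmul _ _ m (tmul _ _ n p) := by
  simp [assocAux]

/-- The linear map `(m ⊗ n) ⊗ p ↦ m ⊗ (n ⊗ p)`. -/
def assocLin (M N P : Bimod K A) : tens (tens M N) P →ₗ[K] tens M (tens N P) :=
  lift (assocAux M N P) (fun x a p =>
    tens_ind ((assocAux M N P).flip p ∘ₗ (tens M N).right a)
      ((assocAux M N P).flip (P.left a p)) (fun m n => by simp [tmul_balanced]) x)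

@[simp] lemma assocLin_tmul (M N P : Bimod K A) (m : M) (n : N) (p : P) :
    assocLin M N P (tmul _ _ (tmul _ _ m n) p) = tmul _ _ m (tmul _ _ n p) :=
  (lift_tmul (assocAux M N P) _ (tmul M N m n) p).trans (assocAux_tmul M N P m n p)

/-- The map `n ⊗ p ↦ (m ↦ (m ⊗ n) ⊗ p)`. -/
def assocInvAux (M N P : Bimod K A) : tens N P →ₗ[K] M →ₗ[K] tens (tens M N) P :=
  lift (LinearMap.mk₂ K (fun n p => ((tmul (tens M N) P).flip p).comp ((tmul M N).flip n))
      (fun _ _ _ => LinearMap.ext fun _ => by simp) (fun _ _ _ => LinearMap.ext fun _ => by simp)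
      (fun _ _ _ => LinearMap.ext fun _ => by simp) (fun _ _ _ => LinearMap.ext fun _ => by simp))
    (fun n a p => LinearMap.ext fun m => by simp [← tmul_balanced])

@[simp] lemma assocInvAux_tmul (M N P : Bimod K A) (m : M) (n : N) (p : P) :
    assocInvAux M N P (tmul _ _ n p) m = tmul _ _ (tmul _ _ m n) p := by
  simp [assocInvAux]

/-- The linear map `m ⊗ (n ⊗ p) ↦ (m ⊗ n) ⊗ p`. -/
def assocInvLin (M N P : Bimod K A) : tens M (tens N P) →ₗ[K] tens (tens M N) P :=
  lift (assocInvAux M N P).flip (fun m a x =>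
    tens_ind ((assocInvAux M N P).flip (M.right a m))
      ((assocInvAux M N P).flip m ∘ₗ (tens N P).left a) (fun n p => by simp [tmul_balanced]) x)

@[simp] lemma assocInvLin_tmul (M N P : Bimod K A) (m : M) (n : N) (p : P) :
    assocInvLin M N P (tmul _ _ m (tmul _ _ n p)) = tmul _ _ (tmul _ _ m n) p := by
  exact (lift_tmul (assocInvAux M N P).flip _ m (tmul N P n p)).trans (assocInvAux_tmul M N P m n p)

/-- Two linear maps on a threefold tensor product agree if they do on pure tensors. -/
lemma tens₃_ind {M N P : Bimod K A} {Q : Type*} [AddCommGroup Q] [Module K Q]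
    (f g : tens (tens M N) P →ₗ[K] Q)
    (h : ∀ m n p, f (tmul _ _ (tmul _ _ m n) p) = g (tmul _ _ (tmul _ _ m n) p)) (x) :
    f x = g x :=
  tens_ind f g (fun x p => tens_ind (f ∘ₗ (tmul _ _).flip p) (g ∘ₗ (tmul _ _).flip p)
    (fun m n => h m n p) x) x

lemma tens₃_ind' {M N P : Bimod K A} {Q : Type*} [AddCommGroup Q] [Module K Q]
    (f g : tens M (tens N P) →ₗ[K] Q)
    (h : ∀ m n p, f (tmul _ _ m (tmul _ _ n p)) = g (tmul _ _ m (tmul _ _ n p))) (x) :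
    f x = g x :=
  tens_ind f g (fun m x => tens_ind (f ∘ₗ tmul _ _ m) (g ∘ₗ tmul _ _ m)
    (fun n p => h m n p) x) x

lemma tens₄_ind {M N P L : Bimod K A} {Q : Type*} [AddCommGroup Q] [Module K Q]
    (f g : tens (tens (tens M N) P) L →ₗ[K] Q)
    (h : ∀ m n p l, f (tmul _ _ (tmul _ _ (tmul _ _ m n) p) l) =
      g (tmul _ _ (tmul _ _ (tmul _ _ m n) p) l)) (x) :
    f x = g x :=
  tens_ind f g (fun x l => tens₃_ind (f ∘ₗ (tmul _ _).flip l) (g ∘ₗ (tmul _ _).flip l)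
    (fun m n p => h m n p l) x) x

/-- The associativity constraint. -/
def assoc (M N P : Bimod K A) : tens (tens M N) P ≅ tens M (tens N P) :=
  isoMk
    { lin := assocLin M N P
      map_left a := tens₃_ind (assocLin M N P ∘ₗ (tens (tens M N) P).left a)
        ((tens M (tens N P)).left a ∘ₗ assocLin M N P) (by simp)
      map_right a := tens₃_ind (assocLin M N P ∘ₗ (tens (tens M N) P).right a)
        ((tens M (tens N P)).right a ∘ₗ assocLin M N P) (by simp) }
    (assocInvLin M N P)
    (tens₃_ind (assocInvLin M N P ∘ₗ assocLin M N P) LinearMap.id (by simp))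
    (tens₃_ind' (assocLin M N P ∘ₗ assocInvLin M N P) LinearMap.id (by simp))

/-- The identity, from `A` to the regular bimodule. -/
def toUnit (K A : Type u) [Field K] [CommRing A] [Algebra K A] : A ≃ₗ[K] unit K A :=
  LinearEquiv.refl K A

@[simp] lemma unit_left (a b : A) : (unit K A).left a (toUnit K A b) = toUnit K A (a * b) := rfl

@[simp] lemma unit_right (b a : A) : (unit K A).right a (toUnit K A b) = toUnit K A (a * b) := rfl

@[simp] lemma symm_unit_left (a : A) (u : unit K A) :
    (toUnit K A).symm ((unit K A).left a u) = a * (toUnit K A).symm u := rfl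

@[simp] lemma symm_unit_right (a : A) (u : unit K A) :
    (toUnit K A).symm ((unit K A).right a u) = a * (toUnit K A).symm u := rfl

/-- The left action as a bilinear map. -/
def actL (M : Bimod K A) : unit K A →ₗ[K] M →ₗ[K] M :=
  M.left.toLinearMap ∘ₗ (toUnit K A).symm.toLinearMap

@[simp] lemma actL_apply (M : Bimod K A) (u : unit K A) (m : M) :
    actL M u m = M.left ((toUnit K A).symm u) m := rfl

/-- The right action as a bilinear map. -/
def actR (M : Bimod K A) : M →ₗ[K] unit K A →ₗ[K] M :=
  (M.right.toLinearMap ∘ₗ (toUnit K A).symm.toLinearMap).flip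

@[simp] lemma actR_apply (M : Bimod K A) (u : unit K A) (m : M) :
    actR M m u = M.right ((toUnit K A).symm u) m := rfl

lemma tmul_unit_left (M : Bimod K A) (u : unit K A) (m : M) :
    tmul (unit K A) M (toUnit K A 1) (M.left ((toUnit K A).symm u) m) =
      tmul (unit K A) M u m := by
  simp [← tmul_balanced]

lemma tmul_unit_right (M : Bimod K A) (u : unit K A) (m : M) :
    tmul M (unit K A) (M.right ((toUnit K A).symm u) m) (toUnit K A 1) =
      tmul M (unit K A) m u := by
  simp [tmul_balanced]

/-- The map `a ⊗ m ↦ a m`. -/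
def leftUnitLin (M : Bimod K A) : tens (unit K A) M →ₗ[K] M :=
  lift (actL M) (fun b a m => by simp [mul_comm a])

@[simp] lemma leftUnitLin_tmul (M : Bimod K A) (u : unit K A) (m : M) :
    leftUnitLin M (tmul _ _ u m) = M.left ((toUnit K A).symm u) m :=
  lift_tmul (actL M) _ u m

/-- The map `m ⊗ a ↦ m a`. -/
def rightUnitLin (M : Bimod K A) : tens M (unit K A) →ₗ[K] M :=
  lift (actR M) (fun m a b => by simp [mul_comm a])

@[simp] lemma rightUnitLin_tmul (M : Bimod K A) (u : unit K A) (m : M) :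
    rightUnitLin M (tmul _ _ m u) = M.right ((toUnit K A).symm u) m :=
  lift_tmul (actR M) _ m u

/-- The left unit constraint `a ⊗ m ↦ a m`. -/
def leftUnit (M : Bimod K A) : tens (unit K A) M ≅ M :=
  isoMk
    (tensMk (leftUnitLin M) (by simp) (fun a b m => by simp [M.left_right]))
    (tmul (unit K A) M (toUnit K A 1))
    (tens_ind (tmul (unit K A) M (toUnit K A 1) ∘ₗ leftUnitLin M) LinearMap.id
      (fun a m => by simp [tmul_unit_left]))
    (fun m => by simp)

/-- The right unit constraint `m ⊗ a ↦ m a`. -/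
def rightUnit (M : Bimod K A) : tens M (unit K A) ≅ M :=
  isoMk
    (tensMk (rightUnitLin M) (fun a m b => by simp [M.left_right]) (by simp))
    ((tmul M (unit K A)).flip (toUnit K A 1))
    (tens_ind ((tmul M (unit K A)).flip (toUnit K A 1) ∘ₗ rightUnitLin M) LinearMap.id
      (fun m a => by simp [tmul_unit_right]))
    (fun m => by simp)

@[simp] lemma assoc_hom_tmul (M N P : Bimod K A) (m : M) (n : N) (p : P) :
    (assoc M N P).hom.lin (tmul _ _ (tmul _ _ m n) p) = tmul _ _ m (tmul _ _ n p) :=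
  assocLin_tmul M N P m n p

@[simp] lemma assoc_inv_tmul (M N P : Bimod K A) (m : M) (n : N) (p : P) :
    (assoc M N P).inv.lin (tmul _ _ m (tmul _ _ n p)) = tmul _ _ (tmul _ _ m n) p :=
  assocInvLin_tmul M N P m n p

@[simp] lemma leftUnit_hom_tmul (M : Bimod K A) (u : unit K A) (m : M) :
    (leftUnit M).hom.lin (tmul _ _ u m) = M.left ((toUnit K A).symm u) m :=
  leftUnitLin_tmul M u m

@[simp] lemma rightUnit_hom_tmul (M : Bimod K A) (u : unit K A) (m : M) :
    (rightUnit M).hom.lin (tmul _ _ m u) = M.right ((toUnit K A).symm u) m :=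
  rightUnitLin_tmul M u m

lemma tens_hom_ext {M N P : Bimod K A} {f g : tens M N ⟶ P}
    (h : ∀ m n, f.lin (tmul M N m n) = g.lin (tmul M N m n)) : f = g :=
  hom_ext (tens_ind f.lin g.lin h)

/-- The monoidal category of `A`-bimodules, with `⊗_A` and the regular bimodule as unit. -/
instance : MonoidalCategory (Bimod K A) where
  tensorObj := tens
  tensorUnit := unit K A
  tensorHom := tensHom
  whiskerLeft M _ _ f := tensHom (𝟙 M) f
  whiskerRight f N := tensHom f (𝟙 N)
  associator := assoc
  leftUnitor := leftUnit
  rightUnitor := rightUnit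
  tensorHom_def _ _ := tens_hom_ext fun m n => by simp
  id_tensorHom_id _ _ := tens_hom_ext fun m n => by simp
  tensorHom_comp_tensorHom _ _ _ _ := tens_hom_ext fun m n => by simp
  whiskerLeft_id _ _ := tens_hom_ext fun m n => by simp
  id_whiskerRight _ _ := tens_hom_ext fun m n => by simp
  associator_naturality _ _ _ := hom_ext (tens₃_ind _ _ fun m n p => by simp)
  leftUnitor_naturality _ := tens_hom_ext fun m n => by simp
  rightUnitor_naturality _ := tens_hom_ext fun m n => by simp
  pentagon _ _ _ _ := hom_ext (tens₄_ind _ _ fun m n p l => by simp)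
  triangle _ _ := hom_ext (tens₃_ind _ _ fun m n p => by simp [tmul_balanced])

@[simp] lemma tensorHom_tmul {M N M' N' : Bimod K A} (f : M ⟶ M') (g : N ⟶ N') (m : M) (n : N) :
    Hom.lin (f ⊗ₘ g) (tmul M N m n) = tmul M' N' (f.lin m) (g.lin n) := tensHom_tmul f g m n

end Bimod

/-! ### Finite-dimensional bimodules -/

/-- The property of being finite-dimensional over `K`. -/
def Bimod.isFinite (K A : Type u) [Field K] [CommRing A] [Algebra K A] :
    ObjectProperty (Bimod K A) := fun M => Module.Finite K M

instance {K A : Type u} [Field K] [CommRing A] [Algebra K A] [Module.Finite K A] :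
    (Bimod.isFinite K A).IsMonoidal where
  prop_unit := inferInstanceAs (Module.Finite K A)
  prop_tensor M N hM hN := by
    have : Module.Finite K M := hM
    have : Module.Finite K N := hN
    exact inferInstanceAs (Module.Finite K ((M ⊗[K] N) ⧸ Bimod.balanced M N))

/-- The category of `A`-bimodules that are finite-dimensional over `K`. -/
abbrev FinBimod (K A : Type u) [Field K] [CommRing A] [Algebra K A] :=
  (Bimod.isFinite K A).FullSubcategory

instance {K A : Type u} [Field K] [CommRing A] [Algebra K A] (M : FinBimod K A) :
    Module.Finite K M.obj := M.property

/-! ### The algebras `R` and `E` -/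

/-- The algebra `R` spanned by orthogonal idempotents `λ ∈ V` with sum `1`. -/
abbrev FaceR (K V : Type u) : Type u := V → K

/-- The algebra `E = R° ⊗ R`. -/
def FaceE (K V : Type u) [Field K] : Type u := FaceR K V ⊗[K] FaceR K V

namespace FaceE

variable {K V : Type u} [Field K]

instance : CommRing (FaceE K V) := inferInstanceAs (CommRing (FaceR K V ⊗[K] FaceR K V))
instance : Algebra K (FaceE K V) := inferInstanceAs (Algebra K (FaceR K V ⊗[K] FaceR K V))

/-- The bilinear map sending `a, b ∈ R` to `a° b ∈ E`. -/
def mk : FaceR K V →ₗ[K] FaceR K V →ₗ[K] FaceE K V := TensorProduct.mk K _ _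

lemma mk_mul (a b a' b' : FaceR K V) : mk a b * mk a' b' = mk (a * a') (b * b') :=
  Algebra.TensorProduct.tmul_mul_tmul a a' b b'

lemma mk_one : mk (1 : FaceR K V) 1 = 1 := rfl

lemma hom_ext {P : Type*} [AddCommGroup P] [Module K P] {f g : FaceE K V →ₗ[K] P}
    (h : ∀ a b, f (mk a b) = g (mk a b)) : f = g :=
  TensorProduct.ext' (M := FaceR K V) (N := FaceR K V) h

/-- The linear map on `E` defined by a bilinear map on `R`. -/
def lift {P : Type*} [AddCommGroup P] [Module K P] (f : FaceR K V →ₗ[K] FaceR K V →ₗ[K] P) :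
    FaceE K V →ₗ[K] P := TensorProduct.lift f

@[simp] lemma lift_mk {P : Type*} [AddCommGroup P] [Module K P]
    (f : FaceR K V →ₗ[K] FaceR K V →ₗ[K] P) (a b : FaceR K V) : lift f (mk a b) = f a b :=
  TensorProduct.lift.tmul a b

variable [Fintype V]

/-- `ε(a° b) = ∑ ν, a(ν) b(ν)`; in particular `ε(λ° μ) = δ_{λ μ}`. -/
def counitLin : FaceE K V →ₗ[K] K :=
  lift (∑ ν, (LinearMap.mul K K).compl₁₂ (LinearMap.proj ν) (LinearMap.proj ν))

lemma counitLin_mk (a b : FaceR K V) : counitLin (mk a b) = ∑ ν, a ν * b ν := by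
  simp [counitLin, LinearMap.sum_apply]

variable [DecidableEq V]

lemma sum_single (a : FaceR K V) : ∑ ν, a ν • (Pi.single ν 1 : FaceR K V) = a :=
  (pi_eq_sum_univ' a).symm

/-- `Δ(a° b) = ∑ ν, a° ν ⊗ ν° b`; in particular `Δ(λ° μ) = ∑ ν, λ° ν ⊗ ν° μ`. -/
def comulLin : FaceE K V →ₗ[K] FaceE K V ⊗[K] FaceE K V :=
  lift (∑ ν, (TensorProduct.mk K (FaceE K V) (FaceE K V)).compl₁₂
    (mk.flip (Pi.single ν 1)) (mk (Pi.single ν 1)))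

lemma comulLin_mk (a b : FaceR K V) :
    comulLin (mk a b) = ∑ ν, mk a (Pi.single ν 1) ⊗ₜ mk (Pi.single ν 1) b := by
  simp [comulLin, LinearMap.sum_apply]

lemma sum_mk_left (a b : FaceR K V) : ∑ ν, a ν • mk (Pi.single ν 1) b = mk a b := by
  conv_rhs => rw [← sum_single a]
  simp [LinearMap.sum_apply]

lemma sum_mk_right (a b : FaceR K V) : ∑ ν, b ν • mk a (Pi.single ν 1) = mk a b := by
  conv_rhs => rw [← sum_single b]
  simp

instance : Coalgebra K (FaceE K V) where
  comul := comulLin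
  counit := counitLin
  coassoc := hom_ext fun a b => by
    simp only [LinearMap.comp_apply, comulLin_mk, map_sum, LinearMap.rTensor_tmul,
      LinearMap.lTensor_tmul, TensorProduct.sum_tmul, TensorProduct.tmul_sum,
      LinearEquiv.coe_coe, TensorProduct.assoc_tmul]
    exact Finset.sum_comm
  rTensor_counit_comp_comul := hom_ext fun a b => by
    have h (ν : V) : ∑ μ, a μ * (Pi.single ν 1 : FaceR K V) μ = a ν := by
      simp [Pi.single_apply]
    have h' (ν : V) (x : FaceE K V) : a ν ⊗ₜ[K] x = (1 : K) ⊗ₜ[K] (a ν • x) := by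
      rw [← TensorProduct.smul_tmul, smul_eq_mul, mul_one]
    simp only [LinearMap.comp_apply, comulLin_mk, map_sum, LinearMap.rTensor_tmul, counitLin_mk, h,
      TensorProduct.mk_apply, h', ← TensorProduct.tmul_sum, sum_mk_left]
  lTensor_counit_comp_comul := hom_ext fun a b => by
    have h (ν : V) : ∑ μ, (Pi.single ν 1 : FaceR K V) μ * b μ = b ν := by
      simp [Pi.single_apply]
    have h' (ν : V) (x : FaceE K V) : x ⊗ₜ[K] b ν = (b ν • x) ⊗ₜ[K] (1 : K) := by
      rw [TensorProduct.smul_tmul, smul_eq_mul, mul_one]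
    simp only [LinearMap.comp_apply, comulLin_mk, map_sum, LinearMap.lTensor_tmul, counitLin_mk, h,
      LinearMap.flip_apply, TensorProduct.mk_apply, h', ← TensorProduct.sum_tmul, sum_mk_right]

lemma comul_mk (a b : FaceR K V) : Coalgebra.comul (R := K) (mk a b) =
    ∑ ν, mk a (Pi.single ν 1) ⊗ₜ[K] mk (Pi.single ν 1) b := comulLin_mk a b

lemma counit_mk (a b : FaceR K V) : Coalgebra.counit (R := K) (mk a b) = ∑ ν, a ν * b ν :=
  counitLin_mk a b

end FaceE

/-! ### The coend of `Ω^* ⊗ Ω` -/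

namespace Bimod

variable {K A : Type u} [Field K] [CommRing A] [Algebra K A]

/-- The dual bimodule, `⟨a f b, m⟩ = ⟨f, a m b⟩`. -/
def dual (M : Bimod K A) : Bimod K A where
  carrier := Module.Dual K M
  left := AlgHom.ofLinearMap
    { toFun a := (M.left a).dualMap
      map_add' a b := by ext; simp
      map_smul' c a := by ext; simp }
    (by ext; simp) (fun a b => by ext; simp [mul_comm a b])
  right := AlgHom.ofLinearMap
    { toFun a := (M.right a).dualMap
      map_add' a b := by ext; simp
      map_smul' c a := by ext; simp }
    (by ext; simp) (fun a b => by ext; simp [mul_comm a b])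
  left_right a b f := LinearMap.ext fun m => congrArg f (M.left_right a b m).symm

/-- The transpose of a bimodule map. -/
def dualMap {M N : Bimod K A} (f : M ⟶ N) : dual N ⟶ dual M where
  lin := f.lin.dualMap
  map_left a φ := LinearMap.ext fun m =>
    congrArg (fun n => (show N →ₗ[K] K from φ) n) (f.map_left a m).symm
  map_right a φ := LinearMap.ext fun m =>
    congrArg (fun n => (show N →ₗ[K] K from φ) n) (f.map_right a m).symm

@[simp] lemma dualMap_id (M : Bimod K A) : dualMap (𝟙 M) = 𝟙 (dual M) := rfl

lemma dualMap_comp {M N P : Bimod K A} (f : M ⟶ N) (g : N ⟶ P) :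
    dualMap (f ≫ g) = dualMap g ≫ dualMap f := rfl

variable {V : Type u}

/-- The `E`-bimodule `N ⊗ M`, with `λ° μ (n ⊗ m) λ'° μ' = λ n λ' ⊗ μ m μ'`. -/
def outer (N M : Bimod K (FaceR K V)) : Bimod K (FaceE K V) where
  carrier := N ⊗[K] M
  left := (Module.endTensorEndAlgHom (R := K) (A := K)).comp
    (Algebra.TensorProduct.map N.left M.left)
  right := (Module.endTensorEndAlgHom (R := K) (A := K)).comp
    (Algebra.TensorProduct.map N.right M.right)
  left_right a b x := by
    have h : ∀ (a b : FaceR K V ⊗[K] FaceR K V),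
        Commute ((Algebra.TensorProduct.map N.left M.left) a)
          ((Algebra.TensorProduct.map N.right M.right) b) := by
      intro a b
      induction a using TensorProduct.induction_on with
      | zero => simp
      | add a a' ha ha' => rw [map_add]; exact ha.add_left ha'
      | tmul a₁ a₂ =>
        induction b using TensorProduct.induction_on with
        | zero => simp
        | add b b' hb hb' => rw [map_add]; exact hb.add_right hb'
        | tmul b₁ b₂ =>
          have h₁ : N.left a₁ * N.right b₁ = N.right b₁ * N.left a₁ :=
            LinearMap.ext (N.left_right a₁ b₁)
          have h₂ : M.left a₂ * M.right b₂ = M.right b₂ * M.left a₂ :=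
            LinearMap.ext (M.left_right a₂ b₂)
          simp [Commute, SemiconjBy, h₁, h₂]
    exact LinearMap.congr_fun ((h a b).map (Module.endTensorEndAlgHom (R := K) (A := K))).eq x

lemma outer_left (N M : Bimod K (FaceR K V)) (a b : FaceR K V) (n : N) (m : M) :
    (outer N M).left (FaceE.mk a b) (n ⊗ₜ m) = N.left a n ⊗ₜ M.left b m := rfl

lemma outer_right (N M : Bimod K (FaceR K V)) (a b : FaceR K V) (n : N) (m : M) :
    (outer N M).right (FaceE.mk a b) (n ⊗ₜ m) = N.right a n ⊗ₜ M.right b m := rfl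

lemma outer_ind {N M : Bimod K (FaceR K V)} {P : Type*} [AddCommGroup P] [Module K P]
    (f g : outer N M →ₗ[K] P) (h : ∀ (n : N) (m : M), f (n ⊗ₜ[K] m) = g (n ⊗ₜ[K] m)) (x) :
    f x = g x :=
  LinearMap.congr_fun (TensorProduct.ext' (M := N) (N := M) h) x

/-- Functoriality of `N ⊗ M`. -/
def outerMap {N N' M M' : Bimod K (FaceR K V)} (f : N ⟶ N') (g : M ⟶ M') :
    outer N M ⟶ outer N' M' where
  lin := TensorProduct.map f.lin g.lin
  map_left e x := by
    refine outer_ind (TensorProduct.map f.lin g.lin ∘ₗ (outer N M).left e)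
      ((outer N' M').left e ∘ₗ TensorProduct.map f.lin g.lin) (fun n m => ?_) x
    refine LinearMap.congr_fun (FaceE.hom_ext
      (f := (TensorProduct.map f.lin g.lin) ∘ₗ (outer N M).left.toLinearMap.flip (n ⊗ₜ m))
      (g := (outer N' M').left.toLinearMap.flip (f.lin n ⊗ₜ g.lin m)) (fun a b => ?_)) e
    change f.lin (N.left a n) ⊗ₜ[K] g.lin (M.left b m) =
      N'.left a (f.lin n) ⊗ₜ[K] M'.left b (g.lin m)
    rw [f.map_left, g.map_left]
  map_right e x := by
    refine outer_ind (TensorProduct.map f.lin g.lin ∘ₗ (outer N M).right e)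
      ((outer N' M').right e ∘ₗ TensorProduct.map f.lin g.lin) (fun n m => ?_) x
    refine LinearMap.congr_fun (FaceE.hom_ext
      (f := (TensorProduct.map f.lin g.lin) ∘ₗ (outer N M).right.toLinearMap.flip (n ⊗ₜ m))
      (g := (outer N' M').right.toLinearMap.flip (f.lin n ⊗ₜ g.lin m)) (fun a b => ?_)) e
    change f.lin (N.right a n) ⊗ₜ[K] g.lin (M.right b m) =
      N'.right a (f.lin n) ⊗ₜ[K] M'.right b (g.lin m)
    rw [f.map_right, g.map_right]

lemma outerMap_id (N M : Bimod K (FaceR K V)) : outerMap (𝟙 N) (𝟙 M) = 𝟙 (outer N M) :=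
  hom_ext (outer_ind _ _ fun _ _ => rfl)

lemma outerMap_comp {N N' N'' M M' M'' : Bimod K (FaceR K V)} (f : N ⟶ N') (f' : N' ⟶ N'')
    (g : M ⟶ M') (g' : M' ⟶ M'') :
    outerMap (f ≫ f') (g ≫ g') = outerMap f g ≫ outerMap f' g' :=
  hom_ext (outer_ind _ _ fun _ _ => rfl)

/-- The bifunctor `(N, M) ↦ N^* ⊗ M`. -/
def dualOuter (K V : Type u) [Field K] :
    (Bimod K (FaceR K V))ᵒᵖ ⥤ Bimod K (FaceR K V) ⥤ Bimod K (FaceE K V) where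
  obj N :=
    { obj M := outer (dual N.unop) M
      map f := outerMap (𝟙 _) f
      map_id _ := outerMap_id _ _
      map_comp f g := outerMap_comp (𝟙 _) (𝟙 _) f g }
  map g :=
    { app M := outerMap (dualMap g.unop) (𝟙 M)
      naturality M M' f := by
        dsimp only
        rw [← outerMap_comp, ← outerMap_comp]
        simp }
  map_id N := by
    ext M
    exact outerMap_id _ _
  map_comp f g := by
    ext M
    exact outerMap_comp (dualMap f.unop) (dualMap g.unop) (𝟙 M) (𝟙 M)

end Bimod

/-- The functor `Ω^* ⊗ Ω` from `Cᵒᵖ × C` to the category of `E`-bimodules,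
`(X, Y) ↦ Ω(X)^* ⊗ Ω(Y)`. -/
def coendDiagram {K V : Type u} [Field K] {C : Type u₁} [Category.{v₁} C]
    (Ω : C ⥤ FinBimod K (FaceR K V)) : Cᵒᵖ ⥤ C ⥤ Bimod K (FaceE K V) :=
  (Ω ⋙ (Bimod.isFinite K (FaceR K V)).ι).op ⋙ Bimod.dualOuter K V ⋙
    (Functor.whiskeringLeft _ _ _).obj (Ω ⋙ (Bimod.isFinite K (FaceR K V)).ι)

/-! ### Face algebras -/

/-- A `V`-face algebra over `K`: an algebra and coalgebra `H` with an algebra-coalgebra map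
`E → H` such that `Δ(ab) = Δ(a)Δ(b)` and `ε(ab) = ∑ ν, ε(a ν) ε(ν° b)`. -/
structure FaceAlg (K V : Type u) [Field K] [Fintype V] [DecidableEq V] where
  carrier : Type u
  [ring : Ring carrier]
  [algebra : Algebra K carrier]
  [coalgebra : Coalgebra K carrier]
  incl : FaceE K V →ₐ[K] carrier
  counit_incl : ∀ e, Coalgebra.counit (R := K) (incl e) = Coalgebra.counit (R := K) e
  comul_incl : ∀ e, Coalgebra.comul (R := K) (incl e) =
    TensorProduct.map incl.toLinearMap incl.toLinearMap (Coalgebra.comul (R := K) e)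
  comul_mul : ∀ a b : carrier, Coalgebra.comul (R := K) (a * b) =
    Coalgebra.comul (R := K) a * Coalgebra.comul (R := K) b
  counit_mul : ∀ a b : carrier, Coalgebra.counit (R := K) (a * b) =
    ∑ ν, Coalgebra.counit (R := K) (a * incl (FaceE.mk 1 (Pi.single ν 1))) *
      Coalgebra.counit (R := K) (incl (FaceE.mk (Pi.single ν 1) 1) * b)

namespace FaceAlg

variable {K V : Type u} [Field K] [Fintype V] [DecidableEq V]

instance : CoeSort (FaceAlg K V) (Type u) := ⟨FaceAlg.carrier⟩

attribute [instance] FaceAlg.ring FaceAlg.algebra FaceAlg.coalgebra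

variable (H : FaceAlg K V)

/-- The image in `H` of `a ∈ R`. -/
def ofR (a : FaceR K V) : H := H.incl (FaceE.mk 1 a)

/-- The image in `H` of `a° ∈ R°`. -/
def ofRo (a : FaceR K V) : H := H.incl (FaceE.mk a 1)

/-- The face idempotent `ν` of `H`. -/
def face (ν : V) : H := H.ofR (Pi.single ν 1)

/-- The face idempotent `ν°` of `H`. -/
def faceo (ν : V) : H := H.ofRo (Pi.single ν 1)

/-- The underlying `E`-bimodule of `H`, given by left and right multiplication. -/
def bimod : Bimod K (FaceE K V) where
  carrier := H
  left := (Algebra.lmul K H).comp H.incl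
  right := AlgHom.ofLinearMap
    ((LinearMap.mul K H).flip ∘ₗ H.incl.toLinearMap) (by ext; simp)
    (fun a b => by ext x; simp [mul_comm a b, mul_assoc])
  left_right a b m := (mul_assoc _ _ _).symm

/-- The counit of `H`. -/
abbrev ε : H →ₗ[K] K := Coalgebra.counit

/-- The coproduct of `H`. -/
abbrev Δ : H →ₗ[K] H ⊗[K] H := Coalgebra.comul

/-- The antipode axioms: `∑ S(a₁) a₂ = ∑ ν, ε(a ν) ν`, `∑ a₁ S(a₂) = ∑ ν, ε(ν a) ν°` and
`∑ S(a₁) a₂ S(a₃) = S(a)`. -/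
structure IsAntipode (S : H →ₗ[K] H) : Prop where
  antipode_mul : ∀ a : H, LinearMap.mul' K H (S.rTensor H (H.Δ a)) =
    ∑ ν, H.ε (a * H.face ν) • H.face ν
  mul_antipode : ∀ a : H, LinearMap.mul' K H (S.lTensor H (H.Δ a)) =
    ∑ ν, H.ε (H.face ν * a) • H.faceo ν
  antipode_mul_antipode : ∀ a : H, LinearMap.mul' K H
    (TensorProduct.map (LinearMap.mul' K H ∘ₗ S.rTensor H) S (H.Δ.rTensor H (H.Δ a))) = S a

lemma ofR_mul (a b : FaceR K V) : H.ofR (a * b) = H.ofR a * H.ofR b := by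
  rw [ofR, ofR, ofR, ← map_mul, FaceE.mk_mul, one_mul]

lemma ofRo_mul (a b : FaceR K V) : H.ofRo (a * b) = H.ofRo a * H.ofRo b := by
  rw [ofRo, ofRo, ofRo, ← map_mul, FaceE.mk_mul, one_mul]

lemma ofR_one : H.ofR 1 = 1 := by rw [ofR, FaceE.mk_one, map_one]

lemma ofR_ofRo (a b : FaceR K V) : H.ofR a * H.ofRo b = H.incl (FaceE.mk b a) := by
  rw [ofR, ofRo, ← map_mul, FaceE.mk_mul, one_mul, mul_one]

lemma ofRo_ofR (a b : FaceR K V) : H.ofRo b * H.ofR a = H.incl (FaceE.mk b a) := by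
  rw [ofR, ofRo, ← map_mul, FaceE.mk_mul, one_mul, mul_one]

lemma comul_ofR (a : FaceR K V) :
    H.Δ (H.ofR a) = ∑ ν, H.face ν ⊗ₜ H.incl (FaceE.mk (Pi.single ν 1) a) := by
  rw [ofR, Δ, H.comul_incl, FaceE.comul_mk, map_sum]
  rfl

lemma comul_one : H.Δ 1 = ∑ ν, H.face ν ⊗ₜ H.faceo ν := by
  rw [← H.ofR_one, comul_ofR]
  rfl

lemma one_comul (x : H) : H.Δ 1 * H.Δ x = H.Δ x := by rw [Δ, ← H.comul_mul, one_mul]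

lemma comul_one_mul (x : H) : H.Δ x * H.Δ 1 = H.Δ x := by rw [Δ, ← H.comul_mul, mul_one]

lemma comul_ofR_mul (a : FaceR K V) (x : H) : H.Δ (H.ofR a * x) = (1 ⊗ₜ H.ofR a) * H.Δ x := by
  have h : H.Δ (H.ofR a) = (1 ⊗ₜ H.ofR a) * H.Δ 1 := by
    rw [comul_one, comul_ofR, Finset.mul_sum]
    refine Finset.sum_congr rfl fun ν _ => ?_
    rw [Algebra.TensorProduct.tmul_mul_tmul, one_mul, faceo, ofR_ofRo]
  rw [Δ, H.comul_mul, h, mul_assoc, one_comul]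

lemma comul_mul_ofR (a : FaceR K V) (x : H) : H.Δ (x * H.ofR a) = H.Δ x * (1 ⊗ₜ H.ofR a) := by
  have h : H.Δ (H.ofR a) = H.Δ 1 * (1 ⊗ₜ H.ofR a) := by
    rw [comul_one, comul_ofR, Finset.sum_mul]
    refine Finset.sum_congr rfl fun ν _ => ?_
    rw [Algebra.TensorProduct.tmul_mul_tmul, mul_one, faceo, ofRo_ofR]
  rw [Δ, H.comul_mul, h, ← mul_assoc, comul_one_mul]

lemma counit_ofR (a : FaceR K V) : H.ε (H.ofR a) = ∑ ν, a ν := by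
  rw [ofR, ε, H.counit_incl, FaceE.counit_mk]
  simp

lemma counit_ofRo (a : FaceR K V) : H.ε (H.ofRo a) = ∑ ν, a ν := by
  rw [ofRo, ε, H.counit_incl, FaceE.counit_mk]
  simp

lemma counit_ofR_mul_ofR (a b : FaceR K V) : H.ε (H.ofR a * H.ofR b) = ∑ ν, a ν * b ν := by
  rw [← ofR_mul, counit_ofR]
  rfl

lemma counit_ofRo_mul_ofRo (a b : FaceR K V) : H.ε (H.ofRo a * H.ofRo b) = ∑ ν, a ν * b ν := by
  rw [← ofRo_mul, counit_ofRo]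
  rfl

lemma counit_mul' (a b : H) : H.ε (a * b) = ∑ ν, H.ε (a * H.face ν) * H.ε (H.faceo ν * b) :=
  H.counit_mul a b

lemma counit_face_mul (μ : V) (x : H) : H.ε (H.face μ * x) = H.ε (H.faceo μ * x) := by
  rw [H.counit_mul']
  simp only [face, counit_ofR_mul_ofR]
  simp [Pi.single_apply]

lemma counit_mul_face (μ : V) (x : H) : H.ε (x * H.face μ) = H.ε (x * H.faceo μ) := by
  rw [H.counit_mul' x (H.faceo μ)]
  simp only [faceo, counit_ofRo_mul_ofRo]
  simp [Pi.single_apply]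

/-- `ε(x y) = ∑ ν, ε(x ν) ε(ν y)`. -/
lemma counit_mul_face_face (a b : H) :
    H.ε (a * b) = ∑ ν, H.ε (a * H.face ν) * H.ε (H.face ν * b) := by
  rw [H.counit_mul']
  simp only [counit_face_mul]

lemma ofR_mul_face (a : FaceR K V) (ν : V) : H.ofR a * H.face ν = a ν • H.face ν := by
  rw [face, ← ofR_mul, ofR, ofR, ← map_smul, ← map_smul]
  congr 2
  ext μ
  by_cases h : μ = ν
  · subst h; simp
  · simp [h]

lemma ofRo_mul_faceo (a : FaceR K V) (ν : V) : H.ofRo a * H.faceo ν = a ν • H.faceo ν := by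
  rw [faceo, ← ofRo_mul, ofRo, ofRo, ← map_smul, ← LinearMap.smul_apply, ← map_smul]
  congr 3
  ext μ
  by_cases h : μ = ν
  · subst h; simp
  · simp [h]

lemma face_mul_ofR (a : FaceR K V) (ν : V) : H.face ν * H.ofR a = a ν • H.face ν := by
  rw [← ofR_mul_face, face, ← ofR_mul, mul_comm, ofR_mul]

lemma faceo_mul_ofRo (a : FaceR K V) (ν : V) : H.faceo ν * H.ofRo a = a ν • H.faceo ν := by
  rw [← ofRo_mul_faceo, faceo, ← ofRo_mul, mul_comm, ofRo_mul]

lemma ofR_mul_comul (a : FaceR K V) (x : H) :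
    (H.ofR a ⊗ₜ 1) * H.Δ x = (1 ⊗ₜ H.ofRo a) * H.Δ x := by
  rw [← one_comul, ← mul_assoc, ← mul_assoc]
  congr 1
  simp only [comul_one, Finset.mul_sum, Algebra.TensorProduct.tmul_mul_tmul, one_mul,
    ofR_mul_face, ofRo_mul_faceo, TensorProduct.smul_tmul]

lemma comul_mul_ofR_left (a : FaceR K V) (x : H) :
    H.Δ x * (H.ofR a ⊗ₜ 1) = H.Δ x * (1 ⊗ₜ H.ofRo a) := by
  rw [← comul_one_mul, mul_assoc, mul_assoc]
  congr 1
  simp only [comul_one, Finset.sum_mul, Algebra.TensorProduct.tmul_mul_tmul, mul_one,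
    face_mul_ofR, faceo_mul_ofRo, TensorProduct.smul_tmul]

end FaceAlg

/-! ### Comodules over a face algebra -/

namespace FaceAlg

variable {K V : Type u} [Field K] [Fintype V] [DecidableEq V]

/-- A finite-dimensional right comodule of `H`. -/
structure Com (H : FaceAlg K V) where
  carrier : Type u
  [addCommGroup : AddCommGroup carrier]
  [module : Module K carrier]
  [finite : Module.Finite K carrier]
  δ : carrier →ₗ[K] carrier ⊗[K] H
  coassoc : ∀ m, TensorProduct.assoc K _ _ _ (δ.rTensor H (δ m)) = H.Δ.lTensor carrier (δ m)
  counit_δ : ∀ m, TensorProduct.rid K _ (H.ε.lTensor carrier (δ m)) = m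

namespace Com

variable {H : FaceAlg K V}

instance : CoeSort (Com H) (Type u) := ⟨Com.carrier⟩

attribute [instance] Com.addCommGroup Com.module Com.finite

/-- Maps of comodules. -/
structure Hom (M N : Com H) where
  lin : M →ₗ[K] N
  comm : ∀ m, N.δ (lin m) = lin.rTensor H (M.δ m)

attribute [simp] Hom.comm

/-- The category `com(H)` of finite-dimensional right comodules of `H`. -/
instance : Category (Com H) where
  Hom M N := Hom M N
  id M := ⟨LinearMap.id, fun m => by simp⟩
  comp f g := ⟨g.lin ∘ₗ f.lin, fun m => by simp [LinearMap.rTensor_comp]⟩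

@[simp] lemma lin_id (M : Com H) : Hom.lin (𝟙 M) = LinearMap.id := rfl

@[simp] lemma lin_comp {M N P : Com H} (f : M ⟶ N) (g : N ⟶ P) :
    Hom.lin (f ≫ g) = g.lin ∘ₗ f.lin := rfl

lemma Hom.lin_injective {M N : Com H} : Function.Injective (fun f : M ⟶ N => f.lin) := by
  rintro ⟨f, _⟩ ⟨g, _⟩ (h : f = g)
  subst h
  rfl

lemma hom_ext {M N : Com H} {f g : M ⟶ N} (h : ∀ m, f.lin m = g.lin m) : f = g :=
  Hom.lin_injective (LinearMap.ext h)

section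

variable {M N : Com H}

instance : Zero (M ⟶ N) := ⟨⟨0, by simp⟩⟩
instance : Add (M ⟶ N) := ⟨fun f g => ⟨f.lin + g.lin, by simp [LinearMap.rTensor_add]⟩⟩
instance : Neg (M ⟶ N) := ⟨fun f => ⟨-f.lin, by simp [LinearMap.rTensor_neg]⟩⟩
instance : Sub (M ⟶ N) := ⟨fun f g => ⟨f.lin - g.lin, by simp [LinearMap.rTensor_sub]⟩⟩
instance : SMul K (M ⟶ N) := ⟨fun c f => ⟨c • f.lin, by simp [LinearMap.rTensor_smul]⟩⟩
instance : SMul ℕ (M ⟶ N) := ⟨fun c f => ⟨c • f.lin, fun m => by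
  rw [← Nat.cast_smul_eq_nsmul K c f.lin]; simp [LinearMap.rTensor_smul]⟩⟩
instance : SMul ℤ (M ⟶ N) := ⟨fun c f => ⟨c • f.lin, fun m => by
  rw [← Int.cast_smul_eq_zsmul K c f.lin]; simp [LinearMap.rTensor_smul]⟩⟩

instance : AddCommGroup (M ⟶ N) :=
  Hom.lin_injective.addCommGroup _ rfl (fun _ _ => rfl) (fun _ => rfl)
    (fun _ _ => rfl) (fun _ _ => rfl) (fun _ _ => rfl)

instance : Module K (M ⟶ N) :=
  Hom.lin_injective.module K ⟨⟨fun f : M ⟶ N => f.lin, rfl⟩, fun _ _ => rfl⟩ (fun _ _ => rfl)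

end

instance instPreadditive : Preadditive (Com H) where
  add_comp _ _ _ _ _ g := Hom.lin_injective (LinearMap.comp_add _ _ g.lin)
  comp_add _ _ _ _ _ _ := Hom.lin_injective (LinearMap.add_comp _ _ _)

instance : Linear K (Com H) where
  smul_comp _ _ _ _ _ g := Hom.lin_injective (LinearMap.comp_smul g.lin _ _)
  comp_smul _ _ _ _ _ _ := Hom.lin_injective (LinearMap.smul_comp _ _ _)

/-! The `R`-bimodule structure of a comodule. -/

/-- The map `m ⊗ x ↦ φ(x) m`. -/
def contract {M : Type*} [AddCommGroup M] [Module K M] {A : Type*} [AddCommGroup A] [Module K A]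
    (φ : A →ₗ[K] K) : M ⊗[K] A →ₗ[K] M :=
  (TensorProduct.rid K M).toLinearMap ∘ₗ φ.lTensor M

@[simp] lemma contract_tmul {M : Type*} [AddCommGroup M] [Module K M]
    {A : Type*} [AddCommGroup A] [Module K A] (φ : A →ₗ[K] K) (m : M) (x : A) :
    contract φ (m ⊗ₜ x) = φ x • m := by simp [contract]

lemma δ_contract (M : Com H) (φ : H →ₗ[K] K) (t : M ⊗[K] H) :
    M.δ (contract φ t) =
      (contract φ).lTensor M (TensorProduct.assoc K _ _ _ (M.δ.rTensor H t)) := by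
  induction t using TensorProduct.induction_on with
  | zero => simp
  | add t s ht hs => simp only [map_add, ht, hs]
  | tmul m x =>
    rw [contract_tmul, map_smul, LinearMap.rTensor_tmul]
    induction M.δ m using TensorProduct.induction_on with
    | zero => simp
    | add t s ht hs => simp only [map_add, smul_add, TensorProduct.add_tmul, ht, hs]
    | tmul n y => simp

/-- `m ↦ ∑ φ(m₁) m₀`. -/
def act (M : Com H) (φ : H →ₗ[K] K) : M →ₗ[K] M := contract φ ∘ₗ M.δ

lemma act_counit (M : Com H) (m : M) : M.act H.ε m = m := M.counit_δ m

lemma δ_act (M : Com H) (φ : H →ₗ[K] K) (m : M) :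
    M.δ (M.act φ m) = (contract φ ∘ₗ H.Δ).lTensor M (M.δ m) := by
  rw [act, LinearMap.comp_apply, δ_contract, M.coassoc, LinearMap.lTensor_comp]
  rfl

lemma contract_lTensor {M : Type*} [AddCommGroup M] [Module K M] {A B : Type*} [AddCommGroup A]
    [Module K A] [AddCommGroup B] [Module K B] (f : A →ₗ[K] B) (φ : B →ₗ[K] K) (t : M ⊗[K] A) :
    contract φ (f.lTensor M t) = contract (φ ∘ₗ f) t := by
  simp [contract, LinearMap.lTensor_comp]

lemma act_act (M : Com H) (φ ψ : H →ₗ[K] K) (m : M) :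
    M.act φ (M.act ψ m) = M.act (φ ∘ₗ contract ψ ∘ₗ H.Δ) m := by
  rw [act, LinearMap.comp_apply, δ_act, contract_lTensor]
  rfl

variable (H) in
/-- The functional `x ↦ ε(a x)` on `H`. -/
def εl (a : FaceR K V) : H →ₗ[K] K := H.ε ∘ₗ LinearMap.mulLeft K (H.ofR a)

variable (H) in
/-- The functional `x ↦ ε(x a)` on `H`. -/
def εr (a : FaceR K V) : H →ₗ[K] K := H.ε ∘ₗ LinearMap.mulRight K (H.ofR a)

lemma contract_counit_comul (x : H) : contract H.ε (H.Δ x) = x := by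
  have := Coalgebra.lTensor_counit_comul (R := K) x
  simp only [contract, LinearMap.comp_apply, this]
  simp

lemma contract_εl (a : FaceR K V) : contract (εl H a) ∘ₗ H.Δ = LinearMap.mulLeft K (H.ofR a) := by
  ext x
  have h (t : H ⊗[K] H) : contract (εl H a) t = contract H.ε ((1 ⊗ₜ H.ofR a) * t) := by
    induction t using TensorProduct.induction_on with
    | zero => simp
    | add t s ht hs => simp only [map_add, mul_add, ht, hs]
    | tmul n y => simp [εl]
  rw [LinearMap.comp_apply, h, ← comul_ofR_mul, contract_counit_comul, LinearMap.mulLeft_apply]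

lemma contract_εr (a : FaceR K V) : contract (εr H a) ∘ₗ H.Δ = LinearMap.mulRight K (H.ofR a) := by
  ext x
  have h (t : H ⊗[K] H) : contract (εr H a) t = contract H.ε (t * (1 ⊗ₜ H.ofR a)) := by
    induction t using TensorProduct.induction_on with
    | zero => simp
    | add t s ht hs => simp only [map_add, add_mul, ht, hs]
    | tmul n y => simp [εr]
  rw [LinearMap.comp_apply, h, ← comul_mul_ofR, contract_counit_comul, LinearMap.mulRight_apply]

/-- The left action `a m = ∑ m₀ ε(a m₁)`. -/
def actL (M : Com H) (a : FaceR K V) : M →ₗ[K] M := M.act (εl H a)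

/-- The right action `m a = ∑ m₀ ε(m₁ a)`. -/
def actR (M : Com H) (a : FaceR K V) : M →ₗ[K] M := M.act (εr H a)

lemma δ_actL (M : Com H) (a : FaceR K V) (m : M) :
    M.δ (M.actL a m) = (LinearMap.mulLeft K (H.ofR a)).lTensor M (M.δ m) := by
  rw [actL, δ_act, contract_εl]

lemma δ_actR (M : Com H) (a : FaceR K V) (m : M) :
    M.δ (M.actR a m) = (LinearMap.mulRight K (H.ofR a)).lTensor M (M.δ m) := by
  rw [actR, δ_act, contract_εr]

/-- The map `x ⊗ y ↦ φ(x) y`. -/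
def contractLeft (φ : H →ₗ[K] K) : H ⊗[K] H →ₗ[K] H :=
  (TensorProduct.lid K H).toLinearMap ∘ₗ φ.rTensor H

@[simp] lemma contractLeft_tmul (φ : H →ₗ[K] K) (x y : H) :
    contractLeft φ (x ⊗ₜ y) = φ x • y := by simp [contractLeft]

lemma rTensor_act (M : Com H) (φ : H →ₗ[K] K) (m : M) :
    (M.act φ).rTensor H (M.δ m) = (contractLeft φ ∘ₗ H.Δ).lTensor M (M.δ m) := by
  rw [LinearMap.lTensor_comp, LinearMap.comp_apply, ← M.coassoc]
  induction M.δ m using TensorProduct.induction_on with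
  | zero => simp
  | add t s ht hs => simp only [map_add, ht, hs]
  | tmul n x =>
    rw [LinearMap.rTensor_tmul, LinearMap.rTensor_tmul, act, LinearMap.comp_apply]
    induction M.δ n using TensorProduct.induction_on with
    | zero => simp
    | add t s ht hs => simp only [map_add, TensorProduct.add_tmul, ht, hs]
    | tmul n y => simp [TensorProduct.smul_tmul]

lemma contractLeft_counit_comul (x : H) : contractLeft H.ε (H.Δ x) = x := by
  have := Coalgebra.rTensor_counit_comul (R := K) x
  simp only [contractLeft, LinearMap.comp_apply, this]
  simp

lemma contractLeft_εl (a : FaceR K V) :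
    contractLeft (εl H a) ∘ₗ H.Δ = LinearMap.mulLeft K (H.ofRo a) := by
  ext x
  have h (t : H ⊗[K] H) : contractLeft (εl H a) t = contractLeft H.ε ((H.ofR a ⊗ₜ 1) * t) := by
    induction t using TensorProduct.induction_on with
    | zero => simp
    | add t s ht hs => simp only [map_add, mul_add, ht, hs]
    | tmul n y => simp [εl]
  have h' (t : H ⊗[K] H) : contractLeft H.ε ((1 ⊗ₜ H.ofRo a) * t) =
      H.ofRo a * contractLeft H.ε t := by
    induction t using TensorProduct.induction_on with
    | zero => simp
    | add t s ht hs => simp only [map_add, mul_add, ht, hs]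
    | tmul n y => simp
  rw [LinearMap.comp_apply, h, ofR_mul_comul, h', contractLeft_counit_comul,
    LinearMap.mulLeft_apply]

lemma contractLeft_εr (a : FaceR K V) :
    contractLeft (εr H a) ∘ₗ H.Δ = LinearMap.mulRight K (H.ofRo a) := by
  ext x
  have h (t : H ⊗[K] H) : contractLeft (εr H a) t = contractLeft H.ε (t * (H.ofR a ⊗ₜ 1)) := by
    induction t using TensorProduct.induction_on with
    | zero => simp
    | add t s ht hs => simp only [map_add, add_mul, ht, hs]
    | tmul n y => simp [εr]
  have h' (t : H ⊗[K] H) : contractLeft H.ε (t * (1 ⊗ₜ H.ofRo a)) =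
      contractLeft H.ε t * H.ofRo a := by
    induction t using TensorProduct.induction_on with
    | zero => simp
    | add t s ht hs => simp only [map_add, add_mul, ht, hs]
    | tmul n y => simp
  rw [LinearMap.comp_apply, h, comul_mul_ofR_left, h', contractLeft_counit_comul,
    LinearMap.mulRight_apply]

lemma rTensor_actL (M : Com H) (a : FaceR K V) (m : M) :
    (M.actL a).rTensor H (M.δ m) = (LinearMap.mulLeft K (H.ofRo a)).lTensor M (M.δ m) := by
  rw [actL, rTensor_act, contractLeft_εl]

lemma rTensor_actR (M : Com H) (a : FaceR K V) (m : M) :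
    (M.actR a).rTensor H (M.δ m) = (LinearMap.mulRight K (H.ofRo a)).lTensor M (M.δ m) := by
  rw [actR, rTensor_act, contractLeft_εr]

lemma act_actL (M : Com H) (φ : H →ₗ[K] K) (a : FaceR K V) (m : M) :
    M.act φ (M.actL a m) = M.act (φ ∘ₗ LinearMap.mulLeft K (H.ofR a)) m := by
  rw [actL, act_act, contract_εl]

lemma act_actR (M : Com H) (φ : H →ₗ[K] K) (a : FaceR K V) (m : M) :
    M.act φ (M.actR a m) = M.act (φ ∘ₗ LinearMap.mulRight K (H.ofR a)) m := by
  rw [actR, act_act, contract_εr]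

lemma actL_mul (M : Com H) (a b : FaceR K V) (m : M) :
    M.actL (a * b) m = M.actL a (M.actL b m) := by
  refine Eq.trans ?_ (M.act_actL (εl H a) b m).symm
  rw [actL]
  congr 2
  ext x
  simp [εl, ofR_mul]

lemma actR_mul (M : Com H) (a b : FaceR K V) (m : M) :
    M.actR (a * b) m = M.actR a (M.actR b m) := by
  refine Eq.trans ?_ (M.act_actR (εr H a) b m).symm
  rw [mul_comm, actR]
  congr 2
  ext x
  simp [εr, ofR_mul, mul_assoc]

lemma actL_actR (M : Com H) (a b : FaceR K V) (m : M) :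
    M.actL a (M.actR b m) = M.act
      (H.ε ∘ₗ LinearMap.mulLeft K (H.ofR a) ∘ₗ LinearMap.mulRight K (H.ofR b)) m :=
  M.act_actR (εl H a) b m

lemma actR_actL (M : Com H) (a b : FaceR K V) (m : M) :
    M.actR b (M.actL a m) = M.actL a (M.actR b m) := by
  rw [actL_actR]
  refine (M.act_actL (εr H b) a m).trans ?_
  congr 2
  ext x
  simp [εr, mul_assoc]

variable (H) in
lemma ofR_add (a b : FaceR K V) : H.ofR (a + b) = H.ofR a + H.ofR b := by simp [ofR]

variable (H) in
lemma ofR_smul (c : K) (a : FaceR K V) : H.ofR (c • a) = c • H.ofR a := by simp [ofR]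

lemma act_add (M : Com H) (φ ψ : H →ₗ[K] K) : M.act (φ + ψ) = M.act φ + M.act ψ := by
  ext m; simp [act, contract, LinearMap.lTensor_add]

lemma act_smul (M : Com H) (c : K) (φ : H →ₗ[K] K) : M.act (c • φ) = c • M.act φ := by
  ext m; simp [act, contract, LinearMap.lTensor_smul]

/-- The `R`-bimodule structure of a comodule, with `a m b = ∑ m₀ ε(a m₁ b)`. -/
def bimod (M : Com H) : Bimod K (FaceR K V) where
  carrier := M
  left := AlgHom.ofLinearMap
    { toFun := M.actL
      map_add' a b := by
        rw [actL, actL, actL, ← act_add]; congr 1; ext x; simp [εl, ofR_add, add_mul]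
      map_smul' c a := by
        rw [actL, actL, RingHom.id_apply, ← act_smul]; congr 1; ext x; simp [εl, ofR_smul] }
    (LinearMap.ext fun m => by
      refine Eq.trans ?_ (M.act_counit m)
      change M.act (εl H 1) m = _
      congr 2; ext x; simp [εl, ofR_one])
    (fun a b => LinearMap.ext (M.actL_mul a b))
  right := AlgHom.ofLinearMap
    { toFun := M.actR
      map_add' a b := by
        rw [actR, actR, actR, ← act_add]; congr 1; ext x; simp [εr, ofR_add, mul_add]
      map_smul' c a := by
        rw [actR, actR, RingHom.id_apply, ← act_smul]; congr 1; ext x; simp [εr, ofR_smul] }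
    (LinearMap.ext fun m => by
      refine Eq.trans ?_ (M.act_counit m)
      change M.act (εr H 1) m = _
      congr 2; ext x; simp [εr, ofR_one])
    (fun a b => LinearMap.ext (M.actR_mul a b))
  left_right a b m := (M.actR_actL a b m).symm

lemma bimod_left (M : Com H) (a : FaceR K V) (m : M) : M.bimod.left a m = M.actL a m := rfl
lemma bimod_right (M : Com H) (a : FaceR K V) (m : M) : M.bimod.right a m = M.actR a m := rfl

/-- The formula `a m b = ∑ m₀ ε(a m₁ b)`. -/
lemma bimod_left_right (M : Com H) (a b : FaceR K V) (m : M) :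
    M.bimod.left a (M.bimod.right b m) = TensorProduct.rid K M
      ((H.ε ∘ₗ LinearMap.mulLeft K (H.ofR a) ∘ₗ LinearMap.mulRight K (H.ofR b)).lTensor M
        (M.δ m)) := M.actL_actR a b m

lemma Hom.act_lin {M N : Com H} (f : M ⟶ N) (φ : H →ₗ[K] K) (m : M) :
    f.lin (M.act φ m) = N.act φ (f.lin m) := by
  simp only [act, LinearMap.comp_apply, f.comm]
  induction M.δ m using TensorProduct.induction_on with
  | zero => simp
  | add t s ht hs => simp only [map_add, ht, hs]
  | tmul n y => simp

variable (H) in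
/-- The forgetful functor from comodules to `R`-bimodules. -/
def forget : Com H ⥤ Bimod K (FaceR K V) where
  obj M := M.bimod
  map {M N} f :=
    { lin := f.lin
      map_left := fun a m => f.act_lin (εl H a) m
      map_right := fun a m => f.act_lin (εr H a) m }

instance : (forget H).Faithful where
  map_injective h :=
    hom_ext fun m => LinearMap.congr_fun (congrArg Bimod.Hom.lin h) m

end Com

end FaceAlg

namespace FaceAlg.Com

/-! ### The tensor product of comodules -/

section

variable {K : Type*} [Field K] {M N P A B : Type*} [AddCommGroup M] [AddCommGroup N]
  [AddCommGroup P] [Module K M] [Module K N] [Module K P]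

/-- For bilinear `t`, the bilinear map `(m ⊗ x, n ⊗ y) ↦ t(m, n) ⊗ x y`. -/
def combine (t : M →ₗ[K] N →ₗ[K] P) (A : Type*) [Ring A] [Algebra K A] :
    M ⊗[K] A →ₗ[K] N ⊗[K] A →ₗ[K] P ⊗[K] A :=
  TensorProduct.curry ((TensorProduct.map (TensorProduct.lift t) (LinearMap.mul' K A)) ∘ₗ
    (TensorProduct.tensorTensorTensorComm K M A N A).toLinearMap)

@[simp] lemma combine_tmul (t : M →ₗ[K] N →ₗ[K] P) (A : Type*) [Ring A] [Algebra K A]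
    (m : M) (x : A) (n : N) (y : A) :
    combine t A (m ⊗ₜ x) (n ⊗ₜ y) = t m n ⊗ₜ (x * y) := by
  simp [combine]

/-- To compare bilinear maps on `(M ⊗ A) × (N ⊗ B)` it is enough to consider pure tensors. -/
lemma bil_ind [AddCommGroup A] [AddCommGroup B] [Module K A] [Module K B]
    (f g : M ⊗[K] A →ₗ[K] N ⊗[K] B →ₗ[K] P)
    (h : ∀ m x n y, f (m ⊗ₜ x) (n ⊗ₜ y) = g (m ⊗ₜ x) (n ⊗ₜ y)) (t s) : f t s = g t s := by
  have : f = g := TensorProduct.ext' fun m x => TensorProduct.ext' fun n y => h m x n y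
  rw [this]

end

variable {K V : Type u} [Field K] [Fintype V] [DecidableEq V] {H : FaceAlg K V}

/-- The underlying bimodule of `M ⊗_R N`. -/
abbrev tens (M N : Com H) : Bimod K (FaceR K V) := Bimod.tens M.bimod N.bimod

/-- The bilinear map `(m, n) ↦ m ⊗_R n`. -/
def tm (M N : Com H) : M →ₗ[K] N →ₗ[K] tens M N := Bimod.tmul M.bimod N.bimod

lemma tm_balanced (M N : Com H) (m : M) (a : FaceR K V) (n : N) :
    tm M N (M.actR a m) n = tm M N m (N.actL a n) :=
  Bimod.tmul_balanced (M := M.bimod) (N := N.bimod) m a n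

lemma tm_ind {M N : Com H} {P : Type*} [AddCommGroup P] [Module K P]
    (f g : tens M N →ₗ[K] P) (h : ∀ m n, f (tm M N m n) = g (tm M N m n)) (x : tens M N) :
    f x = g x := Bimod.tens_ind f g h x

lemma combine_balanced (M N : Com H) (m : M) (a : FaceR K V) (n : N) :
    combine (tm M N) H (M.δ (M.actR a m)) (N.δ n) =
      combine (tm M N) H (M.δ m) (N.δ (N.actL a n)) := by
  rw [δ_actR, δ_actL]
  refine bil_ind ((combine (tm M N) H) ∘ₗ (LinearMap.mulRight K (H.ofR a)).lTensor M)
    ((combine (tm M N) H).compl₂ ((LinearMap.mulLeft K (H.ofR a)).lTensor N))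
    (fun m x n y => ?_) _ _
  simp [mul_assoc]

/-- The coaction `m ⊗_R n ↦ ∑ (m₀ ⊗_R n₀) ⊗ m₁ n₁`. -/
def tensδ (M N : Com H) : tens M N →ₗ[K] tens M N ⊗[K] H :=
  Bimod.lift (M := M.bimod) (N := N.bimod) ((combine (tm M N) H).compl₁₂ M.δ N.δ)
    (fun m a n => combine_balanced M N m a n)

@[simp] lemma tensδ_tm (M N : Com H) (m : M) (n : N) :
    tensδ M N (tm M N m n) = combine (tm M N) H (M.δ m) (N.δ n) :=
  Bimod.lift_tmul (M := M.bimod) (N := N.bimod) ((combine (tm M N) H).compl₁₂ M.δ N.δ) _ m n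

lemma tensδ_coassoc (M N : Com H) (x : tens M N) :
    TensorProduct.assoc K _ _ _ ((tensδ M N).rTensor H (tensδ M N x)) =
      H.Δ.lTensor (tens M N) (tensδ M N x) := by
  refine tm_ind ((TensorProduct.assoc K _ _ _).toLinearMap ∘ₗ
    (tensδ M N).rTensor H ∘ₗ tensδ M N) (H.Δ.lTensor (tens M N) ∘ₗ tensδ M N) (fun m n => ?_) x
  simp only [LinearMap.comp_apply, tensδ_tm, LinearEquiv.coe_coe]
  have h₁ : H.Δ.lTensor (tens M N) (combine (tm M N) H (M.δ m) (N.δ n)) =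
      combine (tm M N) (H ⊗[K] H) (H.Δ.lTensor M (M.δ m)) (H.Δ.lTensor N (N.δ n)) := by
    refine bil_ind ((combine (tm M N) H).compr₂ (H.Δ.lTensor (tens M N)))
      ((combine (tm M N) (H ⊗[K] H)).compl₁₂ (H.Δ.lTensor M) (H.Δ.lTensor N))
      (fun m x n y => ?_) _ _
    simp [H.comul_mul]
  rw [h₁, ← M.coassoc, ← N.coassoc]
  refine bil_ind ((combine (tm M N) H).compr₂ ((TensorProduct.assoc K _ _ _).toLinearMap ∘ₗ
      (tensδ M N).rTensor H))
    ((combine (tm M N) (H ⊗[K] H)).compl₁₂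
      ((TensorProduct.assoc K _ _ _).toLinearMap ∘ₗ M.δ.rTensor H)
      ((TensorProduct.assoc K _ _ _).toLinearMap ∘ₗ N.δ.rTensor H))
    (fun m x n y => ?_) _ _
  simp only [LinearMap.compr₂_apply, LinearMap.compl₁₂_apply, combine_tmul, LinearMap.comp_apply,
    LinearMap.rTensor_tmul, tensδ_tm, LinearEquiv.coe_coe]
  refine bil_ind ((combine (tm M N) H).compr₂ ((TensorProduct.assoc K _ _ _).toLinearMap ∘ₗ
      (TensorProduct.mk K _ _).flip (x * y)))
    ((combine (tm M N) (H ⊗[K] H)).compl₁₂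
      ((TensorProduct.assoc K _ _ _).toLinearMap ∘ₗ (TensorProduct.mk K _ _).flip x)
      ((TensorProduct.assoc K _ _ _).toLinearMap ∘ₗ (TensorProduct.mk K _ _).flip y))
    (fun m x n y => ?_) _ _
  simp

/-- The functional `x ↦ ε(a x b)`. -/
def εlr (a b : FaceR K V) : H →ₗ[K] K :=
  H.ε ∘ₗ LinearMap.mulLeft K (H.ofR a) ∘ₗ LinearMap.mulRight K (H.ofR b)

lemma sum_left (M : Bimod K (FaceR K V)) (m : M) : ∑ ν, M.left (Pi.single ν 1) m = m := by
  have h₄ : ∑ ν : V, (Pi.single ν 1 : FaceR K V) = 1 := by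
    simpa using FaceE.sum_single (1 : FaceR K V)
  have h₅ := LinearMap.congr_fun (congrArg M.left h₄) m
  rwa [map_sum, map_one, LinearMap.sum_apply] at h₅

variable (H) in
lemma sum_faceo : ∑ ν, H.faceo ν = 1 := by
  have h₄ : ∑ ν : V, (Pi.single ν 1 : FaceR K V) = 1 := by
    simpa using FaceE.sum_single (1 : FaceR K V)
  simp only [faceo, ofRo, ← map_sum, ← LinearMap.sum_apply, h₄, FaceE.mk_one, map_one]

lemma contract_εlr (M N : Com H) (a b : FaceR K V) (m : M) (n : N) :
    contract (εlr a b) (tensδ M N (tm M N m n)) = tm M N (M.actL a m) (N.actR b n) := by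
  rw [tensδ_tm]
  have h : contract (εlr a b) (combine (tm M N) H (M.δ m) (N.δ n)) =
      ∑ ν, tm M N (contract (εlr a (Pi.single ν 1)) (M.δ m))
        (contract (εlr (Pi.single ν 1) b) (N.δ n)) := by
    refine (bil_ind ((combine (tm M N) H).compr₂ (contract (εlr a b)))
      (∑ ν, (tm M N).compl₁₂ (contract (εlr a (Pi.single ν 1)))
        (contract (εlr (Pi.single ν 1) b))) (fun m x n y => ?_) _ _).trans ?_
    · have e : H.ε (H.ofR a * (x * y * H.ofR b)) =
          ∑ ν, H.ε (H.ofR a * (x * H.face ν)) * H.ε (H.face ν * (y * H.ofR b)) := by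
        rw [show H.ofR a * (x * y * H.ofR b) = (H.ofR a * x) * (y * H.ofR b) by
          simp only [mul_assoc], counit_mul_face_face]
        simp only [mul_assoc]
      simp only [LinearMap.compr₂_apply, combine_tmul, contract_tmul, LinearMap.sum_apply,
        LinearMap.compl₁₂_apply, εlr, LinearMap.comp_apply, LinearMap.mulLeft_apply,
        LinearMap.mulRight_apply, map_smul, LinearMap.smul_apply, e, Finset.sum_smul, smul_smul]
      refine Finset.sum_congr rfl fun ν _ => ?_
      rw [mul_comm]
      rfl
    · simp [LinearMap.sum_apply]
  rw [h]
  have h₁ (m : M) (a b : FaceR K V) : contract (εlr a b) (M.δ m) = M.actL a (M.actR b m) :=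
    (M.actL_actR a b m).symm
  have h₂ (n : N) (a b : FaceR K V) : contract (εlr a b) (N.δ n) = N.actL a (N.actR b n) :=
    (N.actL_actR a b n).symm
  simp only [h₁, h₂]
  have h₃ (ν : V) : tm M N (M.actL a (M.actR (Pi.single ν 1) m))
      (N.actL (Pi.single ν 1) (N.actR b n)) =
      tm M N (M.actL a m) (N.actL (Pi.single ν 1) (N.actR b n)) := by
    rw [← actR_actL, tm_balanced, ← actL_mul, ← Pi.single_mul, one_mul]
  simp only [h₃, ← map_sum]
  congr 1
  exact sum_left N.bimod (N.actR b n)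

lemma εlr_one : εlr (H := H) 1 1 = H.ε := by
  ext x
  simp [εlr, ofR_one]

lemma εlr_left (a : FaceR K V) : εlr (H := H) a 1 = εl H a := by
  ext x
  simp [εlr, εl, ofR_one]

lemma εlr_right (a : FaceR K V) : εlr (H := H) 1 a = εr H a := by
  ext x
  simp [εlr, εr, ofR_one]

lemma actL_one (M : Com H) (m : M) : M.actL 1 m = m :=
  LinearMap.congr_fun (map_one M.bimod.left) m

lemma actR_one (M : Com H) (m : M) : M.actR 1 m = m :=
  LinearMap.congr_fun (map_one M.bimod.right) m

lemma tens_finite (M N : Com H) : Module.Finite K (tens M N) :=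
  have : Module.Finite K M.bimod := M.finite
  have : Module.Finite K N.bimod := N.finite
  inferInstanceAs (Module.Finite K ((M.bimod ⊗[K] N.bimod) ⧸ Bimod.balanced M.bimod N.bimod))

/-- The tensor product comodule `M ⊗_R N`. -/
def tensor (M N : Com H) : Com H where
  carrier := tens M N
  finite := tens_finite M N
  δ := tensδ M N
  coassoc := tensδ_coassoc M N
  counit_δ x := by
    refine tm_ind (contract H.ε ∘ₗ tensδ M N) LinearMap.id (fun m n => ?_) x
    rw [← εlr_one, LinearMap.comp_apply, contract_εlr, actL_one, actR_one, LinearMap.id_apply]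

/-- The coaction `a ↦ ∑ ν, ν ⊗ ν° a` on `R`. -/
def unitδ (H : FaceAlg K V) : FaceR K V →ₗ[K] FaceR K V ⊗[K] H :=
  ∑ ν, TensorProduct.mk K (FaceR K V) H (Pi.single ν 1) ∘ₗ H.incl.toLinearMap ∘ₗ
    FaceE.mk (Pi.single ν 1)

lemma unitδ_apply (a : FaceR K V) :
    unitδ H a = ∑ ν, (Pi.single ν 1 : FaceR K V) ⊗ₜ H.incl (FaceE.mk (Pi.single ν 1) a) := by
  simp [unitδ, LinearMap.sum_apply]

/-- The regular comodule structure on `R`, the unit object of `com(H)`. -/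
def unit (H : FaceAlg K V) : Com H where
  carrier := FaceR K V
  δ := unitδ H
  coassoc a := by
    simp only [unitδ_apply, map_sum, LinearMap.rTensor_tmul, LinearMap.lTensor_tmul,
      H.comul_incl, FaceE.comul_mk, TensorProduct.sum_tmul, TensorProduct.tmul_sum,
      TensorProduct.assoc_tmul, TensorProduct.map_tmul, AlgHom.toLinearMap_apply]
    exact Finset.sum_comm
  counit_δ a := by
    simp only [unitδ_apply, map_sum, LinearMap.lTensor_tmul, H.counit_incl, FaceE.counit_mk,
      TensorProduct.rid_tmul]
    simp only [Pi.single_apply, ite_mul, one_mul, zero_mul, Finset.sum_ite_eq',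
      Finset.mem_univ, if_true]
    exact FaceE.sum_single a

lemma tensor_actL (M N : Com H) (a : FaceR K V) (m : M) (n : N) :
    (tensor M N).actL a (tm M N m n) = tm M N (M.actL a m) n := by
  change contract (εl H a) (tensδ M N (tm M N m n)) = _
  rw [← εlr_left, contract_εlr, actR_one]

lemma tensor_actR (M N : Com H) (a : FaceR K V) (m : M) (n : N) :
    (tensor M N).actR a (tm M N m n) = tm M N m (N.actR a n) := by
  change contract (εr H a) (tensδ M N (tm M N m n)) = _
  rw [← εlr_right, contract_εlr, actL_one]

/-- The comparison `U M ⊗_R U N ≅ U (M ⊗ N)` of bimodules, the identity on elements. -/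
def μIso (M N : Com H) : Bimod.tens M.bimod N.bimod ≅ (tensor M N).bimod :=
  Bimod.isoMk
    { lin := (LinearMap.id : tens M N →ₗ[K] tens M N)
      map_left := fun a => tm_ind ((Bimod.tens M.bimod N.bimod).left a) ((tensor M N).actL a)
        (fun m n => (tensor_actL M N a m n).symm)
      map_right := fun a => tm_ind ((Bimod.tens M.bimod N.bimod).right a) ((tensor M N).actR a)
        (fun m n => (tensor_actR M N a m n).symm) }
    (LinearMap.id : tens M N →ₗ[K] tens M N) (fun _ => rfl) (fun _ => rfl)

lemma act_unit (φ : H →ₗ[K] K) (a : FaceR K V) :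
    (unit H).act φ a = ∑ ν, φ (H.incl (FaceE.mk (Pi.single ν 1) a)) •
      (Pi.single ν 1 : FaceR K V) := by
  change contract φ (unitδ H a) = _
  simp [unitδ_apply]

lemma unit_actL (a b : FaceR K V) : (unit H).actL a b = a * b := by
  refine (act_unit (εl H a) b).trans ?_
  have h (ν : V) : εl H a (H.incl (FaceE.mk (Pi.single ν 1) b)) = (a * b) ν := by
    rw [εl, LinearMap.comp_apply, LinearMap.mulLeft_apply, ofR, ← map_mul, FaceE.mk_mul,
      H.counit_incl, FaceE.counit_mk]
    simp [Pi.single_apply]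
  simp only [h]
  exact FaceE.sum_single (a * b)

lemma unit_actR (a b : FaceR K V) : (unit H).actR a b = a * b := by
  refine (act_unit (εr H a) b).trans ?_
  have h (ν : V) : εr H a (H.incl (FaceE.mk (Pi.single ν 1) b)) = (a * b) ν := by
    rw [εr, LinearMap.comp_apply, LinearMap.mulRight_apply, ofR, ← map_mul, FaceE.mk_mul,
      H.counit_incl, FaceE.counit_mk]
    simp [Pi.single_apply, mul_comm]
  simp only [h]
  exact FaceE.sum_single (a * b)

variable (H) in
/-- The comparison of the regular bimodule with the bimodule of the unit comodule, the identity
on elements. -/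
def εIso : Bimod.unit K (FaceR K V) ≅ (unit H).bimod :=
  Bimod.isoMk
    { lin := (LinearMap.id : FaceR K V →ₗ[K] FaceR K V)
      map_left := fun a b => (unit_actL (H := H) a b).symm
      map_right := fun a b => (unit_actR (H := H) a b).symm }
    (LinearMap.id : FaceR K V →ₗ[K] FaceR K V) (fun _ => rfl) (fun _ => rfl)

/-- A comodule isomorphism from mutually inverse linear maps. -/
def isoMk {M N : Com H} (f : M ⟶ N) (g : N →ₗ[K] M)
    (h₁ : ∀ m, g (f.lin m) = m) (h₂ : ∀ n, f.lin (g n) = n) : M ≅ N where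
  hom := f
  inv := ⟨g, fun n => by
    conv_rhs => rw [← h₂ n, f.comm]
    rw [← LinearMap.comp_apply (LinearMap.rTensor H g), ← LinearMap.rTensor_comp,
      show g ∘ₗ f.lin = LinearMap.id from LinearMap.ext h₁]
    simp⟩
  hom_inv_id := hom_ext h₁
  inv_hom_id := hom_ext h₂

/-- The bilinear map `(m, n) ↦ m ⊗_R n` with values in the tensor product comodule. -/
def tmul (M N : Com H) : M →ₗ[K] N →ₗ[K] tensor M N := tm M N

lemma tensor_δ (M N : Com H) (m : M) (n : N) :
    (tensor M N).δ (tmul M N m n) = combine (tmul M N) H (M.δ m) (N.δ n) := tensδ_tm M N m n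

lemma tensor_ind {M N : Com H} {P : Type*} [AddCommGroup P] [Module K P]
    (f g : tensor M N →ₗ[K] P) (h : ∀ m n, f (tmul M N m n) = g (tmul M N m n)) (x : tensor M N) :
    f x = g x := tm_ind f g h x

lemma tensor₃_ind {M N P : Com H} {Q : Type*} [AddCommGroup Q] [Module K Q]
    (f g : tensor (tensor M N) P →ₗ[K] Q)
    (h : ∀ m n p, f (tmul _ _ (tmul _ _ m n) p) = g (tmul _ _ (tmul _ _ m n) p)) (x) :
    f x = g x :=
  tensor_ind f g (fun x p => tensor_ind (f ∘ₗ (tmul _ _).flip p) (g ∘ₗ (tmul _ _).flip p)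
    (fun m n => h m n p) x) x

/-- The linear map underlying a map of bimodules between comodules. -/
def linOf {M N : Com H} (f : M.bimod ⟶ N.bimod) : M →ₗ[K] N := f.lin

/-- The bimodule map induced by a comodule map. -/
abbrev toB {M N : Com H} (f : M ⟶ N) : M.bimod ⟶ N.bimod := (forget H).map f

/-- The linear map `f ⊗_R g`. -/
def tensorLin {M N M' N' : Com H} (f : M ⟶ M') (g : N ⟶ N') : tensor M N →ₗ[K] tensor M' N' :=
  linOf ((μIso M N).inv ≫ (toB f ⊗ₘ toB g) ≫ (μIso M' N').hom)

lemma tensorLin_tmul {M N M' N' : Com H} (f : M ⟶ M') (g : N ⟶ N') (m : M) (n : N) :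
    tensorLin f g (tmul M N m n) = tmul M' N' (f.lin m) (g.lin n) :=
  Bimod.tensHom_tmul (toB f) (toB g) m n

/-- The comodule map `f ⊗_R g`. -/
def tensorHom {M N M' N' : Com H} (f : M ⟶ M') (g : N ⟶ N') : tensor M N ⟶ tensor M' N' where
  lin := tensorLin f g
  comm := tensor_ind ((tensor M' N').δ ∘ₗ tensorLin f g)
    ((tensorLin f g).rTensor H ∘ₗ (tensor M N).δ) (fun m n => by
      simp only [LinearMap.comp_apply, tensorLin_tmul, tensor_δ, f.comm, g.comm]
      refine bil_ind ((combine (tmul M' N') H).compl₁₂ (f.lin.rTensor H) (g.lin.rTensor H))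
        ((combine (tmul M N) H).compr₂ ((tensorLin f g).rTensor H)) (fun m x n y => ?_) _ _
      simp [tensorLin_tmul])

/-- The bimodule isomorphism underlying the associativity constraint. -/
def assocB (M N P : Com H) :
    (tensor (tensor M N) P).bimod ≅ (tensor M (tensor N P)).bimod :=
  (((μIso (tensor M N) P).symm ≪≫ ((μIso M N).symm ⊗ᵢ .refl P.bimod))
        ≪≫ α_ M.bimod N.bimod P.bimod
        ≪≫ ((.refl M.bimod ⊗ᵢ μIso N P) ≪≫ μIso M (tensor N P)))

lemma assocB_tmul (M N P : Com H) (m : M) (n : N) (p : P) :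
    linOf (assocB M N P).hom (tmul _ _ (tmul _ _ m n) p) = tmul _ _ m (tmul _ _ n p) := by
  have h₁ : (Bimod.tensHom (μIso M N).inv (𝟙 P.bimod)).lin (tmul _ _ (tmul _ _ m n) p) =
      Bimod.tmul _ _ (Bimod.tmul M.bimod N.bimod m n) p :=
    Bimod.tensHom_tmul (μIso M N).inv (𝟙 P.bimod) (tmul M N m n) p
  have h₂ : (Bimod.tensHom (𝟙 M.bimod) (μIso N P).hom).lin
      (Bimod.tmul _ _ m (Bimod.tmul N.bimod P.bimod n p)) =
      tmul _ _ m (tmul _ _ n p) :=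
    Bimod.tensHom_tmul (𝟙 M.bimod) (μIso N P).hom m (tmul N P n p)
  refine Eq.trans ?_ h₂
  refine Eq.trans ?_ (congrArg (Bimod.tensHom (𝟙 M.bimod) (μIso N P).hom).lin
    (Bimod.assoc_hom_tmul M.bimod N.bimod P.bimod m n p))
  refine congrArg (fun x => (Bimod.tensHom (𝟙 M.bimod) (μIso N P).hom).lin
    ((Bimod.assoc M.bimod N.bimod P.bimod).hom.lin x)) h₁

lemma combine_assoc {K M N P MN NP T T' A : Type*} [Field K] [AddCommGroup M] [AddCommGroup N]
    [AddCommGroup P] [AddCommGroup MN] [AddCommGroup NP] [AddCommGroup T] [AddCommGroup T']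
    [Module K M] [Module K N] [Module K P] [Module K MN] [Module K NP] [Module K T] [Module K T']
    [Ring A] [Algebra K A] (t₁ : M →ₗ[K] N →ₗ[K] MN) (t₂ : MN →ₗ[K] P →ₗ[K] T)
    (t₃ : N →ₗ[K] P →ₗ[K] NP) (t₄ : M →ₗ[K] NP →ₗ[K] T') (f : T →ₗ[K] T')
    (h : ∀ m n p, f (t₂ (t₁ m n) p) = t₄ m (t₃ n p)) (x : M ⊗[K] A) (y : N ⊗[K] A)
    (z : P ⊗[K] A) :
    combine t₄ A x (combine t₃ A y z) =
      f.rTensor A (combine t₂ A (combine t₁ A x y) z) := by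
  induction x using TensorProduct.induction_on with
  | zero => simp
  | add x x' hx hx' => simp only [map_add, LinearMap.add_apply, hx, hx']
  | tmul m a =>
    induction y using TensorProduct.induction_on with
    | zero => simp
    | add x x' hx hx' => simp only [map_add, LinearMap.add_apply, hx, hx']
    | tmul n b =>
      induction z using TensorProduct.induction_on with
      | zero => simp
      | add x x' hx hx' => simp only [map_add, hx, hx']
      | tmul p c => simp [h, mul_assoc]

/-- The associativity constraint. -/
def assoc (M N P : Com H) : tensor (tensor M N) P ≅ tensor M (tensor N P) :=
  isoMk
    { lin := linOf (assocB M N P).hom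
      comm := tensor₃_ind ((tensor M (tensor N P)).δ ∘ₗ linOf (assocB M N P).hom)
        ((linOf (assocB M N P).hom).rTensor H ∘ₗ (tensor (tensor M N) P).δ) (fun m n p => by
        simp only [LinearMap.comp_apply, assocB_tmul, tensor_δ]
        exact combine_assoc _ _ _ _ _ (assocB_tmul M N P) _ _ _) }
    (linOf (assocB M N P).inv)
    (fun m => LinearMap.congr_fun (congrArg Bimod.Hom.lin (assocB M N P).hom_inv_id) m)
    (fun m => LinearMap.congr_fun (congrArg Bimod.Hom.lin (assocB M N P).inv_hom_id) m)

/-- The bimodule isomorphism underlying the left unit constraint. -/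
def leftUnitB (M : Com H) : (tensor (unit H) M).bimod ≅ M.bimod :=
  ((μIso (unit H) M).symm ≪≫ ((εIso H).symm ⊗ᵢ .refl M.bimod)) ≪≫ λ_ M.bimod

/-- The bimodule isomorphism underlying the right unit constraint. -/
def rightUnitB (M : Com H) : (tensor M (unit H)).bimod ≅ M.bimod :=
  ((μIso M (unit H)).symm ≪≫ (.refl M.bimod ⊗ᵢ (εIso H).symm)) ≪≫ ρ_ M.bimod

lemma leftUnitB_tmul (M : Com H) (a : unit H) (m : M) :
    linOf (leftUnitB M).hom (tmul _ _ a m) = M.actL a m := by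
  have h₁ : (Bimod.tensHom (εIso H).inv (𝟙 M.bimod)).lin (tmul _ _ a m) =
      Bimod.tmul (Bimod.unit K (FaceR K V)) M.bimod a m :=
    Bimod.tensHom_tmul (εIso H).inv (𝟙 M.bimod) a m
  exact (congrArg (Bimod.leftUnit M.bimod).hom.lin h₁).trans
    (Bimod.leftUnit_hom_tmul M.bimod a m)

lemma rightUnitB_tmul (M : Com H) (m : M) (a : unit H) :
    linOf (rightUnitB M).hom (tmul _ _ m a) = M.actR a m := by
  have h₁ : (Bimod.tensHom (𝟙 M.bimod) (εIso H).inv).lin (tmul _ _ m a) =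
      Bimod.tmul M.bimod (Bimod.unit K (FaceR K V)) m a :=
    Bimod.tensHom_tmul (𝟙 M.bimod) (εIso H).inv m a
  exact (congrArg (Bimod.rightUnit M.bimod).hom.lin h₁).trans
    (Bimod.rightUnit_hom_tmul M.bimod a m)

/-- The map `(a, m) ↦ a ⊗_R m` for `a ∈ R`. -/
def tmulUL (M : Com H) : FaceR K V →ₗ[K] M →ₗ[K] tensor (unit H) M := tmul (unit H) M

/-- The map `(m, a) ↦ m ⊗_R a` for `a ∈ R`. -/
def tmulUR (M : Com H) : M →ₗ[K] FaceR K V →ₗ[K] tensor M (unit H) := tmul M (unit H)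

lemma leftUnitB_tmulUL (M : Com H) (a : FaceR K V) (m : M) :
    linOf (leftUnitB M).hom (tmulUL M a m) = M.actL a m := leftUnitB_tmul M a m

lemma rightUnitB_tmulUR (M : Com H) (m : M) (a : FaceR K V) :
    linOf (rightUnitB M).hom (tmulUR M m a) = M.actR a m := rightUnitB_tmul M m a

lemma leftUnit_comm (M : Com H) (a : FaceR K V) (m : M) :
    M.δ (M.actL a m) = LinearMap.rTensor H (linOf (leftUnitB M).hom)
      (combine (tmulUL M) H (unitδ H a) (M.δ m)) := by
  have h (ν : V) : LinearMap.rTensor H (linOf (leftUnitB M).hom)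
      (combine (tmulUL M) H
        ((Pi.single ν 1 : FaceR K V) ⊗ₜ H.incl (FaceE.mk (Pi.single ν 1) a)) (M.δ m)) =
      (LinearMap.mulLeft K (H.faceo ν * H.ofR a)).lTensor M (M.δ m) := by
    have e : LinearMap.mulLeft K (H.faceo ν * H.ofR a) =
        LinearMap.mulLeft K (H.ofR a * H.faceo ν) ∘ₗ LinearMap.mulLeft K (H.faceo ν) := by
      ext x
      have : H.faceo ν * H.faceo ν = H.faceo ν := by
        rw [faceo, ← ofRo_mul, ← Pi.single_mul, one_mul]
      simp only [LinearMap.mulLeft_apply, LinearMap.comp_apply]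
      rw [← mul_assoc, mul_assoc (H.ofR a), this, faceo, ofRo_ofR, ofR_ofRo]
    rw [e, LinearMap.lTensor_comp, LinearMap.comp_apply, faceo, ← rTensor_actL, ← faceo]
    induction M.δ m using TensorProduct.induction_on with
    | zero => simp
    | add t s ht hs => simp only [map_add, ht, hs]
    | tmul n x =>
      rw [combine_tmul, LinearMap.rTensor_tmul, leftUnitB_tmulUL, LinearMap.rTensor_tmul,
        LinearMap.lTensor_tmul, LinearMap.mulLeft_apply, faceo, ofR_ofRo]
  rw [unitδ_apply, map_sum, LinearMap.sum_apply, map_sum, Finset.sum_congr rfl fun ν _ => h ν,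
    δ_actL]
  have e : LinearMap.mulLeft K (H.ofR a) = ∑ ν, LinearMap.mulLeft K (H.faceo ν * H.ofR a) := by
    ext x
    simp only [LinearMap.mulLeft_apply, LinearMap.sum_apply, ← Finset.sum_mul, sum_faceo, one_mul]
  rw [e]
  induction M.δ m using TensorProduct.induction_on with
  | zero => simp
  | add t s ht hs => simp only [map_add, ht, hs, Finset.sum_add_distrib]
  | tmul n x => simp [LinearMap.sum_apply, TensorProduct.tmul_sum]

lemma rightUnit_comm (M : Com H) (m : M) (a : FaceR K V) :
    M.δ (M.actR a m) = LinearMap.rTensor H (linOf (rightUnitB M).hom)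
      (combine (tmulUR M) H (M.δ m) (unitδ H a)) := by
  have h (ν : V) : LinearMap.rTensor H (linOf (rightUnitB M).hom)
      (combine (tmulUR M) H (M.δ m)
        ((Pi.single ν 1 : FaceR K V) ⊗ₜ H.incl (FaceE.mk (Pi.single ν 1) a))) =
      (LinearMap.mulRight K (H.faceo ν * H.ofR a)).lTensor M (M.δ m) := by
    have e : LinearMap.mulRight K (H.faceo ν * H.ofR a) =
        LinearMap.mulRight K (H.faceo ν * H.ofR a) ∘ₗ LinearMap.mulRight K (H.faceo ν) := by
      ext x
      have : H.faceo ν * H.faceo ν = H.faceo ν := by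
        rw [faceo, ← ofRo_mul, ← Pi.single_mul, one_mul]
      simp only [LinearMap.mulRight_apply, LinearMap.comp_apply]
      rw [mul_assoc x, ← mul_assoc (H.faceo ν), this]
    rw [e, LinearMap.lTensor_comp, LinearMap.comp_apply, faceo, ← rTensor_actR, ← faceo]
    induction M.δ m using TensorProduct.induction_on with
    | zero => simp
    | add t s ht hs => simp only [map_add, LinearMap.add_apply, ht, hs]
    | tmul n x =>
      rw [combine_tmul, LinearMap.rTensor_tmul, rightUnitB_tmulUR, LinearMap.rTensor_tmul,
        LinearMap.lTensor_tmul, LinearMap.mulRight_apply, faceo, ofRo_ofR]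
  rw [unitδ_apply, map_sum, map_sum, Finset.sum_congr rfl fun ν _ => h ν, δ_actR]
  have e : LinearMap.mulRight K (H.ofR a) = ∑ ν, LinearMap.mulRight K (H.faceo ν * H.ofR a) := by
    ext x
    simp only [LinearMap.mulRight_apply, LinearMap.sum_apply, ← Finset.mul_sum, ← Finset.sum_mul,
      sum_faceo, one_mul]
  rw [e]
  induction M.δ m using TensorProduct.induction_on with
  | zero => simp
  | add t s ht hs => simp only [map_add, ht, hs, Finset.sum_add_distrib]
  | tmul n x => simp [LinearMap.sum_apply, TensorProduct.tmul_sum]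

/-- The left unit constraint, as a comodule map. -/
def leftUnitHom (M : Com H) : tensor (unit H) M ⟶ M where
  lin := linOf (leftUnitB M).hom
  comm x := by
    refine tensor_ind (M := unit H) (N := M) (M.δ ∘ₗ linOf (leftUnitB M).hom)
      (LinearMap.rTensor H (linOf (leftUnitB M).hom) ∘ₗ (tensor (unit H) M).δ) (fun a m => ?_) x
    rw [LinearMap.comp_apply, LinearMap.comp_apply, leftUnitB_tmul, tensor_δ]
    exact leftUnit_comm M a m

/-- The right unit constraint, as a comodule map. -/
def rightUnitHom (M : Com H) : tensor M (unit H) ⟶ M where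
  lin := linOf (rightUnitB M).hom
  comm x := by
    refine tensor_ind (M := M) (N := unit H) (M.δ ∘ₗ linOf (rightUnitB M).hom)
      (LinearMap.rTensor H (linOf (rightUnitB M).hom) ∘ₗ (tensor M (unit H)).δ) (fun m a => ?_) x
    rw [LinearMap.comp_apply, LinearMap.comp_apply, rightUnitB_tmul, tensor_δ]
    exact rightUnit_comm M m a

lemma linOf_hom_inv {M N : Com H} (e : M.bimod ≅ N.bimod) (m : M) :
    linOf e.inv (linOf e.hom m) = m :=
  LinearMap.congr_fun (congrArg Bimod.Hom.lin e.hom_inv_id) m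

/-- The left unit constraint. -/
def leftUnit (M : Com H) : tensor (unit H) M ≅ M :=
  isoMk (leftUnitHom M) (linOf (leftUnitB M).inv) (linOf_hom_inv (leftUnitB M))
    (linOf_hom_inv (leftUnitB M).symm)

/-- The right unit constraint. -/
def rightUnit (M : Com H) : tensor M (unit H) ≅ M :=
  isoMk (rightUnitHom M) (linOf (rightUnitB M).inv) (linOf_hom_inv (rightUnitB M))
    (linOf_hom_inv (rightUnitB M).symm)

instance : MonoidalCategoryStruct (Com H) where
  tensorObj := tensor
  tensorUnit := unit H
  tensorHom := tensorHom
  whiskerLeft M _ _ f := tensorHom (𝟙 M) f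
  whiskerRight f N := tensorHom f (𝟙 N)
  associator := assoc
  leftUnitor := leftUnit
  rightUnitor := rightUnit

variable (H) in
/-- The forgetful functor to bimodules carries the tensor structure of comodules to that of
bimodules. -/
def inducing : Monoidal.InducingFunctorData (forget H) where
  μIso := μIso
  εIso := εIso H
  whiskerLeft_eq _ _ _ _ := by
    rw [← id_tensorHom, ← (forget H).map_id]
    rfl
  whiskerRight_eq _ _ := by
    rw [← tensorHom_id, ← (forget H).map_id]
    rfl
  tensorHom_eq _ _ := rfl
  associator_eq _ _ _ := rfl
  leftUnitor_eq _ := rfl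
  rightUnitor_eq _ := rfl

/-- The monoidal category `com(H)`. -/
instance : MonoidalCategory (Com H) := Monoidal.induced (forget H) (inducing H)

/-- The forgetful functor from comodules to bimodules is monoidal. -/
instance : (forget H).Monoidal := Monoidal.fromInducedMonoidal (forget H) (inducing H)

end FaceAlg.Com

/-! ### The canonical coactions -/

/-- The forgetful functor from finite-dimensional `R`-bimodules to all `R`-bimodules. -/
abbrev toBimod (K V : Type u) [Field K] : FinBimod K (FaceR K V) ⥤ Bimod K (FaceR K V) :=
  (Bimod.isFinite K (FaceR K V)).ι

/-- The bilinear map `(n, m) ↦ n ⊗ m`. -/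
def Bimod.outerMk {K V : Type u} [Field K] (N M : Bimod K (FaceR K V)) :
    N →ₗ[K] M →ₗ[K] outer N M := TensorProduct.mk K N M

namespace FaceAlg

variable {K V : Type u} [Field K] [Fintype V] [DecidableEq V] {H : FaceAlg K V}

/-- The linear map underlying a map of `E`-bimodules to `H`. -/
def linTo {M : Bimod K (FaceE K V)} (f : M ⟶ H.bimod) : M →ₗ[K] H := f.lin

/-- For a map `κ : M^* ⊗ M → H`, the map `M → M ⊗ H`, `m ↦ ∑ i, m_i ⊗ κ(m^i ⊗ m)`, where `(m_i)` is
a basis of `M` and `(m^i)` is its dual basis. -/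
def coaction (M : FinBimod K (FaceR K V)) (κ : Bimod.outer (Bimod.dual M.obj) M.obj ⟶ H.bimod) :
    M.obj →ₗ[K] M.obj ⊗[K] H :=
  ∑ i, TensorProduct.mk K M.obj H (Module.finBasis K M.obj i) ∘ₗ linTo κ ∘ₗ
    Bimod.outerMk (Bimod.dual M.obj) M.obj ((Module.finBasis K M.obj).coord i)

/-- The linear map underlying a map of `R`-bimodules from a comodule `M`. -/
def Com.linFrom {M : Com H} {N : Bimod K (FaceR K V)} (f : M.bimod ⟶ N) : M →ₗ[K] N := f.lin

end FaceAlg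

end VTannaka

end

open VTannaka

/-! Since Ω is additive and left exact, the category of pairs (X, x) with x ∈ Ω(X) is cofiltered
(`isCofiltered_elements`), and the coend is the colimit of the spaces Ω(X)^* over its opposite. The
filtered description controls individual elements: each one is a single matrix coefficient κ_X(φ ⊗
x) (`coef_surjective`), and κ_X(φ ⊗ x) vanishes only if x = Ω(f)(y) for some f with φ ∘ Ω(f) = 0
(`coef_eq_zero`).

The structure maps are written on matrix coefficients. The coproduct and counit are those of a
matrix coalgebra. The product is κ_X(φ ⊗ x) κ_Y(ψ ⊗ y) = κ_{X ⊗ Y}(φψ ⊗ xy), where φψ is the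
functional x ⊗ y ↦ ∑ ν, φ(xν) ψ(νy). Dinaturality of κ along the associator and the unitors gives
associativity, the unit and the E-bimodule structure. Multiplicativity of Δ is `coact_fmul`, and the
sum over ν in φψ is the weak multiplicativity of ε.

For the equivalence, call z ∈ Ω(Z) a generator if no proper subobject of Z contains it. Every
element of a fibre lifts to a generator by minimality of dimension (`exists_isGenerator`), and for a
generator the map φ ↦ κ_Z(φ ⊗ z) is injective (`IsGenerator.eq_zero`). Given a comodule M and m ∈ M,
the finitely many coefficients of δ(m) are coefficients at one generator z. This defines a linear
map Ω(Z) → M; coassociativity, tested at z, makes it colinear, and the counit shows that z goes to m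
(`exists_hom_apply_eq`). Hence M is a quotient of some Ω(Z). The kernel of a comodule map out of
Ω(W) is the image of some Ω(r) (`exists_comMap_comp_eq_zero`), so M is Ω of a cokernel, and a
comodule map Ω(X) → Ω(Y) comes from C because its graph does.

If C is rigid, evaluation followed by the sum of coordinates R → K identifies Ω(X') with Ω(X)^* for
a right dual X' of X; the two zigzag identities give the two inverse laws (`pairForm_sharp`,
`sharp_pairForm`). The antipode is S(κ_X(φ ⊗ x)) = κ_{X'}(⟨·, x⟩ ⊗ φ♯), where φ♯ corresponds to φ.
Its axioms are dinaturality along evaluation and coevaluation. Left duals give surjectivity, and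
also injectivity through the vanishing criterion. -/

open VTannaka

noncomputable section

namespace VTannaka

/-! ### Sub- and quotient bimodules -/

namespace Bimod

variable {K A : Type u} [Field K] [CommRing A] [Algebra K A]

/-- The kernel of a bimodule map. -/
def ker {M N : Bimod K A} (f : M ⟶ N) : Bimod K A where
  carrier := LinearMap.ker f.lin
  left := AlgHom.ofLinearMap
    { toFun a := (M.left a).restrict (p := LinearMap.ker f.lin) (q := LinearMap.ker f.lin)
        (fun x (hx : f.lin x = 0) => by simp [hx])
      map_add' a b := by ext; simp; rfl
      map_smul' c a := by ext; simp; rfl }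
    (by ext; simp) (fun a b => by ext; simp; rfl)
  right := AlgHom.ofLinearMap
    { toFun a := (M.right a).restrict (p := LinearMap.ker f.lin) (q := LinearMap.ker f.lin)
        (fun x (hx : f.lin x = 0) => by simp [hx])
      map_add' a b := by ext; simp; rfl
      map_smul' c a := by ext; simp; rfl }
    (by ext; simp) (fun a b => by ext; simp; rfl)
  left_right a b m := Subtype.ext (M.left_right a b m)

/-- The inclusion of the kernel. -/
def kerι {M N : Bimod K A} (f : M ⟶ N) : ker f ⟶ M where
  lin := (LinearMap.ker f.lin).subtype
  map_left _ _ := rfl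
  map_right _ _ := rfl

lemma kerι_comp {M N : Bimod K A} (f : M ⟶ N) : kerι f ≫ f = 0 :=
  hom_ext fun m => m.2

/-- The endomorphism of the cokernel of `f` induced by `e'`. -/
def cokerAct {M N : Bimod K A} (f : M ⟶ N) (e : Module.End K M) (e' : Module.End K N)
    (h : ∀ m, f.lin (e m) = e' (f.lin m)) : Module.End K (N ⧸ LinearMap.range f.lin) :=
  (LinearMap.range f.lin).mapQ (LinearMap.range f.lin) e' (by
    rintro _ ⟨m, rfl⟩
    exact ⟨e m, h m⟩)

@[simp] lemma cokerAct_mk {M N : Bimod K A} (f : M ⟶ N) (e e' h) (n : N) :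
    cokerAct f e e' h (Submodule.Quotient.mk n) = Submodule.Quotient.mk (e' n) := rfl

lemma coker_ext {M N : Bimod K A} (f : M ⟶ N)
    {e e' : Module.End K (N ⧸ LinearMap.range f.lin)}
    (h : ∀ n : N, e (Submodule.Quotient.mk n) = e' (Submodule.Quotient.mk n)) : e = e' :=
  Submodule.linearMap_qext _ (LinearMap.ext h)

/-- The cokernel of a bimodule map. -/
def coker {M N : Bimod K A} (f : M ⟶ N) : Bimod K A where
  carrier := N ⧸ LinearMap.range f.lin
  left := AlgHom.ofLinearMap
    { toFun a := cokerAct f (M.left a) (N.left a) (f.map_left a)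
      map_add' a b := coker_ext f fun n => by simp
      map_smul' c a := coker_ext f fun n => by simp }
    (coker_ext f fun n => by simp) (fun a b => coker_ext f fun n => by simp)
  right := AlgHom.ofLinearMap
    { toFun a := cokerAct f (M.right a) (N.right a) (f.map_right a)
      map_add' a b := coker_ext f fun n => by simp
      map_smul' c a := coker_ext f fun n => by simp }
    (coker_ext f fun n => by simp) (fun a b => coker_ext f fun n => by simp)
  left_right a b := LinearMap.congr_fun (coker_ext f
    (e := cokerAct f (M.left a) (N.left a) (f.map_left a) ∘ₗ
      cokerAct f (M.right b) (N.right b) (f.map_right b))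
    (e' := cokerAct f (M.right b) (N.right b) (f.map_right b) ∘ₗ
      cokerAct f (M.left a) (N.left a) (f.map_left a))
    fun n => by simp [N.left_right])

/-- The projection to the cokernel. -/
def cokerπ {M N : Bimod K A} (f : M ⟶ N) : N ⟶ coker f where
  lin := (LinearMap.range f.lin).mkQ
  map_left _ _ := rfl
  map_right _ _ := rfl

lemma comp_cokerπ {M N : Bimod K A} (f : M ⟶ N) : f ≫ cokerπ f = 0 :=
  hom_ext fun m => (Submodule.Quotient.mk_eq_zero _).2 ⟨m, rfl⟩

end Bimod

namespace FinBimod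

variable {K A : Type u} [Field K] [CommRing A] [Algebra K A]

/-- The kernel of a map of finite-dimensional bimodules. -/
def ker {M N : FinBimod K A} (f : M ⟶ N) : FinBimod K A :=
  ⟨Bimod.ker f.hom, inferInstanceAs (Module.Finite K (LinearMap.ker f.hom.lin))⟩

/-- The inclusion of the kernel. -/
def kerι {M N : FinBimod K A} (f : M ⟶ N) : ker f ⟶ M := ObjectProperty.homMk (Bimod.kerι f.hom)

lemma kerι_comp {M N : FinBimod K A} (f : M ⟶ N) : kerι f ≫ f = 0 :=
  ObjectProperty.hom_ext _ (Bimod.kerι_comp f.hom)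

/-- The linear kernel is again a finite-dimensional bimodule, so its inclusion is a legitimate test
map; `f` kills it, and cancellation makes it zero. -/
lemma injective_of_mono {M N : FinBimod K A} (f : M ⟶ N) [Mono f] :
    Function.Injective f.hom.lin := by
  rw [← LinearMap.ker_eq_bot, eq_bot_iff]
  intro x hx
  have h : kerι f = 0 := by rw [← cancel_mono f, kerι_comp, zero_comp]
  exact LinearMap.congr_fun (congrArg (fun g : ker f ⟶ M => g.hom.lin) h) ⟨x, hx⟩

lemma surjective_of_epi {M N : FinBimod K A} (f : M ⟶ N) [Epi f] :
    Function.Surjective f.hom.lin := by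
  rw [← LinearMap.range_eq_top, eq_top_iff]
  intro x _
  -- The test object is the linear cokernel, which stays finite-dimensional.
  let Q : FinBimod K A := ⟨Bimod.coker f.hom,
    inferInstanceAs (Module.Finite K (N.obj ⧸ LinearMap.range f.hom.lin))⟩
  let q : N ⟶ Q := ObjectProperty.homMk (Bimod.cokerπ f.hom)
  have h : q = 0 := by
    rw [← cancel_epi f, comp_zero]
    exact ObjectProperty.hom_ext _ (Bimod.comp_cokerπ f.hom)
  exact (Submodule.Quotient.mk_eq_zero _).1
    (LinearMap.congr_fun (congrArg (fun g : N ⟶ Q => g.hom.lin) h) x)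

end FinBimod

/-! ### Fibre functors -/

section Fibre

variable {K A : Type u} [Field K] [CommRing A] [Algebra K A] {C : Type u₁} [Category.{v₁} C]
  (Ω : C ⥤ FinBimod K A)

/-- The vector space underlying `Ω(X)`. -/
abbrev Fib (X : C) : Type u := (Ω.obj X).obj.carrier

/-- The linear map underlying `Ω(f)`. -/
def fmap {X Y : C} (f : X ⟶ Y) : Fib Ω X →ₗ[K] Fib Ω Y := (Ω.map f).hom.lin

@[simp] lemma fmap_id (X : C) (x : Fib Ω X) : fmap Ω (𝟙 X) x = x := by simp [fmap]

@[simp] lemma fmap_comp {X Y Z : C} (f : X ⟶ Y) (g : Y ⟶ Z) (x : Fib Ω X) :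
    fmap Ω (f ≫ g) x = fmap Ω g (fmap Ω f x) := by simp [fmap]

lemma fmap_comp' {X Y Z : C} (f : X ⟶ Y) (g : Y ⟶ Z) :
    fmap Ω (f ≫ g) = fmap Ω g ∘ₗ fmap Ω f := LinearMap.ext fun _ => fmap_comp Ω f g _

lemma fmap_left {X Y : C} (f : X ⟶ Y) (a : A) (x : Fib Ω X) :
    fmap Ω f ((Ω.obj X).obj.left a x) = (Ω.obj Y).obj.left a (fmap Ω f x) :=
  (Ω.map f).hom.map_left a x

lemma fmap_right {X Y : C} (f : X ⟶ Y) (a : A) (x : Fib Ω X) :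
    fmap Ω f ((Ω.obj X).obj.right a x) = (Ω.obj Y).obj.right a (fmap Ω f x) :=
  (Ω.map f).hom.map_right a x

variable {Ω} in
lemma fmap_injective [Ω.Faithful] {X Y : C} {f g : X ⟶ Y}
    (h : ∀ x, fmap Ω f x = fmap Ω g x) : f = g :=
  Ω.map_injective (ObjectProperty.hom_ext _ (Bimod.hom_ext h))

@[simp] lemma fmap_hom_inv {X Y : C} (e : X ≅ Y) (x : Fib Ω X) :
    fmap Ω e.inv (fmap Ω e.hom x) = x := by simp [← fmap_comp]

section

variable [Preadditive C]

@[simp] lemma fmap_smul [Linear K C] [Ω.Linear K] {X Y : C} (c : K) (f : X ⟶ Y) :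
    fmap Ω (c • f) = c • fmap Ω f := by
  rw [fmap, Ω.map_smul]
  rfl

variable [Ω.Additive]

@[simp] lemma fmap_add {X Y : C} (f g : X ⟶ Y) : fmap Ω (f + g) = fmap Ω f + fmap Ω g := by
  rw [fmap, Ω.map_add]
  rfl

@[simp] lemma fmap_zero (X Y : C) : fmap Ω (0 : X ⟶ Y) = 0 := by
  rw [fmap, Ω.map_zero]
  rfl

@[simp] lemma fmap_sub {X Y : C} (f g : X ⟶ Y) : fmap Ω (f - g) = fmap Ω f - fmap Ω g := by
  rw [eq_sub_iff_add_eq, ← fmap_add, sub_add_cancel]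

lemma fmap_sum {ι : Type*} (s : Finset ι) {X Y : C} (f : ι → (X ⟶ Y)) :
    fmap Ω (∑ i ∈ s, f i) = ∑ i ∈ s, fmap Ω (f i) :=
  map_sum (AddMonoidHom.mk' (fmap Ω (X := X) (Y := Y)) (fmap_add Ω)) f s

end

lemma injective_fmap [PreservesFiniteLimits Ω] {X Y : C} (f : X ⟶ Y) [Mono f] :
    Function.Injective (fmap Ω f) := FinBimod.injective_of_mono (Ω.map f)

lemma surjective_fmap [PreservesFiniteColimits Ω] {X Y : C} (f : X ⟶ Y) [Epi f] :
    Function.Surjective (fmap Ω f) := FinBimod.surjective_of_epi (Ω.map f)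

lemma epi_of_surjective_fmap [Ω.Faithful] {X Y : C} (f : X ⟶ Y)
    (h : Function.Surjective (fmap Ω f)) : Epi f where
  left_cancellation g g' e := fmap_injective fun y => by
    obtain ⟨x, rfl⟩ := h y
    simp only [← fmap_comp, e]

/-! ### Exactness of a fibre functor on elements -/

variable [Abelian C] [Ω.Additive]

/-- Ω takes the kernel fork of `f` to a limit fork, so the concrete kernel of Ω(f) factors through
Ω(ker f). -/
lemma exists_fmap_kernel_ι [PreservesFiniteLimits Ω] {X Y : C} (f : X ⟶ Y) (x : Fib Ω X)
    (hx : fmap Ω f x = 0) : ∃ z, fmap Ω (kernel.ι f) z = x := by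
  have hk := KernelFork.mapIsLimit _ (kernelIsKernel f) Ω
  let j : FinBimod.ker (Ω.map f) ⟶ Ω.obj X := FinBimod.kerι (Ω.map f)
  let l := KernelFork.IsLimit.lift' hk j (FinBimod.kerι_comp (Ω.map f))
  refine ⟨l.1.hom.lin ⟨x, hx⟩, ?_⟩
  exact LinearMap.congr_fun
    (congrArg (fun g : FinBimod.ker (Ω.map f) ⟶ Ω.obj X => g.hom.lin) l.2) ⟨x, hx⟩

/-- The kernel of the cokernel is the image of `f`; left exactness lifts `y` to the fibre of the
image, and right exactness makes the fibre of X surject onto that. -/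
lemma exists_fmap_cokernel [PreservesFiniteLimits Ω] [PreservesFiniteColimits Ω]
    {X Y : C} (f : X ⟶ Y) (y : Fib Ω Y)
    (hy : fmap Ω (cokernel.π f) y = 0) : ∃ x, fmap Ω f x = y := by
  obtain ⟨z, rfl⟩ := exists_fmap_kernel_ι Ω (cokernel.π f) y hy
  obtain ⟨x, rfl⟩ := surjective_fmap Ω (Abelian.factorThruImage f) z
  refine ⟨x, ?_⟩
  rw [← fmap_comp]
  exact congrArg (fun g => fmap Ω g x) (Abelian.image.fac f).symm

end Fibre

/-! ### The space of matrix coefficients -/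

section Coend

variable {K A : Type u} [Field K] [CommRing A] [Algebra K A] {C : Type u₁} [Category.{v₁} C]
  (Ω : C ⥤ FinBimod K A)

/-- The functor `X ↦ Ω(X)` to types. -/
def fibType : C ⥤ Type u where
  obj X := Fib Ω X
  map f := TypeCat.ofHom (fmap Ω f)

/-- The functor `(X, x) ↦ Ω(X)^*` on the opposite of the category of elements of `Ω`. -/
def elementsDual : (fibType Ω).Elementsᵒᵖ ⥤ ModuleCat.{u} K where
  obj p := ModuleCat.of K (Module.Dual K (Fib Ω p.unop.1))
  map f := ModuleCat.ofHom (fmap Ω f.unop.1).dualMap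
  map_id p := by
    refine ModuleCat.hom_ext (LinearMap.ext fun (φ : Module.Dual K (Fib Ω p.unop.1)) => ?_)
    exact LinearMap.ext fun x => congrArg φ (fmap_id Ω _ x)
  map_comp f g := by
    refine ModuleCat.hom_ext (LinearMap.ext fun (φ : Module.Dual K (Fib Ω _)) => ?_)
    exact LinearMap.ext fun x => congrArg φ (fmap_comp Ω g.unop.1 f.unop.1 x)

/-- Biproducts dominate two pairs and kernels equalize two arrows. Left exactness is what lets the
chosen element lift to the kernel. -/
lemma isCofiltered_elements [Abelian C] [Ω.Additive] [PreservesFiniteLimits Ω] :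
    IsCofiltered (fibType Ω).Elements where
  nonempty := ⟨⟨(HasZeroObject.zero (C := C)).choose, (0 : Fib Ω _)⟩⟩
  cone_objs := by
    rintro ⟨X, (x : Fib Ω X)⟩ ⟨Y, (y : Fib Ω Y)⟩
    refine ⟨⟨X ⊞ Y, fmap Ω biprod.inl x + fmap Ω biprod.inr y⟩,
      ⟨biprod.fst, ?_⟩, ⟨biprod.snd, ?_⟩, trivial⟩
    · change fmap Ω biprod.fst (fmap Ω biprod.inl x + fmap Ω biprod.inr y) = x
      rw [map_add, ← fmap_comp, ← fmap_comp]
      simp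
    · change fmap Ω biprod.snd (fmap Ω biprod.inl x + fmap Ω biprod.inr y) = y
      rw [map_add, ← fmap_comp, ← fmap_comp]
      simp
  cone_maps := by
    rintro ⟨X, (x : Fib Ω X)⟩ ⟨Y, (y : Fib Ω Y)⟩ ⟨f, (hf : fmap Ω f x = y)⟩
      ⟨g, (hg : fmap Ω g x = y)⟩
    dsimp only at f g
    -- Both arrows send x to y, so their difference kills x.
    obtain ⟨z, hz⟩ := exists_fmap_kernel_ι Ω (f - g) x (by simp [hf, hg])
    refine ⟨⟨kernel (f - g), z⟩, ⟨kernel.ι (f - g), hz⟩, Subtype.ext ?_⟩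
    have := kernel.condition (f - g)
    rwa [Preadditive.comp_sub, sub_eq_zero] at this

variable [EssentiallySmall.{u} C]

instance : HasColimitsOfShape (fibType Ω).Elementsᵒᵖ (ModuleCat.{u} K) :=
  hasColimitsOfShape_of_essentiallySmall.{u} _ _

/-- The coend of `Ω^* ⊗ Ω`, realized as the colimit of the spaces `Ω(X)^*` over all
pairs `(X, x)` with `x ∈ Ω(X)`. -/
def Coend : Type u := (colimit (elementsDual Ω) : ModuleCat.{u} K)

instance : AddCommGroup (Coend Ω) :=
  inferInstanceAs (AddCommGroup (colimit (elementsDual Ω) : ModuleCat.{u} K))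

instance : Module K (Coend Ω) :=
  inferInstanceAs (Module K (colimit (elementsDual Ω) : ModuleCat.{u} K))

/-- The map `φ ↦ κ_X(φ ⊗ x)`. -/
def coefAt (X : C) (x : Fib Ω X) : Module.Dual K (Fib Ω X) →ₗ[K] Coend Ω :=
  (colimit.ι (elementsDual Ω) (Opposite.op ⟨X, x⟩)).hom

variable {Ω}

/-- Dinaturality: `f` is itself an arrow (X, x) ⟶ (Y, Ω(f) x) of the category of elements, and this
is compatibility of the colimit with it. -/
lemma coefAt_map {X Y : C} (f : X ⟶ Y) (φ : Module.Dual K (Fib Ω Y)) (x : Fib Ω X) :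
    coefAt Ω X x (φ ∘ₗ fmap Ω f) = coefAt Ω Y (fmap Ω f x) φ := by
  let p : (fibType Ω).Elements := ⟨X, x⟩
  let q : (fibType Ω).Elements := ⟨Y, fmap Ω f x⟩
  let g : p ⟶ q := ⟨f, rfl⟩
  exact LinearMap.congr_fun
    (congrArg ModuleCat.Hom.hom (colimit.w (elementsDual Ω) g.op)) φ

section

variable [Preadditive C]

/-- Additivity in the vector is not built into the colimit. The vectors x, y and x + y are images of
one z ∈ Ω(X ⊞ X) under `fst`, `snd` and `fst + snd`; dinaturality moves all three coefficients to z,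
where linearity in the functional applies. -/
lemma coefAt_add [Ω.Additive] [HasBinaryBiproducts C] (X : C) (x y : Fib Ω X) (φ : Module.Dual K (Fib Ω X)) :
    coefAt Ω X (x + y) φ = coefAt Ω X x φ + coefAt Ω X y φ := by
  let z : Fib Ω (X ⊞ X) := fmap Ω biprod.inl x + fmap Ω biprod.inr y
  have h₁ : fmap Ω biprod.fst z = x := by
    rw [map_add, ← fmap_comp, ← fmap_comp]; simp
  have h₂ : fmap Ω biprod.snd z = y := by
    rw [map_add, ← fmap_comp, ← fmap_comp]; simp
  have h₃ : fmap Ω (biprod.fst + biprod.snd) z = x + y := by simp [h₁, h₂]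
  have e₁ := coefAt_map biprod.fst φ z
  have e₂ := coefAt_map biprod.snd φ z
  have e₃ := coefAt_map (biprod.fst + biprod.snd) φ z
  rw [h₁] at e₁
  rw [h₂] at e₂
  rw [h₃] at e₃
  rw [← e₁, ← e₂, ← e₃, ← map_add, fmap_add, LinearMap.comp_add]

/-- Dinaturality along c • 𝟙. -/
lemma coefAt_smul [Linear K C] [Ω.Linear K] (X : C) (c : K) (x : Fib Ω X)
    (φ : Module.Dual K (Fib Ω X)) : coefAt Ω X (c • x) φ = c • coefAt Ω X x φ := by
  have h := coefAt_map (c • 𝟙 X) φ x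
  have h' : fmap Ω (c • 𝟙 X) = c • LinearMap.id := by
    ext x; simp
  rwa [h', LinearMap.comp_smul, LinearMap.comp_id, map_smul, eq_comm] at h

end

/-- Filtered colimits of modules are computed on underlying sets. The index category is only
essentially small, so the argument runs on a small model. -/
lemma preservesColimitsOfShape_elements [Abelian C] [Ω.Additive] [PreservesFiniteLimits Ω] :
    PreservesColimitsOfShape (fibType Ω).Elementsᵒᵖ (forget (ModuleCat.{u} K)) := by
  have := isCofiltered_elements Ω
  have := IsFiltered.of_equivalence (equivSmallModel.{u} (fibType Ω).Elementsᵒᵖ)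
  exact preservesColimitsOfShape_of_equiv
    (equivSmallModel.{u} (fibType Ω).Elementsᵒᵖ).symm (forget (ModuleCat.{u} K))

/-- Every element of the coend is a matrix coefficient. -/
lemma coefAt_surjective [Abelian C] [Ω.Additive] [PreservesFiniteLimits Ω]
    (h : Coend Ω) : ∃ X φ x, coefAt Ω X x φ = h := by
  have := isCofiltered_elements Ω
  have := preservesColimitsOfShape_elements (Ω := Ω)
  obtain ⟨p, φ, hφ⟩ := Concrete.colimit_exists_rep (elementsDual Ω) h
  exact ⟨p.unop.1, φ, p.unop.2, hφ⟩

lemma coefAt_eq_zero [Abelian C] [Ω.Additive] [PreservesFiniteLimits Ω] {X : C}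
    {x : Fib Ω X} {φ : Module.Dual K (Fib Ω X)} (h : coefAt Ω X x φ = 0) :
    ∃ (Y : C) (f : Y ⟶ X) (y : Fib Ω Y), fmap Ω f y = x ∧ φ ∘ₗ fmap Ω f = 0 := by
  have := isCofiltered_elements Ω
  have := preservesColimitsOfShape_elements (Ω := Ω)
  -- The representatives φ and 0 become equal after transition along two possibly different arrows;
  -- the second does not matter, because it carries 0 to 0.
  obtain ⟨p, f, g, hfg⟩ := Concrete.colimit_exists_of_rep_eq (elementsDual Ω)
    (i := Opposite.op ⟨X, x⟩) (j := Opposite.op ⟨X, x⟩) φ (0 : Module.Dual K (Fib Ω X))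
    (h.trans (map_zero (coefAt Ω X x)).symm)
  exact ⟨p.unop.1, f.unop.1, p.unop.2, f.unop.2,
    hfg.trans (map_zero (fmap Ω g.unop.1).dualMap)⟩

lemma coend_hom_ext {P : Type u} [AddCommGroup P] [Module K P] {f g : Coend Ω →ₗ[K] P}
    (h : ∀ X φ x, f (coefAt Ω X x φ) = g (coefAt Ω X x φ)) : f = g := by
  have : ModuleCat.ofHom f = ModuleCat.ofHom g := colimit.hom_ext fun p =>
    ModuleCat.hom_ext (LinearMap.ext fun φ => h p.unop.1 φ p.unop.2)
  exact congrArg ModuleCat.Hom.hom this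

/-- The universal property of the coend. -/
def coendDesc {P : Type u} [AddCommGroup P] [Module K P]
    (f : ∀ X, Module.Dual K (Fib Ω X) →ₗ[K] Fib Ω X →ₗ[K] P)
    (hf : ∀ {X Y : C} (g : X ⟶ Y) (φ : Module.Dual K (Fib Ω Y)) (x : Fib Ω X),
      f X (φ ∘ₗ fmap Ω g) x = f Y φ (fmap Ω g x)) : Coend Ω →ₗ[K] P :=
  (colimit.desc (elementsDual Ω)
    { pt := ModuleCat.of K P
      ι :=
        { app p := ModuleCat.ofHom ((f p.unop.1).flip p.unop.2)
          naturality p q g := ModuleCat.hom_ext (LinearMap.ext fun φ =>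
            (hf g.unop.1 φ q.unop.2).trans
              (congrArg (f p.unop.1 φ) g.unop.2)) } }).hom

lemma coendDesc_coefAt {P : Type u} [AddCommGroup P] [Module K P]
    (f : ∀ X, Module.Dual K (Fib Ω X) →ₗ[K] Fib Ω X →ₗ[K] P) (hf) (X : C)
    (φ : Module.Dual K (Fib Ω X)) (x : Fib Ω X) :
    coendDesc (Ω := Ω) f hf (coefAt Ω X x φ) = f X φ x :=
  LinearMap.congr_fun (congrArg ModuleCat.Hom.hom
    (colimit.ι_desc (F := elementsDual Ω) _ (Opposite.op ⟨X, x⟩))) φ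

section

variable [Abelian C] [Linear K C] [Ω.Additive] [Ω.Linear K]

variable (Ω) in
/-- The bilinear map `(φ, x) ↦ κ_X(φ ⊗ x)`. -/
def coef (X : C) : Module.Dual K (Fib Ω X) →ₗ[K] Fib Ω X →ₗ[K] Coend Ω :=
  LinearMap.flip
    { toFun := coefAt Ω X
      map_add' x y := LinearMap.ext (coefAt_add X x y)
      map_smul' c x := LinearMap.ext (coefAt_smul X c x) }

lemma coef_comp_fmap {X Y : C} (f : X ⟶ Y) (φ : Module.Dual K (Fib Ω Y)) (x : Fib Ω X) :
    coef Ω X (φ ∘ₗ fmap Ω f) x = coef Ω Y φ (fmap Ω f x) := coefAt_map f φ x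

lemma coend_ext {P : Type u} [AddCommGroup P] [Module K P] {f g : Coend Ω →ₗ[K] P}
    (h : ∀ X φ x, f (coef Ω X φ x) = g (coef Ω X φ x)) : f = g := coend_hom_ext h

lemma coendDesc_coef {P : Type u} [AddCommGroup P] [Module K P]
    (f : ∀ X, Module.Dual K (Fib Ω X) →ₗ[K] Fib Ω X →ₗ[K] P) (hf) (X : C)
    (φ : Module.Dual K (Fib Ω X)) (x : Fib Ω X) :
    coendDesc (Ω := Ω) f hf (coef Ω X φ x) = f X φ x := coendDesc_coefAt f hf X φ x

variable [PreservesFiniteLimits Ω]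

lemma coef_surjective (h : Coend Ω) : ∃ X φ x, coef Ω X φ x = h := coefAt_surjective h

lemma coef_eq_zero {X : C} {x : Fib Ω X} {φ : Module.Dual K (Fib Ω X)} (h : coef Ω X φ x = 0) :
    ∃ (Y : C) (f : Y ⟶ X) (y : Fib Ω Y), fmap Ω f y = x ∧ φ ∘ₗ fmap Ω f = 0 := coefAt_eq_zero h

end

end Coend

/-! ### Contraction of the first tensor factor -/

section

variable {K : Type*} [Field K] {M P Q : Type*} [AddCommGroup M] [AddCommGroup P]
  [AddCommGroup Q] [Module K M] [Module K P] [Module K Q]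

/-- The map `m ⊗ p ↦ φ(m) p`. -/
def contractL (P : Type*) [AddCommGroup P] [Module K P] (φ : Module.Dual K M) :
    M ⊗[K] P →ₗ[K] P :=
  (TensorProduct.lid K P).toLinearMap ∘ₗ φ.rTensor P

@[simp] lemma contractL_tmul (φ : Module.Dual K M) (m : M) (p : P) :
    contractL P φ (m ⊗ₜ p) = φ m • p := by simp [contractL]

lemma contractL_lTensor (φ : Module.Dual K M) (f : P →ₗ[K] Q) (t : M ⊗[K] P) :
    contractL Q φ (f.lTensor M t) = f (contractL P φ t) := by
  induction t using TensorProduct.induction_on with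
  | zero => simp
  | add t s ht hs => simp only [map_add, ht, hs]
  | tmul m p => simp

lemma contractL_rTensor {N : Type*} [AddCommGroup N] [Module K N] (φ : Module.Dual K N)
    (f : M →ₗ[K] N) (t : M ⊗[K] P) :
    contractL P φ (f.rTensor P t) = contractL P (φ ∘ₗ f) t := by
  induction t using TensorProduct.induction_on with
  | zero => simp
  | add t s ht hs => simp only [map_add, ht, hs]
  | tmul m p => simp

lemma contractL_assoc (φ : Module.Dual K M) (t : (M ⊗[K] P) ⊗[K] Q) :
    contractL (P ⊗[K] Q) φ (TensorProduct.assoc K M P Q t) = (contractL P φ).rTensor Q t := by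
  induction t using TensorProduct.induction_on with
  | zero => simp
  | add t s ht hs => simp only [map_add, ht, hs]
  | tmul s q =>
    induction s using TensorProduct.induction_on with
    | zero => simp
    | add t s ht hs => simp only [map_add, TensorProduct.add_tmul, ht, hs]
    | tmul m p => simp [TensorProduct.smul_tmul']

lemma sum_basis_tmul_contractL {ι : Type*} [Fintype ι] (b : Module.Basis ι K M) (t : M ⊗[K] P) :
    ∑ i, b i ⊗ₜ contractL P (b.coord i) t = t := by
  induction t using TensorProduct.induction_on with
  | zero => simp
  | add t s ht hs =>
    simp only [map_add, TensorProduct.tmul_add, Finset.sum_add_distrib, ht, hs]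
  | tmul m p =>
    simp only [contractL_tmul, ← TensorProduct.smul_tmul, ← TensorProduct.sum_tmul,
      Module.Basis.coord_apply, b.sum_repr]

/-- With M finite-dimensional, the coordinate contractions already recover the tensor. Identities
about coactions are proved by contracting with an arbitrary φ, which turns them into identities of
matrix coefficients. -/
lemma tensor_ext_contractL [Module.Finite K M] {t s : M ⊗[K] P}
    (h : ∀ φ : Module.Dual K M, contractL P φ t = contractL P φ s) : t = s := by
  rw [← sum_basis_tmul_contractL (Module.finBasis K M) t,
    ← sum_basis_tmul_contractL (Module.finBasis K M) s]
  simp only [h]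

lemma lTensor_rTensor {N R : Type*} [AddCommGroup N] [Module K N] [AddCommGroup R] [Module K R]
    (f : M →ₗ[K] N) (g : P →ₗ[K] R) (t : M ⊗[K] P) :
    g.lTensor N (f.rTensor P t) = f.rTensor R (g.lTensor M t) := by
  rw [← LinearMap.comp_apply, ← LinearMap.comp_apply, LinearMap.lTensor_comp_rTensor,
    LinearMap.rTensor_comp_lTensor]

lemma assoc_rTensor_rTensor {N R : Type*} [AddCommGroup N] [Module K N] [AddCommGroup R]
    [Module K R] (f : M →ₗ[K] N) (t : (M ⊗[K] P) ⊗[K] R) :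
    TensorProduct.assoc K N P R ((f.rTensor P).rTensor R t) =
      f.rTensor (P ⊗[K] R) (TensorProduct.assoc K M P R t) := by
  induction t using TensorProduct.induction_on with
  | zero => simp
  | add t s ht hs => simp only [map_add, ht, hs]
  | tmul s q =>
    induction s using TensorProduct.induction_on with
    | zero => simp
    | add t s ht hs => simp only [map_add, TensorProduct.add_tmul, ht, hs]
    | tmul m p => simp

end

/-! ### The coalgebra structure of the coend -/

section Coalgebra

variable {K A : Type u} [Field K] [CommRing A] [Algebra K A] {C : Type u₁} [Category.{v₁} C]
  [EssentiallySmall.{u} C] [Abelian C] [Linear K C]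
  (Ω : C ⥤ FinBimod K A) [Ω.Additive] [Ω.Linear K]

/-- The coaction `x ↦ ∑ i, x_i ⊗ κ_X(x^i ⊗ x)` on `Ω(X)`. -/
def coact (X : C) : Fib Ω X →ₗ[K] Fib Ω X ⊗[K] Coend Ω :=
  ∑ i, TensorProduct.mk K (Fib Ω X) (Coend Ω) (Module.finBasis K (Fib Ω X) i) ∘ₗ
    coef Ω X ((Module.finBasis K (Fib Ω X)).coord i)

lemma coact_apply (X : C) (x : Fib Ω X) :
    coact Ω X x = ∑ i, Module.finBasis K (Fib Ω X) i ⊗ₜ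
      coef Ω X ((Module.finBasis K (Fib Ω X)).coord i) x := by
  simp [coact, LinearMap.sum_apply]

variable {Ω}

-- A basis-free characterization of the coaction; later arguments use it in place of the defining
-- sum.
@[simp] lemma contractL_coact {X : C} (φ : Module.Dual K (Fib Ω X)) (x : Fib Ω X) :
    contractL (Coend Ω) φ (coact Ω X x) = coef Ω X φ x := by
  rw [coact_apply, map_sum]
  conv_rhs => rw [← (Module.finBasis K (Fib Ω X)).sum_dual_apply_smul_coord φ]
  simp only [contractL_tmul, map_sum, map_smul, LinearMap.sum_apply, LinearMap.smul_apply]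

/-- Dinaturality of κ, reread as colinearity of Ω(f). -/
lemma coact_fmap {X Y : C} (f : X ⟶ Y) (x : Fib Ω X) :
    coact Ω Y (fmap Ω f x) = (fmap Ω f).rTensor (Coend Ω) (coact Ω X x) :=
  tensor_ext_contractL fun φ => by
    rw [contractL_coact, contractL_rTensor, contractL_coact, coef_comp_fmap]

variable (Ω) in
/-- The coproduct of the coend. -/
def coendComul : Coend Ω →ₗ[K] Coend Ω ⊗[K] Coend Ω :=
  coendDesc
    (fun X => (coact Ω X).lcomp K _ ∘ₗ LinearMap.rTensorHom (Coend Ω) ∘ₗ coef Ω X)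
    -- The formula is κ_X(φ ⊗ x) ↦ ∑ i, κ_X(φ ⊗ x_i) ⊗ κ_X(x^i ⊗ x), the map κ_X(φ ⊗ ·) applied to
    -- the first leg of the coaction; it is dinatural because coactions commute with Ω(g).
    (fun {X Y} g φ x => by
      have h : coef Ω X (φ ∘ₗ fmap Ω g) = coef Ω Y φ ∘ₗ fmap Ω g :=
        LinearMap.ext fun x => coef_comp_fmap g φ x
      simp only [LinearMap.comp_apply, LinearMap.lcomp_apply, LinearMap.coe_rTensorHom, h,
        LinearMap.rTensor_comp, coact_fmap])

variable (Ω) in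
/-- The counit of the coend. -/
def coendCounit : Coend Ω →ₗ[K] K := coendDesc (fun _ => LinearMap.id) (fun _ _ _ => rfl)

lemma coendComul_coef {X : C} (φ : Module.Dual K (Fib Ω X)) (x : Fib Ω X) :
    coendComul Ω (coef Ω X φ x) = (coef Ω X φ).rTensor (Coend Ω) (coact Ω X x) :=
  coendDesc_coef _ _ X φ x

lemma coendCounit_coef {X : C} (φ : Module.Dual K (Fib Ω X)) (x : Fib Ω X) :
    coendCounit Ω (coef Ω X φ x) = φ x := coendDesc_coef _ _ X φ x

/-- Contracting the first leg with φ turns both sides into Δ(κ_X(φ ⊗ x)). -/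
lemma coact_coassoc {X : C} (x : Fib Ω X) :
    TensorProduct.assoc K _ _ _ ((coact Ω X).rTensor (Coend Ω) (coact Ω X x)) =
      (coendComul Ω).lTensor (Fib Ω X) (coact Ω X x) :=
  tensor_ext_contractL fun φ => by
    rw [contractL_assoc, contractL_lTensor, contractL_coact, coendComul_coef,
      ← LinearMap.comp_apply, ← LinearMap.rTensor_comp]
    congr 2
    exact LinearMap.ext fun x => contractL_coact φ x

/-- Pairing with φ reduces this to ε(κ_X(φ ⊗ x)) = φ(x). -/
lemma coact_counit {X : C} (x : Fib Ω X) :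
    TensorProduct.rid K _ ((coendCounit Ω).lTensor (Fib Ω X) (coact Ω X x)) = x := by
  have h (t : Fib Ω X ⊗[K] K) (φ : Module.Dual K (Fib Ω X)) :
      φ (TensorProduct.rid K _ t) = contractL K φ t := by
    induction t using TensorProduct.induction_on with
    | zero => simp
    | add t s ht hs => simp only [map_add, ht, hs]
    | tmul m p => simp [mul_comm]
  refine (Module.forall_dual_apply_eq_zero_iff K _).1 (fun φ => ?_) |> sub_eq_zero.1
  rw [map_sub, h, contractL_lTensor, contractL_coact, coendCounit_coef, sub_self]

/-- The coalgebra laws are pushed forward from the coactions: coassociativity and the right counit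
law are those of Ω(X), transported by κ_X(φ ⊗ ·), and the left counit law is ε ∘ κ_X(φ ⊗ ·) = φ. -/
instance : Coalgebra K (Coend Ω) where
  comul := coendComul Ω
  counit := coendCounit Ω
  coassoc := coend_ext fun X φ x => by
    have h : coendComul Ω ∘ₗ coef Ω X φ = (coef Ω X φ).rTensor (Coend Ω) ∘ₗ coact Ω X :=
      LinearMap.ext fun x => coendComul_coef φ x
    simp only [LinearMap.comp_apply, coendComul_coef, LinearEquiv.coe_coe]
    rw [← LinearMap.comp_apply (LinearMap.rTensor _ _), ← LinearMap.rTensor_comp, h,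
      LinearMap.rTensor_comp, LinearMap.comp_apply, assoc_rTensor_rTensor, coact_coassoc,
      lTensor_rTensor]
  rTensor_counit_comp_comul := coend_ext fun X φ x => by
    have h : coendCounit Ω ∘ₗ coef Ω X φ = φ := LinearMap.ext fun x => coendCounit_coef φ x
    simp only [LinearMap.comp_apply, coendComul_coef, TensorProduct.mk_apply]
    rw [← LinearMap.comp_apply, ← LinearMap.rTensor_comp, h,
      ← (TensorProduct.lid K _).symm_apply_apply (φ.rTensor _ _), ← TensorProduct.lid_symm_apply]
    exact congrArg _ (contractL_coact φ x)
  lTensor_counit_comp_comul := coend_ext fun X φ x => by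
    simp only [LinearMap.comp_apply, coendComul_coef, LinearMap.flip_apply, TensorProduct.mk_apply]
    rw [lTensor_rTensor, ← (TensorProduct.rid K _).symm_apply_apply
        ((coendCounit Ω).lTensor (Fib Ω X) (coact Ω X x)), coact_counit]
    simp

lemma comul_coef {X : C} (φ : Module.Dual K (Fib Ω X)) (x : Fib Ω X) :
    Coalgebra.comul (R := K) (coef Ω X φ x) = (coef Ω X φ).rTensor (Coend Ω) (coact Ω X x) :=
  coendComul_coef φ x

lemma counit_coef {X : C} (φ : Module.Dual K (Fib Ω X)) (x : Fib Ω X) :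
    Coalgebra.counit (R := K) (coef Ω X φ x) = φ x := coendCounit_coef φ x

end Coalgebra

/-! ### The tensor structure of a fibre functor, on elements -/

section Monoidal

variable {K A : Type u} [Field K] [CommRing A] [Algebra K A]
  {C : Type u₁} [Category.{v₁} C] (Ω : C ⥤ FinBimod K A)

/-- The left action of `a` on `Ω(X)`. -/
def fleft (X : C) : A →ₐ[K] Module.End K (Fib Ω X) := (Ω.obj X).obj.left

/-- The right action of `a` on `Ω(X)`. -/
def fright (X : C) : A →ₐ[K] Module.End K (Fib Ω X) := (Ω.obj X).obj.right

variable {Ω}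

lemma fleft_fright {X : C} (a b : A) (x : Fib Ω X) :
    fleft Ω X a (fright Ω X b x) = fright Ω X b (fleft Ω X a x) :=
  (Ω.obj X).obj.left_right a b x

lemma fmap_fleft {X Y : C} (f : X ⟶ Y) (a : A) (x : Fib Ω X) :
    fmap Ω f (fleft Ω X a x) = fleft Ω Y a (fmap Ω f x) := fmap_left Ω f a x

lemma fmap_fright {X Y : C} (f : X ⟶ Y) (a : A) (x : Fib Ω X) :
    fmap Ω f (fright Ω X a x) = fright Ω Y a (fmap Ω f x) := fmap_right Ω f a x

variable [Module.Finite K A] [MonoidalCategory C] (Ω) [Ω.Monoidal]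

/-- The bilinear map `Ω(X) × Ω(Y) → Ω(X ⊗ Y)`. -/
def fmul (X Y : C) : Fib Ω X →ₗ[K] Fib Ω Y →ₗ[K] Fib Ω (X ⊗ Y) :=
  (Bimod.tmul (Ω.obj X).obj (Ω.obj Y).obj).compr₂ (Functor.LaxMonoidal.μ Ω X Y).hom.lin

/-- The map `A → Ω(𝟙)`. -/
def funit : A →ₗ[K] Fib Ω (𝟙_ C) :=
  (Functor.LaxMonoidal.ε Ω).hom.lin ∘ₗ (Bimod.toUnit K A).toLinearMap

variable {Ω}

lemma fmul_balanced {X Y : C} (x : Fib Ω X) (a : A) (y : Fib Ω Y) :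
    fmul Ω X Y (fright Ω X a x) y = fmul Ω X Y x (fleft Ω Y a y) :=
  congrArg (Functor.LaxMonoidal.μ Ω X Y).hom.lin (Bimod.tmul_balanced x a y)

lemma fleft_fmul {X Y : C} (a : A) (x : Fib Ω X) (y : Fib Ω Y) :
    fleft Ω _ a (fmul Ω X Y x y) = fmul Ω X Y (fleft Ω X a x) y :=
  ((Functor.LaxMonoidal.μ Ω X Y).hom.map_left a
    (Bimod.tmul (Ω.obj X).obj (Ω.obj Y).obj x y)).symm

lemma fright_fmul {X Y : C} (a : A) (x : Fib Ω X) (y : Fib Ω Y) :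
    fright Ω _ a (fmul Ω X Y x y) = fmul Ω X Y x (fright Ω Y a y) :=
  ((Functor.LaxMonoidal.μ Ω X Y).hom.map_right a
    (Bimod.tmul (Ω.obj X).obj (Ω.obj Y).obj x y)).symm

/-- The linear equivalence underlying the tensor constraint of `Ω`. -/
def fμ (Ω : C ⥤ FinBimod K A) [Ω.Monoidal] (X Y : C) :
    Bimod.tens (Ω.obj X).obj (Ω.obj Y).obj ≃ₗ[K] Fib Ω (X ⊗ Y) :=
  LinearEquiv.ofLinearMap (Functor.LaxMonoidal.μ Ω X Y).hom.lin
    (Functor.OplaxMonoidal.δ Ω X Y).hom.lin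
    (congrArg (fun f : Ω.obj (X ⊗ Y) ⟶ Ω.obj (X ⊗ Y) => f.hom.lin)
      (Functor.Monoidal.δ_μ Ω X Y))
    (congrArg (fun f : Ω.obj X ⊗ Ω.obj Y ⟶ Ω.obj X ⊗ Ω.obj Y => f.hom.lin)
      (Functor.Monoidal.μ_δ Ω X Y))

lemma fμ_tmul {X Y : C} (x : Fib Ω X) (y : Fib Ω Y) :
    fμ Ω X Y (Bimod.tmul _ _ x y) = fmul Ω X Y x y := rfl

/-- The tensor constraint of Ω is invertible, so products x y span Ω(X ⊗ Y). -/
lemma fmul_ind {X Y : C} {P : Type*} [AddCommGroup P] [Module K P]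
    {f g : Fib Ω (X ⊗ Y) →ₗ[K] P} (h : ∀ x y, f (fmul Ω X Y x y) = g (fmul Ω X Y x y)) :
    f = g := by
  have : f ∘ₗ (fμ Ω X Y).toLinearMap = g ∘ₗ (fμ Ω X Y).toLinearMap :=
    Bimod.tens_ext h
  ext x
  obtain ⟨y, rfl⟩ := (fμ Ω X Y).surjective x
  exact LinearMap.congr_fun this y

/-- The universal property of `Ω(X ⊗ Y)`. -/
def fmulLift {X Y : C} {P : Type*} [AddCommGroup P] [Module K P]
    (f : Fib Ω X →ₗ[K] Fib Ω Y →ₗ[K] P)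
    (h : ∀ x a y, f (fright Ω X a x) y = f x (fleft Ω Y a y)) : Fib Ω (X ⊗ Y) →ₗ[K] P :=
  Bimod.lift f h ∘ₗ (fμ Ω X Y).symm.toLinearMap

@[simp] lemma fmulLift_fmul {X Y : C} {P : Type*} [AddCommGroup P] [Module K P]
    (f : Fib Ω X →ₗ[K] Fib Ω Y →ₗ[K] P) (h) (x : Fib Ω X) (y : Fib Ω Y) :
    fmulLift f h (fmul Ω X Y x y) = f x y := by
  rw [fmulLift, LinearMap.comp_apply, ← fμ_tmul, LinearEquiv.coe_coe,
    LinearEquiv.symm_apply_apply]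
  exact Bimod.lift_tmul f h x y

@[simp] lemma fmap_tensorHom_fmul {X Y X' Y' : C} (f : X ⟶ X') (g : Y ⟶ Y') (x : Fib Ω X)
    (y : Fib Ω Y) :
    fmap Ω (f ⊗ₘ g) (fmul Ω X Y x y) = fmul Ω X' Y' (fmap Ω f x) (fmap Ω g y) := by
  have h := congrArg (fun k : Ω.obj X ⊗ Ω.obj Y ⟶ Ω.obj (X' ⊗ Y') =>
    k.hom.lin (Bimod.tmul (Ω.obj X).obj (Ω.obj Y).obj x y))
    (Functor.LaxMonoidal.μ_natural Ω f g)
  exact h.symm.trans (congrArg (Functor.LaxMonoidal.μ Ω X' Y').hom.lin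
    (Bimod.tensHom_tmul (Ω.map f).hom (Ω.map g).hom x y))

lemma fmap_whiskerRight_fmul {X Y X' : C} (f : X ⟶ X') (x : Fib Ω X) (y : Fib Ω Y) :
    fmap Ω (f ▷ Y) (fmul Ω X Y x y) = fmul Ω X' Y (fmap Ω f x) y := by
  rw [← tensorHom_id, fmap_tensorHom_fmul, fmap_id]

lemma fmap_whiskerLeft_fmul {X Y Y' : C} (g : Y ⟶ Y') (x : Fib Ω X) (y : Fib Ω Y) :
    fmap Ω (X ◁ g) (fmul Ω X Y x y) = fmul Ω X Y' x (fmap Ω g y) := by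
  rw [← id_tensorHom, fmap_tensorHom_fmul, fmap_id]

lemma fmap_associator_fmul {X Y Z : C} (x : Fib Ω X) (y : Fib Ω Y) (z : Fib Ω Z) :
    fmap Ω (α_ X Y Z).hom (fmul Ω _ Z (fmul Ω X Y x y) z) =
      fmul Ω X _ x (fmul Ω Y Z y z) := by
  have h := congrArg (fun k : (Ω.obj X ⊗ Ω.obj Y) ⊗ Ω.obj Z ⟶ Ω.obj (X ⊗ Y ⊗ Z) =>
    k.hom.lin (Bimod.tmul (Bimod.tens (Ω.obj X).obj (Ω.obj Y).obj) (Ω.obj Z).obj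
      (Bimod.tmul (Ω.obj X).obj (Ω.obj Y).obj x y) z))
    (Functor.LaxMonoidal.associativity Ω X Y Z)
  have h₁ := Bimod.tensHom_tmul (Functor.LaxMonoidal.μ Ω X Y).hom (𝟙 (Ω.obj Z).obj)
    (Bimod.tmul (Ω.obj X).obj (Ω.obj Y).obj x y) z
  have h₂ := Bimod.tensHom_tmul (𝟙 (Ω.obj X).obj) (Functor.LaxMonoidal.μ Ω Y Z).hom x
    (Bimod.tmul (Ω.obj Y).obj (Ω.obj Z).obj y z)
  have h₃ := Bimod.assoc_hom_tmul (Ω.obj X).obj (Ω.obj Y).obj (Ω.obj Z).obj x y z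
  refine (congrArg (fun t => (Ω.map (α_ X Y Z).hom).hom.lin
    ((Functor.LaxMonoidal.μ Ω (X ⊗ Y) Z).hom.lin t)) h₁).symm.trans (h.trans ?_)
  exact congrArg (Functor.LaxMonoidal.μ Ω X (Y ⊗ Z)).hom.lin
    ((congrArg (Bimod.tensHom (𝟙 (Ω.obj X).obj) (Functor.LaxMonoidal.μ Ω Y Z).hom).lin h₃).trans
      h₂)

lemma fmap_leftUnitor_fmul {X : C} (a : A) (x : Fib Ω X) :
    fmap Ω (λ_ X).hom (fmul Ω _ X (funit Ω a) x) = fleft Ω X a x := by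
  have h := congrArg (fun k : 𝟙_ (FinBimod K A) ⊗ Ω.obj X ⟶ Ω.obj X =>
    k.hom.lin (Bimod.tmul (Bimod.unit K A) (Ω.obj X).obj (Bimod.toUnit K A a) x))
    (Functor.LaxMonoidal.left_unitality Ω X)
  have h₁ := Bimod.tensHom_tmul (Functor.LaxMonoidal.ε Ω).hom (𝟙 (Ω.obj X).obj)
    (Bimod.toUnit K A a) x
  exact (congrArg (fun t => (Ω.map (λ_ X).hom).hom.lin
    ((Functor.LaxMonoidal.μ Ω _ X).hom.lin t)) h₁).symm.trans
    (h.symm.trans (Bimod.leftUnit_hom_tmul (Ω.obj X).obj (Bimod.toUnit K A a) x))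

lemma fmap_rightUnitor_fmul {X : C} (a : A) (x : Fib Ω X) :
    fmap Ω (ρ_ X).hom (fmul Ω X _ x (funit Ω a)) = fright Ω X a x := by
  have h := congrArg (fun k : Ω.obj X ⊗ 𝟙_ (FinBimod K A) ⟶ Ω.obj X =>
    k.hom.lin (Bimod.tmul (Ω.obj X).obj (Bimod.unit K A) x (Bimod.toUnit K A a)))
    (Functor.LaxMonoidal.right_unitality Ω X)
  have h₁ := Bimod.tensHom_tmul (𝟙 (Ω.obj X).obj) (Functor.LaxMonoidal.ε Ω).hom
    x (Bimod.toUnit K A a)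
  exact (congrArg (fun t => (Ω.map (ρ_ X).hom).hom.lin
    ((Functor.LaxMonoidal.μ Ω X _).hom.lin t)) h₁).symm.trans
    (h.symm.trans (Bimod.rightUnit_hom_tmul (Ω.obj X).obj (Bimod.toUnit K A a) x))

lemma fleft_funit (a b : A) : fleft Ω _ a (funit Ω b) = funit Ω (a * b) :=
  ((Functor.LaxMonoidal.ε Ω).hom.map_left a (Bimod.toUnit K A b)).symm

lemma fright_funit (a b : A) : fright Ω _ a (funit Ω b) = funit Ω (a * b) :=
  ((Functor.LaxMonoidal.ε Ω).hom.map_right a (Bimod.toUnit K A b)).symm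

variable (Ω) in
/-- The inverse of the map `A → Ω(𝟙)`. -/
def funitInv : Fib Ω (𝟙_ C) →ₗ[K] A :=
  (Bimod.toUnit K A).symm.toLinearMap ∘ₗ (Functor.OplaxMonoidal.η Ω).hom.lin

@[simp] lemma funitInv_funit (a : A) : funitInv Ω (funit Ω a) = a :=
  congrArg (fun f : 𝟙_ (FinBimod K A) ⟶ 𝟙_ (FinBimod K A) => f.hom.lin (Bimod.toUnit K A a))
    (Functor.Monoidal.ε_η Ω)

@[simp] lemma funit_funitInv (x : Fib Ω (𝟙_ C)) : funit Ω (funitInv Ω x) = x :=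
  congrArg (fun f : Ω.obj (𝟙_ C) ⟶ Ω.obj (𝟙_ C) => f.hom.lin x)
    (Functor.Monoidal.η_ε Ω)

end Monoidal

/-! ### Products of functionals -/

section Dual

variable {K V : Type u} [Field K] [Fintype V] [DecidableEq V]
  {C : Type u₁} [Category.{v₁} C] {Ω : C ⥤ FinBimod K (FaceR K V)}

/-- The idempotent `ν ∈ R`. -/
abbrev idem (K : Type u) {V : Type u} [Field K] [DecidableEq V] (ν : V) : FaceR K V :=
  Pi.single ν 1

lemma idem_mul (a : FaceR K V) (ν : V) : idem K ν * a = a ν • idem K ν := by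
  ext μ
  by_cases h : μ = ν
  · subst h; simp
  · simp [h]

lemma sum_fleft {X : C} (a : FaceR K V) (x : Fib Ω X) :
    ∑ ν, a ν • fleft Ω X (idem K ν) x = fleft Ω X a x := by
  conv_rhs => rw [← FaceE.sum_single a]
  simp [LinearMap.sum_apply]

lemma sum_fright {X : C} (a : FaceR K V) (x : Fib Ω X) :
    ∑ ν, a ν • fright Ω X (idem K ν) x = fright Ω X a x := by
  conv_rhs => rw [← FaceE.sum_single a]
  simp [LinearMap.sum_apply]

lemma fleft_idem_fleft {X : C} (a : FaceR K V) (ν : V) (x : Fib Ω X) :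
    fleft Ω X (idem K ν) (fleft Ω X a x) = a ν • fleft Ω X (idem K ν) x := by
  rw [← Module.End.mul_apply, ← map_mul, idem_mul, map_smul, LinearMap.smul_apply]

lemma fright_idem_fright {X : C} (a : FaceR K V) (ν : V) (x : Fib Ω X) :
    fright Ω X (idem K ν) (fright Ω X a x) = a ν • fright Ω X (idem K ν) x := by
  rw [← Module.End.mul_apply, ← map_mul, idem_mul, map_smul, LinearMap.smul_apply]

variable [MonoidalCategory C] [Ω.Monoidal]

/-- The bilinear form `(x, y) ↦ ∑ ν, φ(x ν) ψ(ν y)`. -/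
def dualPair {X Y : C} (φ : Module.Dual K (Fib Ω X)) (ψ : Module.Dual K (Fib Ω Y)) :
    Fib Ω X →ₗ[K] Fib Ω Y →ₗ[K] K :=
  ∑ ν, (LinearMap.mul K K).compl₁₂ (φ ∘ₗ fright Ω X (idem K ν)) (ψ ∘ₗ fleft Ω Y (idem K ν))

lemma dualPair_apply {X Y : C} (φ : Module.Dual K (Fib Ω X)) (ψ : Module.Dual K (Fib Ω Y))
    (x : Fib Ω X) (y : Fib Ω Y) : dualPair φ ψ x y =
      ∑ ν, φ (fright Ω X (idem K ν) x) * ψ (fleft Ω Y (idem K ν) y) := by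
  simp [dualPair, LinearMap.sum_apply]

/-- The functional `x ⊗ y ↦ ∑ ν, φ(x ν) ψ(ν y)` on `Ω(X ⊗ Y)`. -/
def dualMul {X Y : C} (φ : Module.Dual K (Fib Ω X)) (ψ : Module.Dual K (Fib Ω Y)) :
    Module.Dual K (Fib Ω (X ⊗ Y)) :=
  -- Moving a across the tensor sign contributes the same factor a(ν) to the ν-th summand on either
  -- side.
  fmulLift (dualPair φ ψ) (fun x a y => by
    simp only [dualPair_apply, fleft_idem_fleft, fright_idem_fright, map_smul, smul_eq_mul]
    exact Finset.sum_congr rfl fun ν _ => by ring)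

@[simp] lemma dualMul_fmul {X Y : C} (φ : Module.Dual K (Fib Ω X)) (ψ : Module.Dual K (Fib Ω Y))
    (x : Fib Ω X) (y : Fib Ω Y) : dualMul φ ψ (fmul Ω X Y x y) =
      ∑ ν, φ (fright Ω X (idem K ν) x) * ψ (fleft Ω Y (idem K ν) y) := by
  rw [dualMul, fmulLift_fmul, dualPair_apply]

lemma dualMul_add {X Y : C} (φ : Module.Dual K (Fib Ω X)) (ψ ψ' : Module.Dual K (Fib Ω Y)) :
    dualMul φ (ψ + ψ') = dualMul φ ψ + dualMul φ ψ' :=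
  fmul_ind fun x y => by simp [mul_add, Finset.sum_add_distrib]

lemma add_dualMul {X Y : C} (φ φ' : Module.Dual K (Fib Ω X)) (ψ : Module.Dual K (Fib Ω Y)) :
    dualMul (φ + φ') ψ = dualMul φ ψ + dualMul φ' ψ :=
  fmul_ind fun x y => by simp [add_mul, Finset.sum_add_distrib]

lemma dualMul_smul {X Y : C} (c : K) (φ : Module.Dual K (Fib Ω X))
    (ψ : Module.Dual K (Fib Ω Y)) : dualMul φ (c • ψ) = c • dualMul φ ψ :=
  fmul_ind fun x y => by simp [Finset.mul_sum, mul_left_comm]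

lemma smul_dualMul {X Y : C} (c : K) (φ : Module.Dual K (Fib Ω X))
    (ψ : Module.Dual K (Fib Ω Y)) : dualMul (c • φ) ψ = c • dualMul φ ψ :=
  fmul_ind fun x y => by simp [Finset.mul_sum, mul_assoc]

lemma dualMul_comp_whiskerRight {X X' Y : C} (f : X ⟶ X') (φ : Module.Dual K (Fib Ω X'))
    (ψ : Module.Dual K (Fib Ω Y)) :
    dualMul (φ ∘ₗ fmap Ω f) ψ = dualMul φ ψ ∘ₗ fmap Ω (f ▷ Y) :=
  fmul_ind fun x y => by simp [fmap_whiskerRight_fmul, fmap_fright]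

lemma dualMul_comp_whiskerLeft {X Y Y' : C} (f : Y ⟶ Y') (φ : Module.Dual K (Fib Ω X))
    (ψ : Module.Dual K (Fib Ω Y')) :
    dualMul φ (ψ ∘ₗ fmap Ω f) = dualMul φ ψ ∘ₗ fmap Ω (X ◁ f) :=
  fmul_ind fun x y => by simp [fmap_whiskerLeft_fmul, fmap_fleft]

/-- Both sides are the same double sum over face idempotents, since the left and right actions on
the middle factor commute. -/
lemma dualMul_assoc {X Y Z : C} (φ : Module.Dual K (Fib Ω X)) (ψ : Module.Dual K (Fib Ω Y))
    (χ : Module.Dual K (Fib Ω Z)) :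
    dualMul (dualMul φ ψ) χ = dualMul φ (dualMul ψ χ) ∘ₗ fmap Ω (α_ X Y Z).hom := by
  refine fmul_ind fun t z => ?_
  refine LinearMap.congr_fun (f := dualMul (dualMul φ ψ) χ ∘ₗ (fmul Ω _ Z).flip z)
    (g := (dualMul φ (dualMul ψ χ) ∘ₗ fmap Ω (α_ X Y Z).hom) ∘ₗ (fmul Ω _ Z).flip z)
    (fmul_ind fun x y => ?_) t
  simp only [LinearMap.comp_apply, LinearMap.flip_apply, fmap_associator_fmul, dualMul_fmul,
    fright_fmul, fleft_fmul, Finset.mul_sum, Finset.sum_mul]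
  rw [Finset.sum_comm]
  simp only [fleft_fright, mul_assoc]

/-- The functional `b ↦ ∑ ν, a(ν) b(ν)` on `Ω(𝟙) = R`. -/
def unitDual (Ω : C ⥤ FinBimod K (FaceR K V)) [Ω.Monoidal] :
    FaceR K V →ₗ[K] Module.Dual K (Fib Ω (𝟙_ C)) :=
  (∑ ν, (LinearMap.mul K K).compl₁₂ (LinearMap.proj ν) (LinearMap.proj ν)).compr₂ LinearMap.id
    |>.compl₂ (funitInv Ω)

@[simp] lemma unitDual_funit (a b : FaceR K V) :
    unitDual Ω a (funit Ω b) = ∑ ν, a ν * b ν := by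
  simp [unitDual, LinearMap.sum_apply]

/-- Under Ω(𝟙) = R the factor for ν is a(ν) times the ν-th coordinate, so summing over ν reassembles
the action of a. This identifies multiplication by the image of E with the E-bimodule structure. -/
lemma unitDual_mul {X : C} (a : FaceR K V) (φ : Module.Dual K (Fib Ω X)) :
    dualMul (unitDual Ω a) φ = (φ ∘ₗ fleft Ω X a) ∘ₗ fmap Ω (λ_ X).hom := by
  refine fmul_ind fun c x => ?_
  rw [← funit_funitInv c]
  simp only [LinearMap.comp_apply, fmap_leftUnitor_fmul, dualMul_fmul, fright_funit,
    unitDual_funit]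
  rw [← Module.End.mul_apply, ← map_mul, ← sum_fleft, map_sum]
  refine Finset.sum_congr rfl fun ν _ => ?_
  rw [map_smul, smul_eq_mul]
  simp [Pi.single_apply]

lemma mul_unitDual {X : C} (a : FaceR K V) (φ : Module.Dual K (Fib Ω X)) :
    dualMul φ (unitDual Ω a) = (φ ∘ₗ fright Ω X a) ∘ₗ fmap Ω (ρ_ X).hom := by
  refine fmul_ind fun x c => ?_
  rw [← funit_funitInv c]
  simp only [LinearMap.comp_apply, fmap_rightUnitor_fmul, dualMul_fmul, fleft_funit,
    unitDual_funit]
  rw [← Module.End.mul_apply, ← map_mul, ← sum_fright, map_sum]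
  refine Finset.sum_congr rfl fun ν _ => ?_
  rw [map_smul, smul_eq_mul, mul_comm]
  simp [Pi.single_apply]

end Dual

/-! ### The algebra structure of the coend -/

section Algebra

variable {K V : Type u} [Field K] [Fintype V] [DecidableEq V]
  {C : Type u₁} [Category.{v₁} C] [EssentiallySmall.{u} C] [Abelian C] [Linear K C]
  [MonoidalCategory C] (Ω : C ⥤ FinBimod K (FaceR K V)) [Ω.Additive] [Ω.Linear K] [Ω.Monoidal]

/-- Left multiplication by `κ_X(φ ⊗ x)`. -/
def coefMul (X : C) (φ : Module.Dual K (Fib Ω X)) (x : Fib Ω X) : Coend Ω →ₗ[K] Coend Ω :=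
  coendDesc
    (fun Y => LinearMap.mk₂ K (fun ψ y => coef Ω (X ⊗ Y) (dualMul φ ψ) (fmul Ω X Y x y))
      (fun _ _ _ => by simp [dualMul_add]) (fun _ _ _ => by simp [dualMul_smul])
      (fun _ _ _ => by simp) (fun _ _ _ => by simp))
    -- Dinaturality in Y is that of κ along X ◁ g.
    (fun g ψ y => by
      simp only [LinearMap.mk₂_apply]
      rw [dualMul_comp_whiskerLeft, coef_comp_fmap, fmap_whiskerLeft_fmul])

@[simp] lemma coefMul_coef {X Y : C} (φ : Module.Dual K (Fib Ω X)) (x : Fib Ω X)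
    (ψ : Module.Dual K (Fib Ω Y)) (y : Fib Ω Y) :
    coefMul Ω X φ x (coef Ω Y ψ y) = coef Ω (X ⊗ Y) (dualMul φ ψ) (fmul Ω X Y x y) :=
  coendDesc_coef _ _ Y ψ y

/-- The multiplication of the coend,
`κ_X(φ ⊗ x) κ_Y(ψ ⊗ y) = κ_{X ⊗ Y}(φ ψ ⊗ x y)`. -/
def coendMul : Coend Ω →ₗ[K] Coend Ω →ₗ[K] Coend Ω :=
  coendDesc
    (fun X => LinearMap.mk₂ K (coefMul Ω X)
      (fun _ _ _ => coend_ext fun _ _ _ => by simp [add_dualMul])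
      (fun _ _ _ => coend_ext fun _ _ _ => by simp [smul_dualMul])
      (fun _ _ _ => coend_ext fun _ _ _ => by simp)
      (fun _ _ _ => coend_ext fun _ _ _ => by simp))
    (fun g φ x => coend_ext fun Y ψ y => by
      simp only [LinearMap.mk₂_apply, coefMul_coef]
      rw [dualMul_comp_whiskerRight, coef_comp_fmap, fmap_whiskerRight_fmul])

lemma coendMul_coef_coef {X Y : C} (φ : Module.Dual K (Fib Ω X)) (x : Fib Ω X)
    (ψ : Module.Dual K (Fib Ω Y)) (y : Fib Ω Y) :
    coendMul Ω (coef Ω X φ x) (coef Ω Y ψ y) =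
      coef Ω (X ⊗ Y) (dualMul φ ψ) (fmul Ω X Y x y) := by
  have h : coendMul Ω (coef Ω X φ x) = coefMul Ω X φ x := coendDesc_coef _ _ X φ x
  rw [h, coefMul_coef]

/-- The map `E → C(Ω)`. -/
def coendIncl : FaceE K V →ₗ[K] Coend Ω :=
  FaceE.lift ((coef Ω (𝟙_ C)).compl₁₂ (unitDual Ω) (funit Ω))

lemma coendIncl_mk (a b : FaceR K V) :
    coendIncl Ω (FaceE.mk a b) = coef Ω (𝟙_ C) (unitDual Ω a) (funit Ω b) := by
  simp [coendIncl]

/-- Dinaturality along the left unitor. This shows that left multiplication by E is the E-action on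
Ω(X)^* ⊗ Ω(X), and it yields the unit law. -/
lemma coendIncl_mul_coef {X : C} (a b : FaceR K V) (φ : Module.Dual K (Fib Ω X))
    (x : Fib Ω X) : coendMul Ω (coendIncl Ω (FaceE.mk a b)) (coef Ω X φ x) =
      coef Ω X (φ ∘ₗ fleft Ω X a) (fleft Ω X b x) := by
  rw [coendIncl_mk, coendMul_coef_coef, unitDual_mul, coef_comp_fmap, fmap_leftUnitor_fmul]

lemma coef_mul_coendIncl {X : C} (a b : FaceR K V) (φ : Module.Dual K (Fib Ω X))
    (x : Fib Ω X) : coendMul Ω (coef Ω X φ x) (coendIncl Ω (FaceE.mk a b)) =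
      coef Ω X (φ ∘ₗ fright Ω X a) (fright Ω X b x) := by
  rw [coendIncl_mk, coendMul_coef_coef, mul_unitDual, coef_comp_fmap, fmap_rightUnitor_fmul]

/-- Dinaturality of κ along the associator, which matches both the functionals and the vectors. -/
lemma coendMul_assoc (h₁ h₂ h₃ : Coend Ω) :
    coendMul Ω (coendMul Ω h₁ h₂) h₃ = coendMul Ω h₁ (coendMul Ω h₂ h₃) := by
  have key : (coendMul Ω).compr₂ (coendMul Ω) =
      (LinearMap.llcomp K _ _ _).flip (coendMul Ω) ∘ₗ
        LinearMap.llcomp K (Coend Ω) (Coend Ω) (Coend Ω) ∘ₗ coendMul Ω := by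
    refine coend_ext fun X φ x => coend_ext fun Y ψ y => coend_ext fun Z χ z => ?_
    simp only [LinearMap.compr₂_apply, LinearMap.comp_apply, LinearMap.flip_apply,
      LinearMap.llcomp_apply, coendMul_coef_coef]
    rw [dualMul_assoc, coef_comp_fmap, fmap_associator_fmul]
  exact LinearMap.congr_fun (LinearMap.congr_fun (LinearMap.congr_fun key h₁) h₂) h₃

lemma coendIncl_one_mul (h : Coend Ω) : coendMul Ω (coendIncl Ω 1) h = h := by
  refine LinearMap.congr_fun (f := coendMul Ω (coendIncl Ω 1)) (g := LinearMap.id)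
    (coend_ext fun X φ x => ?_) h
  rw [← FaceE.mk_one, coendIncl_mul_coef, map_one]
  rfl

lemma mul_coendIncl_one (h : Coend Ω) : coendMul Ω h (coendIncl Ω 1) = h := by
  refine LinearMap.congr_fun (f := (coendMul Ω).flip (coendIncl Ω 1)) (g := LinearMap.id)
    (coend_ext fun X φ x => ?_) h
  rw [LinearMap.flip_apply, ← FaceE.mk_one, coef_mul_coendIncl, map_one]
  rfl

instance : Ring (Coend Ω) where
  __ : AddCommGroup (Coend Ω) := inferInstance
  mul h h' := coendMul Ω h h'
  one := coendIncl Ω 1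
  left_distrib h := map_add (coendMul Ω h)
  right_distrib h h' h'' := LinearMap.map_add₂ (coendMul Ω) h h' h''
  zero_mul h := LinearMap.map_zero₂ (coendMul Ω) h
  mul_zero h := map_zero (coendMul Ω h)
  mul_assoc := coendMul_assoc Ω
  one_mul := coendIncl_one_mul Ω
  mul_one := mul_coendIncl_one Ω

instance : Algebra K (Coend Ω) :=
  Algebra.ofModule (fun c h h' => LinearMap.map_smul₂ (coendMul Ω) c h h')
    (fun c h h' => map_smul (coendMul Ω h) c h')

variable {Ω}

lemma coef_mul_coef {X Y : C} (φ : Module.Dual K (Fib Ω X)) (x : Fib Ω X)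
    (ψ : Module.Dual K (Fib Ω Y)) (y : Fib Ω Y) :
    coef Ω X φ x * coef Ω Y ψ y = coef Ω (X ⊗ Y) (dualMul φ ψ) (fmul Ω X Y x y) :=
  coendMul_coef_coef Ω φ x ψ y

end Algebra

/-! ### The face algebra of a fibre functor -/

section FaceAlgebra

variable {K V : Type u} [Field K] [Fintype V] [DecidableEq V]
  {C : Type u₁} [Category.{v₁} C] [EssentiallySmall.{u} C] [Abelian C] [Linear K C]
  [MonoidalCategory C] (Ω : C ⥤ FinBimod K (FaceR K V)) [Ω.Additive] [Ω.Linear K] [Ω.Monoidal]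

lemma unitDual_comp_fleft (a b : FaceR K V) :
    unitDual Ω b ∘ₗ fleft Ω _ a = unitDual Ω (a * b) := by
  ext c
  rw [← funit_funitInv c, LinearMap.comp_apply, fleft_funit, unitDual_funit, unitDual_funit]
  exact Finset.sum_congr rfl fun ν _ => by rw [Pi.mul_apply, Pi.mul_apply]; ring

/-- Elements of E are matrix coefficients of the unit object, so this is the left E-action on
coefficients applied to X = 𝟙. -/
lemma coendIncl_mul (e e' : FaceE K V) :
    coendIncl Ω (e * e') = coendIncl Ω e * coendIncl Ω e' := by
  have key : (LinearMap.mul K (FaceE K V)).compr₂ (coendIncl Ω) =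
      (coendMul Ω).compl₁₂ (coendIncl Ω) (coendIncl Ω) := by
    refine FaceE.hom_ext fun a b => FaceE.hom_ext fun a' b' => ?_
    simp only [LinearMap.compr₂_apply, LinearMap.mul_apply', FaceE.mk_mul,
      LinearMap.compl₁₂_apply]
    rw [coendIncl_mk Ω a' b', coendIncl_mul_coef, unitDual_comp_fleft, fleft_funit, coendIncl_mk]
  exact LinearMap.congr_fun (LinearMap.congr_fun key e) e'

/-- The algebra map `E → C(Ω)`. -/
def coendInclHom : FaceE K V →ₐ[K] Coend Ω :=
  AlgHom.ofLinearMap (coendIncl Ω) rfl (coendIncl_mul Ω)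

variable {Ω}

/-- The functionals attached to the face idempotents form the basis dual to those idempotents in
Ω(𝟙) = R. -/
lemma sum_unitDual (φ : Module.Dual K (Fib Ω (𝟙_ C))) :
    ∑ ν, φ (funit Ω (idem K ν)) • unitDual Ω (idem K ν) = φ := by
  ext c
  rw [← funit_funitInv c, ← FaceE.sum_single (funitInv Ω c)]
  simp only [LinearMap.sum_apply, LinearMap.smul_apply, map_sum, map_smul, unitDual_funit]
  refine Finset.sum_congr rfl fun ν _ => ?_
  simp [Pi.single_apply, mul_comm]

/-- The coaction on Ω(𝟙) is that of the unit comodule. This gives both the compatibility of Δ with E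
and the unit constraint of the functor to comodules. -/
lemma coact_funit (b : FaceR K V) :
    coact Ω (𝟙_ C) (funit Ω b) =
      ∑ ν, funit Ω (idem K ν) ⊗ₜ coendIncl Ω (FaceE.mk (idem K ν) b) :=
  tensor_ext_contractL fun φ => by
    rw [contractL_coact, map_sum]
    conv_lhs => rw [← sum_unitDual φ]
    simp only [contractL_tmul, coendIncl_mk, map_sum, map_smul, LinearMap.sum_apply,
      LinearMap.smul_apply]

/-- The idempotents ν can be moved to one side of the tensor sign, where ν ν = ν and they sum to 1.
-/
lemma sum_fmul_fright_fleft {X Y : C} (x : Fib Ω X) (y : Fib Ω Y) :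
    ∑ ν, fmul Ω X Y (fright Ω X (idem K ν) x) (fleft Ω Y (idem K ν) y) = fmul Ω X Y x y := by
  simp only [fmul_balanced]
  rw [← map_sum]
  congr 1
  have h := sum_fleft (1 : FaceR K V) y
  simpa only [← Module.End.mul_apply, ← map_mul, ← Pi.single_mul, mul_one, map_one,
    Module.End.one_apply, Pi.one_apply, one_smul] using h

/-- The b_i b'_j span Ω(X ⊗ Y) but need not be independent, so this is not a dual basis expansion.
It holds because x y = ∑ ν, (xν)(νy), with xν and νy then expanded in the two bases. -/
lemma sum_dualMul {X Y : C} (θ : Module.Dual K (Fib Ω (X ⊗ Y))) {ι ι' : Type*} [Fintype ι]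
    [Fintype ι'] (b : Module.Basis ι K (Fib Ω X)) (b' : Module.Basis ι' K (Fib Ω Y)) :
    ∑ i, ∑ j, θ (fmul Ω X Y (b i) (b' j)) • dualMul (b.coord i) (b'.coord j) = θ := by
  refine fmul_ind fun x y => ?_
  have h (x : Fib Ω X) (y : Fib Ω Y) :
      ∑ i, ∑ j, θ (fmul Ω X Y (b i) (b' j)) * (b.coord i x * b'.coord j y) =
        θ (fmul Ω X Y x y) := by
    conv_rhs => rw [← b.sum_repr x, ← b'.sum_repr y]
    simp only [map_sum, map_smul, LinearMap.sum_apply, LinearMap.smul_apply, smul_eq_mul,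
      Module.Basis.coord_apply, Finset.mul_sum]
    rw [Finset.sum_comm]
    exact Finset.sum_congr rfl fun i _ => Finset.sum_congr rfl fun j _ => by ring
  rw [← congrArg θ (sum_fmul_fright_fleft x y), map_sum θ]
  refine Eq.trans ?_ (Finset.sum_congr rfl fun ν _ => h _ _)
  simp only [LinearMap.sum_apply, LinearMap.smul_apply, dualMul_fmul, smul_eq_mul,
    Finset.mul_sum]
  conv_rhs => rw [Finset.sum_comm]
  exact Finset.sum_congr rfl fun i _ => Finset.sum_comm

/-- The key compatibility of coaction and tensor product: it gives both Δ(ab) = Δ(a)Δ(b) and the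
colinearity of the tensor constraint of Ω. After contraction with θ it is the expansion
`sum_dualMul`. -/
lemma coact_fmul {X Y : C} (x : Fib Ω X) (y : Fib Ω Y) :
    coact Ω (X ⊗ Y) (fmul Ω X Y x y) =
      FaceAlg.Com.combine (fmul Ω X Y) (Coend Ω) (coact Ω X x) (coact Ω Y y) :=
  tensor_ext_contractL fun θ => by
    rw [contractL_coact, coact_apply Ω X, coact_apply Ω Y]
    conv_lhs => rw [← sum_dualMul θ (Module.finBasis K (Fib Ω X)) (Module.finBasis K (Fib Ω Y))]
    simp only [map_sum, map_smul, LinearMap.sum_apply, LinearMap.smul_apply,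
      FaceAlg.Com.combine_tmul, contractL_tmul, coef_mul_coef]
    exact Finset.sum_comm

lemma rTensor_coef_combine {X Y : C} (φ : Module.Dual K (Fib Ω X)) (ψ : Module.Dual K (Fib Ω Y))
    (t : Fib Ω X ⊗[K] Coend Ω) (s : Fib Ω Y ⊗[K] Coend Ω) :
    (coef Ω (X ⊗ Y) (dualMul φ ψ)).rTensor (Coend Ω)
        (FaceAlg.Com.combine (fmul Ω X Y) (Coend Ω) t s) =
      (coef Ω X φ).rTensor (Coend Ω) t * (coef Ω Y ψ).rTensor (Coend Ω) s := by
  refine FaceAlg.Com.bil_ind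
    ((FaceAlg.Com.combine (fmul Ω X Y) (Coend Ω)).compr₂
      ((coef Ω (X ⊗ Y) (dualMul φ ψ)).rTensor (Coend Ω)))
    ((LinearMap.mul K (Coend Ω ⊗[K] Coend Ω)).compl₁₂ ((coef Ω X φ).rTensor (Coend Ω))
      ((coef Ω Y ψ).rTensor (Coend Ω))) (fun x h y h' => ?_) t s
  simp [coef_mul_coef]

lemma comul_mul_coend (h h' : Coend Ω) :
    Coalgebra.comul (R := K) (h * h') =
      Coalgebra.comul (R := K) h * Coalgebra.comul (R := K) h' := by
  have key : (coendMul Ω).compr₂ Coalgebra.comul =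
      (LinearMap.mul K (Coend Ω ⊗[K] Coend Ω)).compl₁₂ Coalgebra.comul Coalgebra.comul := by
    refine coend_ext fun X φ x => coend_ext fun Y ψ y => ?_
    simp only [LinearMap.compr₂_apply, LinearMap.compl₁₂_apply, LinearMap.mul_apply',
      coendMul_coef_coef, comul_coef, coact_fmul, rTensor_coef_combine]
  exact LinearMap.congr_fun (LinearMap.congr_fun key h) h'

/-- On coefficients the left side is (φψ)(xy), whose defining sum over ν is term by term the right
side. -/
lemma counit_mul_coend (h h' : Coend Ω) :
    Coalgebra.counit (R := K) (h * h') =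
      ∑ ν, Coalgebra.counit (R := K) (h * coendIncl Ω (FaceE.mk 1 (idem K ν))) *
        Coalgebra.counit (R := K) (coendIncl Ω (FaceE.mk (idem K ν) 1) * h') := by
  have key : (coendMul Ω).compr₂ Coalgebra.counit =
      ∑ ν, (LinearMap.mul K K).compl₁₂
        (Coalgebra.counit ∘ₗ (coendMul Ω).flip (coendIncl Ω (FaceE.mk 1 (idem K ν))))
        (Coalgebra.counit ∘ₗ coendMul Ω (coendIncl Ω (FaceE.mk (idem K ν) 1))) := by
    refine coend_ext fun X φ x => coend_ext fun Y ψ y => ?_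
    simp only [LinearMap.compr₂_apply, LinearMap.compl₁₂_apply, LinearMap.mul_apply',
      LinearMap.sum_apply, LinearMap.comp_apply, LinearMap.flip_apply,
      coendMul_coef_coef, coef_mul_coendIncl, coendIncl_mul_coef, counit_coef, dualMul_fmul,
      map_one, Module.End.one_apply]
  refine (LinearMap.congr_fun (LinearMap.congr_fun key h) h').trans ?_
  rw [LinearMap.sum_apply, LinearMap.sum_apply]
  rfl

lemma counit_coendIncl (e : FaceE K V) :
    Coalgebra.counit (R := K) (coendIncl Ω e) = Coalgebra.counit (R := K) e := by
  refine LinearMap.congr_fun (f := Coalgebra.counit ∘ₗ coendIncl Ω) (g := Coalgebra.counit)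
    (FaceE.hom_ext fun a b => ?_) e
  rw [LinearMap.comp_apply, coendIncl_mk, counit_coef, unitDual_funit, FaceE.counit_mk]

lemma comul_coendIncl (e : FaceE K V) :
    Coalgebra.comul (R := K) (coendIncl Ω e) =
      TensorProduct.map (coendIncl Ω) (coendIncl Ω) (Coalgebra.comul (R := K) e) := by
  refine LinearMap.congr_fun (f := Coalgebra.comul ∘ₗ coendIncl Ω)
    (g := TensorProduct.map (coendIncl Ω) (coendIncl Ω) ∘ₗ Coalgebra.comul)
    (FaceE.hom_ext fun a b => ?_) e
  rw [LinearMap.comp_apply, LinearMap.comp_apply, coendIncl_mk, comul_coef, coact_funit,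
    FaceE.comul_mk]
  simp only [map_sum, LinearMap.rTensor_tmul, TensorProduct.map_tmul, coendIncl_mk]

variable (Ω) in
/-- The face algebra `C(Ω)`. -/
def faceAlg : FaceAlg K V where
  carrier := Coend Ω
  incl := coendInclHom Ω
  counit_incl := counit_coendIncl
  comul_incl := comul_coendIncl
  comul_mul := comul_mul_coend
  counit_mul := counit_mul_coend

end FaceAlgebra

/-! ### The universal property of the face algebra -/

section Universal

variable {K V : Type u} [Field K] [Fintype V] [DecidableEq V]
  {C : Type u₁} [Category.{v₁} C] [EssentiallySmall.{u} C] [Abelian C] [Linear K C]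
  [MonoidalCategory C] (Ω : C ⥤ FinBimod K (FaceR K V)) [Ω.Additive] [Ω.Linear K] [Ω.Monoidal]

lemma Bimod.outerE_ext {N M : Bimod K (FaceR K V)} {P : Type*} [AddCommGroup P] [Module K P]
    {f g : FaceE K V →ₗ[K] Bimod.outer N M →ₗ[K] P}
    (h : ∀ a b n m, f (FaceE.mk a b) (Bimod.outerMk N M n m) =
      g (FaceE.mk a b) (Bimod.outerMk N M n m)) (e x) : f e x = g e x :=
  LinearMap.congr_fun (LinearMap.congr_fun (FaceE.hom_ext fun a b =>
    LinearMap.ext (Bimod.outer_ind (f (FaceE.mk a b)) (g (FaceE.mk a b)) (h a b))) e) x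

/-- The linear map `Ω(X)^* ⊗ Ω(X) → C(Ω)`. -/
def kappaLin (X : C) :
    Bimod.outer (Bimod.dual (Ω.obj X).obj) (Ω.obj X).obj →ₗ[K] (faceAlg Ω).bimod :=
  TensorProduct.lift (coef Ω X)

lemma kappaLin_outerMk {X : C} (φ : Module.Dual K (Fib Ω X)) (x : Fib Ω X) :
    kappaLin Ω X (Bimod.outerMk (Bimod.dual (Ω.obj X).obj) (Ω.obj X).obj φ x) = coef Ω X φ x :=
  TensorProduct.lift.tmul (f' := coef Ω X) φ x

/-- The structure map `κ_X : Ω(X)^* ⊗ Ω(X) → C(Ω)`. -/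
def kappa (X : C) :
    Bimod.outer (Bimod.dual (Ω.obj X).obj) (Ω.obj X).obj ⟶ (faceAlg Ω).bimod where
  lin := kappaLin Ω X
  map_left := Bimod.outerE_ext
    (f := (Bimod.outer _ _).left.toLinearMap.compr₂ (kappaLin Ω X))
    (g := (faceAlg Ω).bimod.left.toLinearMap.compl₂ (kappaLin Ω X)) fun a b φ x => by
      refine (kappaLin_outerMk Ω _ _).trans ((coendIncl_mul_coef Ω a b φ x).symm.trans ?_)
      exact congrArg (coendMul Ω (coendIncl Ω (FaceE.mk a b))) (kappaLin_outerMk Ω φ x).symm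
  map_right := Bimod.outerE_ext
    (f := (Bimod.outer _ _).right.toLinearMap.compr₂ (kappaLin Ω X))
    (g := (faceAlg Ω).bimod.right.toLinearMap.compl₂ (kappaLin Ω X)) fun a b φ x => by
      refine (kappaLin_outerMk Ω _ _).trans ((coef_mul_coendIncl Ω a b φ x).symm.trans ?_)
      exact congrArg ((coendMul Ω).flip (coendIncl Ω (FaceE.mk a b)))
        (kappaLin_outerMk Ω φ x).symm

/-- The universal cowedge. -/
def faceCowedge : Cowedge (coendDiagram Ω) :=
  Cowedge.mk (faceAlg Ω).bimod (kappa Ω) fun {X Y} f => Bimod.hom_ext <|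
    Bimod.outer_ind _ _ fun φ x => by
      refine (kappaLin_outerMk Ω (X := X) (φ ∘ₗ fmap Ω f) x).trans ?_
      exact (coef_comp_fmap f φ x).trans (kappaLin_outerMk Ω φ (fmap Ω f x)).symm

/-- The bilinear map underlying the structure map of a cowedge. -/
def cowedgeBil (c : Cowedge (coendDiagram Ω)) (X : C) :
    Module.Dual K (Fib Ω X) →ₗ[K] Fib Ω X →ₗ[K] c.pt.carrier :=
  (Bimod.outerMk (Bimod.dual (Ω.obj X).obj) (Ω.obj X).obj).compr₂ (c.π X).lin

/-- The linear map from the face algebra to a cowedge. -/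
def cowedgeDescLin (c : Cowedge (coendDiagram Ω)) : Coend Ω →ₗ[K] c.pt.carrier :=
  coendDesc (cowedgeBil Ω c) fun {X Y} f φ x =>
    congrArg (fun k : Bimod.outer (Bimod.dual (Ω.obj Y).obj) (Ω.obj X).obj ⟶ c.pt =>
      k.lin (Bimod.outerMk _ _ φ x)) (Cowedge.condition c f)

lemma cowedgeDescLin_coef (c : Cowedge (coendDiagram Ω)) {X : C}
    (φ : Module.Dual K (Fib Ω X)) (x : Fib Ω X) :
    cowedgeDescLin Ω c (coef Ω X φ x) = cowedgeBil Ω c X φ x := coendDesc_coef _ _ X φ x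

/-- The map of bimodules from the face algebra to a cowedge. -/
def cowedgeDesc (c : Cowedge (coendDiagram Ω)) : (faceAlg Ω).bimod ⟶ c.pt where
  lin := cowedgeDescLin Ω c
  map_left e h := by
    have key : (coendMul Ω ∘ₗ coendIncl Ω).compr₂ (cowedgeDescLin Ω c) =
        c.pt.left.toLinearMap.compl₂ (cowedgeDescLin Ω c) :=
      FaceE.hom_ext fun a b => coend_ext fun X φ x => by
        simp only [LinearMap.compr₂_apply, LinearMap.comp_apply, LinearMap.compl₂_apply,
          coendIncl_mul_coef, cowedgeDescLin_coef]
        exact (c.π X).map_left (FaceE.mk a b) (Bimod.outerMk _ _ φ x)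
    exact LinearMap.congr_fun (LinearMap.congr_fun key e) h
  map_right e h := by
    have key : ((coendMul Ω).flip ∘ₗ coendIncl Ω).compr₂ (cowedgeDescLin Ω c) =
        c.pt.right.toLinearMap.compl₂ (cowedgeDescLin Ω c) :=
      FaceE.hom_ext fun a b => coend_ext fun X φ x => by
        simp only [LinearMap.compr₂_apply, LinearMap.comp_apply, LinearMap.compl₂_apply,
          LinearMap.flip_apply, coef_mul_coendIncl, cowedgeDescLin_coef]
        exact (c.π X).map_right (FaceE.mk a b) (Bimod.outerMk _ _ φ x)
    exact LinearMap.congr_fun (LinearMap.congr_fun key e) h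

lemma kappa_cowedgeDesc (c : Cowedge (coendDiagram Ω)) (X : C) :
    kappa Ω X ≫ cowedgeDesc Ω c = c.π X :=
  Bimod.hom_ext <| Bimod.outer_ind _ _ fun φ x =>
    (congrArg (cowedgeDescLin Ω c) (kappaLin_outerMk Ω φ x)).trans (cowedgeDescLin_coef Ω c φ x)

lemma faceAlg_hom_ext {P : Bimod K (FaceE K V)} {f g : (faceAlg Ω).bimod ⟶ P}
    (h : ∀ X, kappa Ω X ≫ f = kappa Ω X ≫ g) : f = g :=
  Bimod.Hom.lin_injective <| coend_ext (f := f.lin) (g := g.lin) fun X φ x => by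
    have e := congrArg (fun k : Bimod.outer (Bimod.dual (Ω.obj X).obj) (Ω.obj X).obj ⟶ P =>
      k.lin (Bimod.outerMk _ _ φ x)) (h X)
    exact (congrArg f.lin (kappaLin_outerMk Ω φ x)).symm.trans
      (e.trans (congrArg g.lin (kappaLin_outerMk Ω φ x)))

/-- The face algebra is the coend of `Ω^* ⊗ Ω`. -/
def isColimitFaceCowedge : IsColimit (faceCowedge Ω) :=
  Multicofork.IsColimit.mk _ (cowedgeDesc Ω) (kappa_cowedgeDesc Ω) fun c _ hm =>
    faceAlg_hom_ext Ω fun X => (hm X).trans (kappa_cowedgeDesc Ω c X).symm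

lemma hasCoend : HasCoend (coendDiagram Ω) := ⟨⟨⟨_, isColimitFaceCowedge Ω⟩⟩⟩

/-- Lets the theorem be stated for an arbitrary coend, with its own structure maps. -/
lemma exists_iso_faceAlg (c : Cowedge (coendDiagram Ω)) (hc : IsColimit c) :
    ∃ e : c.pt ≅ (faceAlg Ω).bimod, ∀ X, c.π X ≫ e.hom = kappa Ω X :=
  ⟨hc.coconePointUniqueUpToIso (isColimitFaceCowedge Ω), fun X =>
    hc.comp_coconePointUniqueUpToIso_hom (isColimitFaceCowedge Ω) (.right X)⟩

lemma coaction_kappa (X : C) :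
    FaceAlg.coaction (H := faceAlg Ω) (Ω.obj X) (kappa Ω X) = coact Ω X := by
  have h (φ : Module.Dual K (Fib Ω X)) :
      FaceAlg.linTo (kappa Ω X) ∘ₗ Bimod.outerMk (Bimod.dual (Ω.obj X).obj) (Ω.obj X).obj φ =
        coef Ω X φ := LinearMap.ext fun x => kappaLin_outerMk Ω φ x
  exact Finset.sum_congr rfl fun i _ => congrArg (fun k : Fib Ω X →ₗ[K] Coend Ω =>
    TensorProduct.mk K (Fib Ω X) (Coend Ω) (Module.finBasis K (Fib Ω X) i) ∘ₗ k) (h _)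

end Universal

/-! ### The functor to comodules -/

section Functor

variable {K V : Type u} [Field K] [Fintype V] [DecidableEq V]
  {C : Type u₁} [Category.{v₁} C] [EssentiallySmall.{u} C] [Abelian C] [Linear K C]
  [MonoidalCategory C] (Ω : C ⥤ FinBimod K (FaceR K V)) [Ω.Additive] [Ω.Linear K] [Ω.Monoidal]

/-- The comodule `Ω(X)`. -/
def comObj (X : C) : (faceAlg Ω).Com where
  carrier := Fib Ω X
  δ := coact Ω X
  coassoc := coact_coassoc
  counit_δ := coact_counit

/-- The comodule map `Ω(f)`. -/
def comMap {X Y : C} (f : X ⟶ Y) : comObj Ω X ⟶ comObj Ω Y where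
  lin := fmap Ω f
  comm := coact_fmap f

/-- The functor `Ω`, with values in comodules. -/
def comFunctor : C ⥤ (faceAlg Ω).Com where
  obj := comObj Ω
  map := comMap Ω
  map_id X := FaceAlg.Com.hom_ext (fmap_id Ω X)
  map_comp f g := FaceAlg.Com.hom_ext (fmap_comp Ω f g)

instance : (comFunctor Ω).Additive where
  map_add := FaceAlg.Com.hom_ext fun x => LinearMap.congr_fun (fmap_add Ω _ _) x

instance : (comFunctor Ω).Linear K where
  map_smul _ _ := FaceAlg.Com.hom_ext fun x => LinearMap.congr_fun (fmap_smul Ω _ _) x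

variable {Ω}

lemma dual_contract {M : Type*} [AddCommGroup M] [Module K M] {P : Type*} [AddCommGroup P]
    [Module K P] (φ : Module.Dual K M) (ψ : P →ₗ[K] K) (t : M ⊗[K] P) :
    φ (FaceAlg.Com.contract ψ t) = ψ (contractL P φ t) := by
  induction t using TensorProduct.induction_on with
  | zero => simp
  | add t s ht hs => simp only [map_add, ht, hs]
  | tmul m p => simp [mul_comm]

lemma eq_of_dual_eq {M : Type*} [AddCommGroup M] [Module K M] {x y : M}
    (h : ∀ φ : Module.Dual K M, φ x = φ y) : x = y :=
  sub_eq_zero.1 <| (Module.forall_dual_apply_eq_zero_iff K _).1 fun φ => by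
    rw [map_sub, h, sub_self]

/-- Paired with φ, the left side is ε(a κ_X(φ ⊗ x)) = φ(a x). So the bimodule structure read off
from the coaction is the original one, and `comObjIso` can be the identity on elements. -/
lemma comObj_actL {X : C} (a : FaceR K V) (x : Fib Ω X) :
    (comObj Ω X).actL a x = fleft Ω X a x := by
  refine eq_of_dual_eq (K := K) (M := Fib Ω X) fun φ => ?_
  refine (dual_contract φ (FaceAlg.Com.εl (faceAlg Ω) a) (coact Ω X x)).trans ?_
  refine (congrArg (FaceAlg.Com.εl (faceAlg Ω) a) (contractL_coact φ x)).trans ?_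
  refine (congrArg (coendCounit Ω) (coendIncl_mul_coef Ω 1 a φ x)).trans ?_
  rw [coendCounit_coef, map_one]
  rfl

lemma comObj_actR {X : C} (a : FaceR K V) (x : Fib Ω X) :
    (comObj Ω X).actR a x = fright Ω X a x := by
  refine eq_of_dual_eq (K := K) (M := Fib Ω X) fun φ => ?_
  refine (dual_contract φ (FaceAlg.Com.εr (faceAlg Ω) a) (coact Ω X x)).trans ?_
  refine (congrArg (FaceAlg.Com.εr (faceAlg Ω) a) (contractL_coact φ x)).trans ?_
  refine (congrArg (coendCounit Ω) (coef_mul_coendIncl Ω 1 a φ x)).trans ?_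
  rw [coendCounit_coef, map_one]
  rfl

variable (Ω) in
/-- The isomorphism of the bimodule of the comodule `Ω(X)` with `Ω(X)`. -/
def comObjIso (X : C) : (comObj Ω X).bimod ≅ (Ω.obj X).obj :=
  Bimod.isoMk
    { lin := (LinearMap.id : Fib Ω X →ₗ[K] Fib Ω X)
      map_left := comObj_actL
      map_right := comObj_actR }
    (LinearMap.id : Fib Ω X →ₗ[K] Fib Ω X) (fun _ => rfl) (fun _ => rfl)

variable (Ω) in
/-- The isomorphism of the underlying functor of `comFunctor Ω` with `Ω`. -/
def comFunctorIso : comFunctor Ω ⋙ FaceAlg.Com.forget (faceAlg Ω) ≅ Ω ⋙ toBimod K V :=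
  NatIso.ofComponents (comObjIso Ω) (fun _ => rfl)

/-! ### The tensor structure of the functor to comodules -/

/-- The map `Ω(X) × Ω(Y) → Ω(X) ⊗_R Ω(Y)` to the tensor product of comodules. -/
def comTmul (X Y : C) :
    Fib Ω X →ₗ[K] Fib Ω Y →ₗ[K] FaceAlg.Com.tensor (comObj Ω X) (comObj Ω Y) :=
  FaceAlg.Com.tmul (comObj Ω X) (comObj Ω Y)

variable (Ω) in
/-- The linear map `Ω(X) ⊗_R Ω(Y) → Ω(X ⊗ Y)`. -/
def comμLin (X Y : C) : FaceAlg.Com.tensor (comObj Ω X) (comObj Ω Y) →ₗ[K] Fib Ω (X ⊗ Y) :=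
  Bimod.lift (M := (comObj Ω X).bimod) (N := (comObj Ω Y).bimod) (fmul Ω X Y)
    fun x a y => (congrArg (fun t => fmul Ω X Y t y) (comObj_actR a x)).trans
      ((fmul_balanced x a y).trans (congrArg (fmul Ω X Y x) (comObj_actL a y)).symm)

lemma comμLin_tmul {X Y : C} (x : Fib Ω X) (y : Fib Ω Y) :
    comμLin Ω X Y (comTmul X Y x y) = fmul Ω X Y x y :=
  Bimod.lift_tmul (M := (comObj Ω X).bimod) (N := (comObj Ω Y).bimod) (fmul Ω X Y) _ x y

variable (Ω) in
/-- The linear map `Ω(X ⊗ Y) → Ω(X) ⊗_R Ω(Y)`. -/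
def comμInv (X Y : C) : Fib Ω (X ⊗ Y) →ₗ[K] FaceAlg.Com.tensor (comObj Ω X) (comObj Ω Y) :=
  fmulLift (comTmul X Y) fun x a y => by
    rw [← comObj_actL, ← comObj_actR]
    exact FaceAlg.Com.tm_balanced (comObj Ω X) (comObj Ω Y) x a y

variable (Ω) in
/-- The tensor constraint of `comFunctor Ω`, as a comodule map. -/
def comμHom (X Y : C) : FaceAlg.Com.tensor (comObj Ω X) (comObj Ω Y) ⟶ comObj Ω (X ⊗ Y) where
  lin := comμLin Ω X Y
  comm := FaceAlg.Com.tensor_ind (coact Ω (X ⊗ Y) ∘ₗ comμLin Ω X Y)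
    ((comμLin Ω X Y).rTensor (faceAlg Ω) ∘ₗ (FaceAlg.Com.tensor _ _).δ) fun x y => by
      -- Colinearity is `coact_fmul`, up to replacing x ⊗ y by its product in Ω(X ⊗ Y).
      refine (congrArg (coact Ω (X ⊗ Y)) (comμLin_tmul x y)).trans ((coact_fmul x y).trans ?_)
      refine Eq.trans ?_ (congrArg ((comμLin Ω X Y).rTensor (faceAlg Ω))
        (FaceAlg.Com.tensor_δ (comObj Ω X) (comObj Ω Y) x y)).symm
      refine FaceAlg.Com.bil_ind (FaceAlg.Com.combine (fmul Ω X Y) (faceAlg Ω))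
        ((FaceAlg.Com.combine (comTmul X Y) (faceAlg Ω)).compr₂
          ((comμLin Ω X Y).rTensor (faceAlg Ω))) (fun x h y h' => ?_) _ _
      rw [LinearMap.compr₂_apply, FaceAlg.Com.combine_tmul, FaceAlg.Com.combine_tmul,
        LinearMap.rTensor_tmul, comμLin_tmul]

variable (Ω) in
/-- The tensor constraint of `comFunctor Ω`. -/
def comμIso (X Y : C) : FaceAlg.Com.tensor (comObj Ω X) (comObj Ω Y) ≅ comObj Ω (X ⊗ Y) :=
  FaceAlg.Com.isoMk (comμHom Ω X Y) (comμInv Ω X Y)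
    (FaceAlg.Com.tensor_ind (comμInv Ω X Y ∘ₗ comμLin Ω X Y) LinearMap.id fun x y =>
      (congrArg (comμInv Ω X Y) (comμLin_tmul x y)).trans (fmulLift_fmul _ _ x y))
    (LinearMap.congr_fun (fmul_ind (f := comμLin Ω X Y ∘ₗ comμInv Ω X Y) (g := LinearMap.id)
      fun x y => (congrArg (comμLin Ω X Y) (fmulLift_fmul _ _ x y)).trans (comμLin_tmul x y)))

variable (Ω) in
/-- The unit constraint of `comFunctor Ω`. -/
def comεIso : FaceAlg.Com.unit (faceAlg Ω) ≅ comObj Ω (𝟙_ C) :=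
  FaceAlg.Com.isoMk
    { lin := funit (A := FaceR K V) Ω
      comm := fun (a : FaceR K V) => by
        refine (coact_funit a).trans ?_
        refine Eq.trans ?_ (congrArg ((funit Ω).rTensor (faceAlg Ω))
          (FaceAlg.Com.unitδ_apply (H := faceAlg Ω) a)).symm
        rw [map_sum]
        rfl }
    (funitInv Ω) (funitInv_funit (A := FaceR K V)) funit_funitInv

variable (Ω) in
/-- The tensor structure of `comFunctor Ω`. -/
def comCore : (comFunctor Ω).CoreMonoidal where
  εIso := comεIso Ω
  μIso := comμIso Ω
  -- Each coherence condition is tested on pure tensors, where the constraint is multiplication Ω(X)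
  -- × Ω(Y) → Ω(X ⊗ Y); there it is the corresponding elementwise identity for Ω.
  μIso_hom_natural_left {X Y} f Z := FaceAlg.Com.hom_ext <| FaceAlg.Com.tensor_ind _ _ fun x z =>
    (congrArg (comμLin Ω Y Z)
      (FaceAlg.Com.tensorLin_tmul (comMap Ω f) (𝟙 (comObj Ω Z)) x z)).trans
      ((comμLin_tmul (fmap Ω f x) z).trans ((fmap_whiskerRight_fmul f x z).symm.trans
        (congrArg (fmap Ω (f ▷ Z)) (comμLin_tmul x z)).symm))
  μIso_hom_natural_right {X Y} Z f := FaceAlg.Com.hom_ext <| FaceAlg.Com.tensor_ind _ _ fun z x =>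
    (congrArg (comμLin Ω Z Y)
      (FaceAlg.Com.tensorLin_tmul (𝟙 (comObj Ω Z)) (comMap Ω f) z x)).trans
      ((comμLin_tmul z (fmap Ω f x)).trans ((fmap_whiskerLeft_fmul f z x).symm.trans
        (congrArg (fmap Ω (Z ◁ f)) (comμLin_tmul z x)).symm))
  associativity X Y Z := FaceAlg.Com.hom_ext <| FaceAlg.Com.tensor₃_ind _ _ fun x y z => by
    refine (congrArg (fun t => fmap Ω (α_ X Y Z).hom (comμLin Ω (X ⊗ Y) Z t))
      (FaceAlg.Com.tensorLin_tmul (comμHom Ω X Y) (𝟙 (comObj Ω Z)) (comTmul X Y x y) z)).trans ?_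
    refine (congrArg (fun t => fmap Ω (α_ X Y Z).hom (comμLin Ω (X ⊗ Y) Z
      (comTmul (X ⊗ Y) Z t z))) (comμLin_tmul x y)).trans ?_
    refine (congrArg (fmap Ω (α_ X Y Z).hom) (comμLin_tmul _ z)).trans ?_
    refine (fmap_associator_fmul x y z).trans ?_
    refine ((congrArg (fun t => comμLin Ω X (Y ⊗ Z)
      (FaceAlg.Com.tensorLin (𝟙 (comObj Ω X)) (comμHom Ω Y Z) t))
      (FaceAlg.Com.assocB_tmul (comObj Ω X) (comObj Ω Y) (comObj Ω Z) x y z)).trans ?_).symm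
    refine (congrArg (comμLin Ω X (Y ⊗ Z))
      (FaceAlg.Com.tensorLin_tmul (𝟙 (comObj Ω X)) (comμHom Ω Y Z) x (comTmul Y Z y z))).trans ?_
    exact (comμLin_tmul x _).trans (congrArg (fmul Ω X _ x) (comμLin_tmul y z))
  left_unitality X := FaceAlg.Com.hom_ext <| FaceAlg.Com.tensor_ind _ _
      fun (a : FaceR K V) (x : Fib Ω X) => by
    refine (FaceAlg.Com.leftUnitB_tmul (comObj Ω X) a x).trans ((comObj_actL a x).trans ?_)
    refine (fmap_leftUnitor_fmul a x).symm.trans ?_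
    refine (congrArg (fmap Ω (λ_ X).hom) (comμLin_tmul (funit Ω a) x)).symm.trans ?_
    exact (congrArg (fun t => fmap Ω (λ_ X).hom (comμLin Ω (𝟙_ C) X t))
      (FaceAlg.Com.tensorLin_tmul (comεIso Ω).hom (𝟙 (comObj Ω X)) a x)).symm
  right_unitality X := FaceAlg.Com.hom_ext <| FaceAlg.Com.tensor_ind _ _
      fun (x : Fib Ω X) (a : FaceR K V) => by
    refine (FaceAlg.Com.rightUnitB_tmul (comObj Ω X) x a).trans ((comObj_actR a x).trans ?_)
    refine (fmap_rightUnitor_fmul a x).symm.trans ?_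
    refine (congrArg (fmap Ω (ρ_ X).hom) (comμLin_tmul x (funit Ω a))).symm.trans ?_
    exact (congrArg (fun t => fmap Ω (ρ_ X).hom (comμLin Ω X (𝟙_ C) t))
      (FaceAlg.Com.tensorLin_tmul (𝟙 (comObj Ω X)) (comεIso Ω).hom x a)).symm

instance : (comFunctor Ω).Monoidal := (comCore Ω).toMonoidal

instance : NatTrans.IsMonoidal (comFunctorIso Ω).hom where
  unit := Bimod.hom_ext fun a => by
    rw [Functor.LaxMonoidal.comp_ε, Functor.LaxMonoidal.comp_ε]
    rfl
  tensor X Y := Bimod.tens_hom_ext fun x y => by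
    rw [Functor.LaxMonoidal.comp_μ, Functor.LaxMonoidal.comp_μ]
    refine (comμLin_tmul x y).trans ?_
    exact (congrArg (Functor.LaxMonoidal.μ Ω X Y).hom.lin
      (Bimod.tensHom_tmul (comObjIso Ω X).hom (comObjIso Ω Y).hom x y)).symm

end Functor

/-! ### Comodules over the face algebra -/

section Equivalence

variable {K V : Type u} [Field K] [Fintype V] [DecidableEq V]
  {C : Type u₁} [Category.{v₁} C] [EssentiallySmall.{u} C] [Abelian C] [Linear K C]
  [MonoidalCategory C] (Ω : C ⥤ FinBimod K (FaceR K V)) [Ω.Additive] [Ω.Linear K] [Ω.Monoidal]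
  [PreservesFiniteLimits Ω] [PreservesFiniteColimits Ω]

/-- The element `z` of `Ω(Z)` is not contained in `Ω(Z')` for a proper subobject `Z'` of `Z`. -/
def IsGenerator {Z : C} (z : Fib Ω Z) : Prop :=
  ∀ (Y : C) (f : Y ⟶ Z) (y : Fib Ω Y), fmap Ω f y = z → Function.Surjective (fmap Ω f)

/-- Among all lifts of x along maps Z ⟶ X, take one with dim Ω(Z) minimal. If g hits z, its image
carries another lift of x, so minimality forces the image to have full dimension. -/
lemma exists_isGenerator {X : C} (x : Fib Ω X) :
    ∃ (Z : C) (f : Z ⟶ X) (z : Fib Ω Z), fmap Ω f z = x ∧ IsGenerator Ω z := by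
  classical
  have h : ∃ n, ∃ (Z : C) (f : Z ⟶ X) (z : Fib Ω Z), fmap Ω f z = x ∧
      Module.finrank K (Fib Ω Z) = n := ⟨_, X, 𝟙 X, x, fmap_id Ω X x, rfl⟩
  obtain ⟨Z, f, z, hz, hn⟩ := Nat.find_spec h
  refine ⟨Z, f, z, hz, fun Y g y hy => ?_⟩
  have hι := injective_fmap Ω (Abelian.image.ι g)
  have hg : fmap Ω (Abelian.image.ι g) ∘ₗ fmap Ω (Abelian.factorThruImage g) = fmap Ω g := by
    rw [← fmap_comp', Abelian.image.fac]
  have hle : Module.finrank K (Fib Ω Z) ≤ Module.finrank K (Fib Ω (Abelian.image g)) := by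
    rw [hn]
    refine Nat.find_min' h ⟨_, Abelian.image.ι g ≫ f, fmap Ω (Abelian.factorThruImage g) y, ?_, rfl⟩
    rw [fmap_comp, ← LinearMap.comp_apply (fmap Ω (Abelian.image.ι g)), hg, hy, hz]
  have hs := (LinearMap.injective_iff_surjective_of_finrank_eq_finrank
    (le_antisymm (LinearMap.finrank_le_finrank_of_injective hι) hle)).1 hι
  rw [← hg, LinearMap.coe_comp]
  exact hs.comp (surjective_fmap Ω (Abelian.factorThruImage g))

variable {Ω}

/-- Vanishing gives an f that hits z with φ ∘ Ω(f) = 0, and such an f is surjective on fibres. -/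
lemma IsGenerator.eq_zero {Z : C} {z : Fib Ω Z} (hz : IsGenerator Ω z)
    {φ : Module.Dual K (Fib Ω Z)} (h : coef Ω Z φ z = 0) : φ = 0 := by
  obtain ⟨Y, f, y, hy, hφ⟩ := coef_eq_zero h
  ext x
  obtain ⟨x, rfl⟩ := hz Y f y hy x
  exact LinearMap.congr_fun hφ x

/-- The second legs of the coaction of a generator are linearly independent, so a linear map can be
read off from its effect on the first leg. An identity known only at z thereby holds on all of Ω(Z).
-/
lemma IsGenerator.linearMap_ext {Z : C} {z : Fib Ω Z} (hz : IsGenerator Ω z) {P : Type*}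
    [AddCommGroup P] [Module K P] {f g : Fib Ω Z →ₗ[K] P}
    (h : f.rTensor (Coend Ω) (coact Ω Z z) = g.rTensor (Coend Ω) (coact Ω Z z)) : f = g := by
  refine LinearMap.ext fun x => eq_of_dual_eq (K := K) fun φ => ?_
  have h' : φ ∘ₗ f - φ ∘ₗ g = 0 := hz.eq_zero (by
    rw [map_sub, LinearMap.sub_apply, ← contractL_coact, ← contractL_coact, ← contractL_rTensor,
      ← contractL_rTensor, h, sub_self])
  exact LinearMap.congr_fun (sub_eq_zero.1 h') x

/-- The coaction of a comodule over the coend. -/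
def comδ (M : (faceAlg Ω).Com) : M →ₗ[K] M ⊗[K] Coend Ω := M.δ

lemma comδ_coassoc (M : (faceAlg Ω).Com) (m : M) :
    TensorProduct.assoc K _ _ _ ((comδ M).rTensor (Coend Ω) (comδ M m)) =
      (coendComul Ω).lTensor M (comδ M m) := M.coassoc m

lemma comδ_counit (M : (faceAlg Ω).Com) (m : M) :
    TensorProduct.rid K _ ((coendCounit Ω).lTensor M (comδ M m)) = m := M.counit_δ m

/-- The linear map underlying a comodule map from `Ω(X)`. -/
def comLin {X : C} {M : (faceAlg Ω).Com} (u : comObj Ω X ⟶ M) : Fib Ω X →ₗ[K] M := u.lin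

lemma comLin_ext {X : C} {M : (faceAlg Ω).Com} {u v : comObj Ω X ⟶ M}
    (h : ∀ x, comLin u x = comLin v x) : u = v := FaceAlg.Com.hom_ext h

lemma comδ_comLin {X : C} {M : (faceAlg Ω).Com} (u : comObj Ω X ⟶ M) (x : Fib Ω X) :
    comδ M (comLin u x) = (comLin u).rTensor (Coend Ω) (coact Ω X x) := u.comm x

/-- A comodule map from `Ω(X)`. -/
def comHomMk {X : C} {M : (faceAlg Ω).Com} (g : Fib Ω X →ₗ[K] M)
    (h : ∀ x, comδ M (g x) = g.rTensor (Coend Ω) (coact Ω X x)) : comObj Ω X ⟶ M := ⟨g, h⟩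

@[simp] lemma comLin_comHomMk {X : C} {M : (faceAlg Ω).Com} (g : Fib Ω X →ₗ[K] M) (h) :
    comLin (comHomMk g h) = g := rfl

@[simp] lemma comLin_comp {X Y : C} {M : (faceAlg Ω).Com} (f : X ⟶ Y) (u : comObj Ω Y ⟶ M) :
    comLin (comMap Ω f ≫ u) = comLin u ∘ₗ fmap Ω f := rfl

@[simp] lemma comLin_add {X : C} {M : (faceAlg Ω).Com} (u v : comObj Ω X ⟶ M) :
    comLin (u + v) = comLin u + comLin v := rfl

@[simp] lemma comLin_sub {X : C} {M : (faceAlg Ω).Com} (u v : comObj Ω X ⟶ M) :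
    comLin (u - v) = comLin u - comLin v := rfl

@[simp] lemma comLin_zero (X : C) (M : (faceAlg Ω).Com) :
    comLin (0 : comObj Ω X ⟶ M) = 0 := rfl

lemma comLin_sum {ι : Type*} [Fintype ι] {X : C} {M : (faceAlg Ω).Com}
    (u : ι → (comObj Ω X ⟶ M)) : comLin (∑ i, u i) = ∑ i, comLin (u i) :=
  map_sum (⟨⟨comLin, rfl⟩, comLin_add⟩ : (comObj Ω X ⟶ M) →+ (Fib Ω X →ₗ[K] M)) u _

lemma IsGenerator.hom_ext {Z : C} {z : Fib Ω Z} (hz : IsGenerator Ω z) {M : (faceAlg Ω).Com}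
    {u v : comObj Ω Z ⟶ M} (h : comLin u z = comLin v z) : u = v :=
  comLin_ext <| LinearMap.congr_fun <| hz.linearMap_ext <| by
    rw [← comδ_comLin, h, comδ_comLin]

section

attribute [local instance] Abelian.hasFiniteBiproducts

lemma biproduct_π_fmap_ι {n : ℕ} (X : Fin n → C) (x : ∀ i, Fib Ω (X i)) (i : Fin n) :
    fmap Ω (biproduct.π X i) (∑ j, fmap Ω (biproduct.ι X j) (x j)) = x i := by
  rw [map_sum, Finset.sum_eq_single i]
  · rw [← fmap_comp, biproduct.ι_π_self, fmap_id]
  · intro j _ hj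
    rw [← fmap_comp, biproduct.ι_π_ne _ hj, fmap_zero, LinearMap.zero_apply]
  · simp

/-- Pack the vectors of the separate coefficients into one vector of a biproduct, lift it to a
generator, and pull the functionals back along the projections. -/
lemma exists_coef_eq {n : ℕ} (h : Fin n → Coend Ω) :
    ∃ (Z : C) (z : Fib Ω Z) (φ : Fin n → Module.Dual K (Fib Ω Z)),
      IsGenerator Ω z ∧ ∀ i, coef Ω Z (φ i) z = h i := by
  choose X φ x hx using fun i => coef_surjective (h i)
  obtain ⟨Z, f, z, hz, hg⟩ := exists_isGenerator Ω (∑ j, fmap Ω (biproduct.ι X j) (x j))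
  refine ⟨Z, z, fun i => (φ i ∘ₗ fmap Ω (biproduct.π X i)) ∘ₗ fmap Ω f, hg, fun i => ?_⟩
  rw [coef_comp_fmap, coef_comp_fmap, hz, biproduct_π_fmap_ι, hx]

lemma rid_rTensor {M N : Type*} [AddCommGroup M] [Module K M] [AddCommGroup N] [Module K N]
    (f : M →ₗ[K] N) (t : M ⊗[K] K) :
    TensorProduct.rid K N (f.rTensor K t) = f (TensorProduct.rid K M t) := by
  induction t using TensorProduct.induction_on with
  | zero => simp
  | add t s ht hs => simp only [map_add, ht, hs]
  | tmul m p => simp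

/-- The coefficients of δ(m) all live at one generator z, so δ(m) = (g ⊗ 1) δ(z) for a linear g :
Ω(Z) → M. It remains to see that g is colinear and takes z to m. -/
lemma exists_hom_apply_eq {M : (faceAlg Ω).Com} (m : M) :
    ∃ (Z : C) (u : comObj Ω Z ⟶ M) (z : Fib Ω Z), comLin u z = m := by
  let b := Module.finBasis K M
  obtain ⟨Z, z, φ, hg, hφ⟩ := exists_coef_eq fun i => contractL (Coend Ω) (b.coord i) (comδ M m)
  let g : Fib Ω Z →ₗ[K] M := ∑ i, (φ i).smulRight (b i)
  have hgφ (i) : b.coord i ∘ₗ g = φ i := by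
    ext x
    simp [g, Finsupp.single_apply]
  have h₁ : comδ M m = g.rTensor (Coend Ω) (coact Ω Z z) := by
    rw [← sum_basis_tmul_contractL b (comδ M m),
      ← sum_basis_tmul_contractL b (g.rTensor (Coend Ω) (coact Ω Z z))]
    refine Finset.sum_congr rfl fun i _ => congrArg _ ?_
    rw [← hφ i, contractL_rTensor, contractL_coact, hgφ]
  -- Colinearity of g, contracted with θ. Coassociativity at m supplies the identity after applying
  -- both maps to the first leg of δ(z), and genericity of z removes that restriction.
  have h₂ (θ : Module.Dual K M) :
      (contractL (Coend Ω) θ ∘ₗ comδ M) ∘ₗ g = coef Ω Z (θ ∘ₗ g) := by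
    refine hg.linearMap_ext ?_
    have e := congrArg (contractL _ θ) (comδ_coassoc M m)
    rw [contractL_assoc, contractL_lTensor, ← LinearMap.comp_apply, ← LinearMap.rTensor_comp, h₁,
      contractL_rTensor, contractL_coact, coendComul_coef, ← LinearMap.comp_apply,
      ← LinearMap.rTensor_comp] at e
    exact e
  refine ⟨Z, comHomMk g fun x => tensor_ext_contractL fun θ => ?_, z, ?_⟩
  · rw [contractL_rTensor, contractL_coact]
    exact LinearMap.congr_fun (h₂ θ) x
  -- Applying the counit to δ(m) = (g ⊗ 1) δ(z) gives m = g(z).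
  · rw [comLin_comHomMk]
    refine Eq.trans ?_ (comδ_counit M m)
    rw [h₁, lTensor_rTensor, rid_rTensor, coact_counit]

lemma exists_surjective (M : (faceAlg Ω).Com) :
    ∃ (Z : C) (u : comObj Ω Z ⟶ M), Function.Surjective (comLin u) := by
  let b := Module.finBasis K M
  choose X u x hx using fun i => exists_hom_apply_eq (b i)
  refine ⟨⨁ X, ∑ i, comMap Ω (biproduct.π X i) ≫ u i, fun m => ?_⟩
  refine ⟨∑ j, fmap Ω (biproduct.ι X j) (b.repr m j • x j), ?_⟩
  rw [comLin_sum, LinearMap.sum_apply]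
  conv_rhs => rw [← b.sum_repr m]
  refine Finset.sum_congr rfl fun i _ => ?_
  rw [comLin_comp, LinearMap.comp_apply, biproduct_π_fmap_ι, map_smul, hx]

/-- For each basis vector of the kernel take a generator lying over it. The composite with k kills
that generator, hence is zero, and the sum of these maps covers the kernel. -/
lemma exists_comMap_comp_eq_zero {W : C} {M : (faceAlg Ω).Com} (k : comObj Ω W ⟶ M) :
    ∃ (Z : C) (r : Z ⟶ W), comMap Ω r ≫ k = 0 ∧
      ∀ w : Fib Ω W, comLin k w = 0 → ∃ z, fmap Ω r z = w := by
  let b := Module.finBasis K (LinearMap.ker (comLin k))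
  choose Z f z hz hg using fun i => exists_isGenerator Ω (b i).1
  have h (i) : comMap Ω (f i) ≫ k = 0 := (hg i).hom_ext <| by
    rw [comLin_comp, LinearMap.comp_apply, hz, comLin_zero, LinearMap.zero_apply]
    exact (b i).2
  refine ⟨⨁ Z, ∑ i, biproduct.π Z i ≫ f i, comLin_ext fun x => ?_, fun w hw => ?_⟩
  · rw [comLin_comp, fmap_sum, LinearMap.comp_apply, LinearMap.sum_apply, map_sum]
    refine Finset.sum_eq_zero fun i _ => ?_
    rw [fmap_comp]
    exact LinearMap.congr_fun (congrArg comLin (h i)) _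
  · refine ⟨∑ j, fmap Ω (biproduct.ι Z j) (b.repr ⟨w, hw⟩ j • z j), ?_⟩
    rw [fmap_sum, LinearMap.sum_apply]
    refine Eq.trans ?_ (congrArg Subtype.val (b.sum_repr ⟨w, hw⟩))
    rw [Submodule.coe_sum]
    refine Finset.sum_congr rfl fun i _ => ?_
    rw [fmap_comp, biproduct_π_fmap_ι, map_smul, hz, Submodule.coe_smul]

end

lemma biprod_fst_fmap {X Y : C} (x : Fib Ω X) (y : Fib Ω Y) :
    fmap Ω biprod.fst (fmap Ω biprod.inl x + fmap Ω biprod.inr y) = x := by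
  rw [map_add, ← fmap_comp, ← fmap_comp]
  simp

lemma biprod_snd_fmap {X Y : C} (x : Fib Ω X) (y : Fib Ω Y) :
    fmap Ω biprod.snd (fmap Ω biprod.inl x + fmap Ω biprod.inr y) = y := by
  rw [map_add, ← fmap_comp, ← fmap_comp]
  simp

/-! ### Fully faithful and essentially surjective -/

variable [Ω.Faithful]

instance : (comFunctor Ω).Faithful where
  map_injective h := fmap_injective fun x =>
    LinearMap.congr_fun (congrArg FaceAlg.Com.Hom.lin h) x

/-- The graph of g is the image of some Ω(r) with r : Z ⟶ X ⊞ Y. Its first component is epi, and the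
second descends along it to a preimage of g. -/
instance : (comFunctor Ω).Full where
  map_surjective {X Y} g := by
    let g' : comObj Ω X ⟶ comObj Ω Y := g
    -- The kernel of k is the graph of g.
    let k : comObj Ω (X ⊞ Y) ⟶ comObj Ω Y := comMap Ω biprod.snd - comMap Ω biprod.fst ≫ g'
    obtain ⟨Z, r, hr, hk⟩ := exists_comMap_comp_eq_zero k
    have hr' (z : Fib Ω Z) :
        fmap Ω (r ≫ biprod.snd) z = comLin g' (fmap Ω (r ≫ biprod.fst) z) := by
      have := LinearMap.congr_fun (congrArg comLin hr) z
      rw [comLin_comp, LinearMap.comp_apply, comLin_sub, LinearMap.sub_apply] at this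
      rw [fmap_comp, fmap_comp]
      exact sub_eq_zero.1 this
    have hs : Function.Surjective (fmap Ω (r ≫ biprod.fst)) := fun x => by
      let y : Fib Ω Y := comLin g' x
      obtain ⟨z, hz⟩ := hk (fmap Ω biprod.inl x + fmap Ω biprod.inr y) (sub_eq_zero.2
        ((biprod_snd_fmap x y).trans (congrArg (comLin g') (biprod_fst_fmap x y)).symm))
      exact ⟨z, by rw [fmap_comp, hz, biprod_fst_fmap]⟩
    have := epi_of_surjective_fmap Ω _ hs
    suffices h : ∃ a, comMap Ω a = g' from h
    -- On the graph the second component is g of the first, so it vanishes where the first does;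
    -- faithfulness brings this equation back to C.
    have hw : kernel.ι (r ≫ biprod.fst) ≫ r ≫ biprod.snd = 0 := fmap_injective (Ω := Ω) fun z => by
      rw [fmap_comp]
      refine (hr' _).trans ?_
      rw [← fmap_comp, kernel.condition, fmap_zero, fmap_zero, LinearMap.zero_apply, map_zero]
      rfl
    refine ⟨Abelian.epiDesc (r ≫ biprod.fst) (r ≫ biprod.snd) hw, comLin_ext fun x => ?_⟩
    obtain ⟨z, rfl⟩ := hs x
    refine (fmap_comp Ω _ _ z).symm.trans ?_
    rw [Abelian.comp_epiDesc]
    exact hr' z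

/-- Present M as a quotient of Ω(Z) whose kernel is the image of Ω(r). Exactness identifies Ω(coker
r) with the same quotient. -/
instance : (comFunctor Ω).EssSurj where
  mem_essImage M := by
    obtain ⟨Z, u, hu⟩ := exists_surjective M
    obtain ⟨Y, r, hr, hk⟩ := exists_comMap_comp_eq_zero u
    have hs := surjective_fmap Ω (cokernel.π r)
    have hker : LinearMap.ker (comLin u) = LinearMap.ker (fmap Ω (cokernel.π r)) := by
      ext z
      refine ⟨fun h => ?_, fun h => ?_⟩
      · obtain ⟨y, rfl⟩ := hk z h
        rw [LinearMap.mem_ker, ← fmap_comp, cokernel.condition, fmap_zero, LinearMap.zero_apply]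
      · obtain ⟨y, rfl⟩ := exists_fmap_cokernel Ω r z h
        exact LinearMap.congr_fun (congrArg comLin hr) y
    let e : Fib Ω (cokernel r) ≃ₗ[K] M :=
      ((LinearMap.quotKerEquivOfSurjective _ hs).symm ≪≫ₗ
        Submodule.quotEquivOfEq _ _ hker.symm) ≪≫ₗ LinearMap.quotKerEquivOfSurjective _ hu
    have he (z) : e (fmap Ω (cokernel.π r) z) = comLin u z := by
      have : (LinearMap.quotKerEquivOfSurjective _ hs).symm (fmap Ω (cokernel.π r) z) =
          Submodule.Quotient.mk z := by
        rw [LinearEquiv.symm_apply_eq]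
        rfl
      simp only [e, LinearEquiv.trans_apply, this]
      rfl
    have he' : e.toLinearMap ∘ₗ fmap Ω (cokernel.π r) = comLin u := LinearMap.ext he
    let f : comObj Ω (cokernel r) ⟶ M := comHomMk e.toLinearMap fun x => by
      obtain ⟨z, rfl⟩ := hs x
      rw [LinearEquiv.coe_coe, he, comδ_comLin, coact_fmap, ← LinearMap.rTensor_comp_apply, he']
    exact ⟨cokernel r, ⟨FaceAlg.Com.isoMk f e.symm.toLinearMap e.symm_apply_apply
      e.apply_symm_apply⟩⟩

instance : (comFunctor Ω).IsEquivalence where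

end Equivalence

/-! ### The tensor category of comodules -/

section TensorCategory

variable {K V : Type u} [Field K] [Fintype V] [DecidableEq V]

instance (H : FaceAlg K V) : MonoidalPreadditive H.Com where
  whiskerLeft_zero {X Y Z} := FaceAlg.Com.hom_ext <| FaceAlg.Com.tensor_ind
    (FaceAlg.Com.tensorLin (𝟙 X) (0 : Y ⟶ Z)) 0 fun x y =>
      (FaceAlg.Com.tensorLin_tmul _ _ x y).trans (map_zero (FaceAlg.Com.tmul X Z x))
  zero_whiskerRight {X Y Z} := FaceAlg.Com.hom_ext <| FaceAlg.Com.tensor_ind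
    (FaceAlg.Com.tensorLin (0 : Y ⟶ Z) (𝟙 X)) 0 fun y x =>
      (FaceAlg.Com.tensorLin_tmul _ _ y x).trans (map_zero ((FaceAlg.Com.tmul Z X).flip x))
  whiskerLeft_add {X Y Z} f g := FaceAlg.Com.hom_ext <| FaceAlg.Com.tensor_ind
    (FaceAlg.Com.tensorLin (𝟙 X) (f + g))
    (FaceAlg.Com.tensorLin (𝟙 X) f + FaceAlg.Com.tensorLin (𝟙 X) g) fun x y => by
      rw [LinearMap.add_apply, FaceAlg.Com.tensorLin_tmul, FaceAlg.Com.tensorLin_tmul,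
        FaceAlg.Com.tensorLin_tmul]
      exact map_add (FaceAlg.Com.tmul X Z x) (f.lin y) (g.lin y)
  add_whiskerRight {X Y Z} f g := FaceAlg.Com.hom_ext <| FaceAlg.Com.tensor_ind
    (FaceAlg.Com.tensorLin (f + g) (𝟙 X))
    (FaceAlg.Com.tensorLin f (𝟙 X) + FaceAlg.Com.tensorLin g (𝟙 X)) fun y x => by
      rw [LinearMap.add_apply, FaceAlg.Com.tensorLin_tmul, FaceAlg.Com.tensorLin_tmul,
        FaceAlg.Com.tensorLin_tmul]
      exact map_add ((FaceAlg.Com.tmul Z X).flip x) (f.lin y) (g.lin y)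

variable {C : Type u₁} [Category.{v₁} C] [EssentiallySmall.{u} C] [Abelian C] [Linear K C]
  [MonoidalCategory C] (Ω : C ⥤ FinBimod K (FaceR K V)) [Ω.Additive] [Ω.Linear K] [Ω.Monoidal]
  [PreservesFiniteLimits Ω] [PreservesFiniteColimits Ω] [Ω.Faithful]

lemma exists_abelian_com :
    ∃ A : Abelian (faceAlg Ω).Com, A.toPreadditive = FaceAlg.Com.instPreadditive := by
  have : HasFiniteProducts (faceAlg Ω).Com :=
    -- Finite products in comodules come from those of C through the inverse equivalence, as does
    -- the whole abelian structure; the additive structure on morphisms stays the given one.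
    ⟨fun _ => Adjunction.hasLimitsOfShape_of_equivalence (comFunctor Ω).inv⟩
  exact ⟨abelianOfEquivalence (comFunctor Ω).inv, rfl⟩

end TensorCategory

/-! ### The pairing of a fibre with the fibre of a dual object -/

section Pairing

variable {K V : Type u} [Field K] [Fintype V] [DecidableEq V]
  {C : Type u₁} [Category.{v₁} C] [MonoidalCategory C]
  {Ω : C ⥤ FinBimod K (FaceR K V)} [Ω.Monoidal]

lemma sum_idem_fright {X : C} (x : Fib Ω X) : ∑ ν, fright Ω X (idem K ν) x = x := by
  simpa using sum_fright (1 : FaceR K V) x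

lemma sum_unitDual_fright (c : Fib Ω (𝟙_ C)) :
    ∑ ν, unitDual Ω 1 (fright Ω _ (idem K ν) c) • funit Ω (idem K ν) = c := by
  rw [← funit_funitInv c]
  simp only [fright_funit, idem_mul, map_smul, unitDual_funit]
  conv_rhs => rw [← FaceE.sum_single (funitInv Ω c)]
  simp

/-- The contraction `x ⊗ y ↦ ∑ ν, φ(x ν) ν y`. -/
def contr {X : C} (Y : C) (φ : Module.Dual K (Fib Ω X)) : Fib Ω (X ⊗ Y) →ₗ[K] Fib Ω Y :=
  fmulLift (∑ ν, (LinearMap.lsmul K (Fib Ω Y)).compl₁₂ (φ ∘ₗ fright Ω X (idem K ν))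
    (fleft Ω Y (idem K ν))) (fun x a y => by
      simp only [LinearMap.sum_apply, LinearMap.compl₁₂_apply, LinearMap.comp_apply,
        fleft_idem_fleft, fright_idem_fright, map_smul, LinearMap.smul_apply])

lemma contr_fmul {X Y : C} (φ : Module.Dual K (Fib Ω X)) (x : Fib Ω X) (y : Fib Ω Y) :
    contr Y φ (fmul Ω X Y x y) =
      ∑ ν, φ (fright Ω X (idem K ν) x) • fleft Ω Y (idem K ν) y := by
  simp [contr, LinearMap.sum_apply]

lemma apply_contr {X Y : C} (φ : Module.Dual K (Fib Ω X)) (ψ : Module.Dual K (Fib Ω Y))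
    (w : Fib Ω (X ⊗ Y)) : ψ (contr Y φ w) = dualMul φ ψ w :=
  LinearMap.congr_fun (f := ψ ∘ₗ contr Y φ) (fmul_ind fun x y => by simp [contr_fmul]) w

lemma dualMul_fleft {X Y : C} (φ : Module.Dual K (Fib Ω X)) (ψ : Module.Dual K (Fib Ω Y))
    (a : FaceR K V) (w : Fib Ω (X ⊗ Y)) :
    dualMul φ ψ (fleft Ω _ a w) = dualMul (φ ∘ₗ fleft Ω X a) ψ w :=
  LinearMap.congr_fun (f := dualMul φ ψ ∘ₗ fleft Ω (X ⊗ Y) a)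
    (fmul_ind fun x y => by simp [fleft_fmul, fleft_fright]) w

variable (Ω) in
/-- The bilinear form `(m', m) ↦ ∑ ν, ⟨m', m⟩(ν)`, where `⟨m', m⟩ ∈ R` is the evaluation. -/
def pairForm (X X' : C) [ExactPairing X X'] : Fib Ω X' →ₗ[K] Module.Dual K (Fib Ω X) :=
  (fmul Ω X' X).compr₂ (unitDual Ω 1 ∘ₗ fmap Ω (ε_ X X'))

variable (Ω) in
/-- The coevaluation element of `Ω(X ⊗ X')`. -/
def coevElt (X X' : C) [ExactPairing X X'] : Fib Ω (X ⊗ X') := fmap Ω (η_ X X') (funit Ω 1)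

variable (Ω) in
/-- The inverse of the map `Ω(X') → Ω(X)^*`. -/
def sharp (X X' : C) [ExactPairing X X'] (φ : Module.Dual K (Fib Ω X)) : Fib Ω X' :=
  contr X' φ (coevElt Ω X X')

section

variable {X X' : C} [ExactPairing X X']

lemma pairForm_apply (m' : Fib Ω X') (m : Fib Ω X) :
    pairForm Ω X X' m' m = unitDual Ω 1 (fmap Ω (ε_ X X') (fmul Ω X' X m' m)) := rfl

lemma unitDual_one_fleft (a : FaceR K V) (c : Fib Ω (𝟙_ C)) :
    unitDual Ω 1 (fleft Ω _ a c) = unitDual Ω 1 (fright Ω _ a c) := by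
  rw [← funit_funitInv c, fleft_funit, fright_funit]

/-- Evaluation is a bimodule map to R, and on the commutative R the left and right actions agree. -/
lemma pairForm_fleft (a : FaceR K V) (m' : Fib Ω X') (m : Fib Ω X) :
    pairForm Ω X X' (fleft Ω X' a m') m = pairForm Ω X X' m' (fright Ω X a m) := by
  rw [pairForm_apply, pairForm_apply, ← fleft_fmul, ← fright_fmul, fmap_fleft, fmap_fright,
    unitDual_one_fleft]

/-- The scalar form loses nothing: the ν-th coordinate of the R-valued evaluation is the form at
(m', m ν). -/
lemma fmap_evaluation_fmul (m' : Fib Ω X') (m : Fib Ω X) :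
    fmap Ω (ε_ X X') (fmul Ω X' X m' m) =
      ∑ ν, pairForm Ω X X' m' (fright Ω X (idem K ν) m) • funit Ω (idem K ν) := by
  conv_lhs => rw [← sum_unitDual_fright (fmap Ω (ε_ X X') (fmul Ω X' X m' m))]
  simp only [← fmap_fright, fright_fmul, pairForm_apply]

lemma fmap_leftUnitor_inv {Y : C} (y : Fib Ω Y) :
    fmap Ω (λ_ Y).inv y = fmul Ω _ Y (funit Ω 1) y := by
  have h := fmap_leftUnitor_fmul (Ω := Ω) (1 : FaceR K V) y
  rw [map_one (fleft Ω Y), Module.End.one_apply] at h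
  rw [← h, fmap_hom_inv, h]

lemma fmap_rightUnitor_inv {Y : C} (y : Fib Ω Y) :
    fmap Ω (ρ_ Y).inv y = fmul Ω Y _ y (funit Ω 1) := by
  have h := fmap_rightUnitor_fmul (Ω := Ω) (1 : FaceR K V) y
  rw [map_one (fright Ω Y), Module.End.one_apply] at h
  rw [← h, fmap_hom_inv, h]

/-- The zigzag identity for X, evaluated at m and then at φ. -/
lemma pairForm_sharp (φ : Module.Dual K (Fib Ω X)) : pairForm Ω X X' (sharp Ω X X' φ) = φ := by
  ext m
  -- Both sides are linear in the element of Ω(X ⊗ X'); the zigzag identity applies once it is the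
  -- coevaluation element.
  have h : (pairForm Ω X X').flip m ∘ₗ contr X' φ =
      (φ ∘ₗ fmap Ω (ρ_ X).hom ∘ₗ fmap Ω (X ◁ ε_ X X') ∘ₗ fmap Ω (α_ X X' X).hom) ∘ₗ
        (fmul Ω _ X).flip m := fmul_ind fun x x' => by
    simp only [LinearMap.comp_apply, LinearMap.flip_apply, contr_fmul, fmap_associator_fmul,
      fmap_whiskerLeft_fmul, fmap_evaluation_fmul, map_sum, map_smul,
      fmap_rightUnitor_fmul, pairForm_fleft, smul_eq_mul]
    exact Finset.sum_congr rfl fun ν _ => mul_comm _ _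
  refine (LinearMap.congr_fun h (coevElt Ω X X')).trans (congrArg φ ?_)
  simp only [LinearMap.comp_apply, LinearMap.flip_apply]
  rw [coevElt, ← fmap_whiskerRight_fmul, ← fmap_leftUnitor_inv, ← fmap_comp, ← fmap_comp,
    ← fmap_comp, ← fmap_comp]
  simp

/-- The other zigzag identity, for X'. -/
lemma sharp_pairForm (m' : Fib Ω X') : sharp Ω X X' (pairForm Ω X X' m') = m' := by
  have h : contr X' (pairForm Ω X X' m') =
      (fmap Ω (λ_ X').hom ∘ₗ fmap Ω (ε_ X X' ▷ X') ∘ₗ fmap Ω (α_ X' X X').inv) ∘ₗ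
        fmul Ω X' _ m' := fmul_ind fun x x' => by
    simp only [LinearMap.comp_apply, contr_fmul]
    rw [← fmap_associator_fmul, fmap_hom_inv, fmap_whiskerRight_fmul, fmap_evaluation_fmul]
    simp only [map_sum, map_smul, LinearMap.sum_apply, LinearMap.smul_apply,
      fmap_leftUnitor_fmul]
  refine (LinearMap.congr_fun h (coevElt Ω X X')).trans ?_
  simp only [LinearMap.comp_apply]
  rw [coevElt, ← fmap_whiskerLeft_fmul, ← fmap_rightUnitor_inv, ← fmap_comp, ← fmap_comp,
    ← fmap_comp, ← fmap_comp]
  simp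

variable (Ω X X') in
/-- The isomorphism of `Ω(X')` with `Ω(X)^*`. -/
def pairEquiv : Fib Ω X' ≃ₗ[K] Module.Dual K (Fib Ω X) where
  __ := pairForm Ω X X'
  invFun := sharp Ω X X'
  left_inv := sharp_pairForm
  right_inv := pairForm_sharp

lemma pairEquiv_apply (m' : Fib Ω X') : pairEquiv Ω X X' m' = pairForm Ω X X' m' := rfl

@[simp] lemma pairForm_pairEquiv_symm (φ : Module.Dual K (Fib Ω X)) :
    pairForm Ω X X' ((pairEquiv Ω X X').symm φ) = φ := pairForm_sharp φ

lemma pairForm_injective {m m' : Fib Ω X'} (h : pairForm Ω X X' m = pairForm Ω X X' m') :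
    m = m' := (pairEquiv Ω X X').injective h

lemma exists_pairForm_flip_eq (φ : Module.Dual K (Fib Ω X')) :
    ∃ m, (pairForm Ω X X').flip m = φ := by
  obtain ⟨m, hm⟩ := (Module.evalEquiv K (Fib Ω X)).surjective
    (φ ∘ₗ (pairEquiv Ω X X').symm.toLinearMap)
  refine ⟨m, LinearMap.ext fun m' => ?_⟩
  have h := LinearMap.congr_fun hm (pairEquiv Ω X X' m')
  rw [LinearMap.comp_apply, LinearEquiv.coe_coe, LinearEquiv.symm_apply_apply] at h
  exact h

lemma eq_zero_of_pairForm_flip {m : Fib Ω X} (h : ∀ m', pairForm Ω X X' m' m = 0) : m = 0 :=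
  (Module.forall_dual_apply_eq_zero_iff K m).1 fun φ => by
    rw [← pairForm_pairEquiv_symm (X' := X') φ, h]

/-- The left action on Ω(X') is adjoint to the right action on Ω(X), so the idempotents split φ♯
accordingly. This absorbs the sum over ν that comes with a product of functionals. -/
lemma sum_fleft_symm (φ : Module.Dual K (Fib Ω X)) :
    ∑ ν, fleft Ω X' (idem K ν) ((pairEquiv Ω X X').symm (φ ∘ₗ fright Ω X (idem K ν))) =
      (pairEquiv Ω X X').symm φ := by
  refine pairForm_injective (X := X) (LinearMap.ext fun m => ?_)
  rw [map_sum, LinearMap.sum_apply, pairForm_pairEquiv_symm]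
  conv_rhs => rw [← sum_idem_fright m, map_sum]
  refine Finset.sum_congr rfl fun ν _ => ?_
  rw [pairForm_fleft, pairForm_pairEquiv_symm, LinearMap.comp_apply, fright_idem_fright]
  simp

variable (X X') in
lemma dualMul_coevElt (φ : Module.Dual K (Fib Ω X)) (ψ : Module.Dual K (Fib Ω X')) :
    dualMul φ ψ (coevElt Ω X X') = ψ ((pairEquiv Ω X X').symm φ) := (apply_contr φ ψ _).symm

/-- The right adjoint mate of f is its adjoint for the forms, because the mate is compatible with
evaluation. -/
lemma exists_mate {Y Y' : C} [ExactPairing Y Y'] (f : X ⟶ Y) :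
    ∃ f' : Y' ⟶ X', ∀ y' x, pairForm Ω X X' (fmap Ω f' y') x = pairForm Ω Y Y' y' (fmap Ω f x) := by
  let _ : HasRightDual X := ⟨X'⟩
  let _ : HasRightDual Y := ⟨Y'⟩
  refine ⟨rightAdjointMate f, fun y' x => ?_⟩
  rw [pairForm_apply, pairForm_apply, ← fmap_whiskerRight_fmul, ← fmap_whiskerLeft_fmul,
    ← fmap_comp, ← fmap_comp]
  exact congrArg (fun g => unitDual Ω 1 (fmap Ω g _)) (rightAdjointMate_comp_evaluation f)

lemma exists_mate' {Y Y' : C} [ExactPairing Y Y'] (f : Y' ⟶ X') :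
    ∃ g : X ⟶ Y, ∀ y' x, pairForm Ω X X' (fmap Ω f y') x = pairForm Ω Y Y' y' (fmap Ω g x) := by
  let _ : HasLeftDual X' := ⟨X⟩
  let _ : HasLeftDual Y' := ⟨Y⟩
  refine ⟨leftAdjointMate f, fun y' x => ?_⟩
  rw [pairForm_apply, pairForm_apply, ← fmap_whiskerRight_fmul, ← fmap_whiskerLeft_fmul,
    ← fmap_comp, ← fmap_comp]
  exact congrArg (fun g => unitDual Ω 1 (fmap Ω g _)) (leftAdjointMate_comp_evaluation f).symm

end

end Pairing

/-! ### The antipode -/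

section Antipode

variable {K V : Type u} [Field K] [Fintype V] [DecidableEq V]
  {C : Type u₁} [Category.{v₁} C] [EssentiallySmall.{u} C] [Abelian C] [Linear K C]
  [MonoidalCategory C] {Ω : C ⥤ FinBimod K (FaceR K V)} [Ω.Additive] [Ω.Linear K] [Ω.Monoidal]

lemma eq_of_dualMul_eq {X Y : C} {w w' : Fib Ω (X ⊗ Y)}
    (h : ∀ φ ψ, dualMul φ ψ w = dualMul φ ψ w') : w = w' :=
  eq_of_dual_eq (K := K) fun θ => by
    rw [← sum_dualMul θ (Module.finBasis K (Fib Ω X)) (Module.finBasis K (Fib Ω Y))]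
    simp only [LinearMap.sum_apply, LinearMap.smul_apply, h]

section

variable {X X' : C} [ExactPairing X X']

/-- The coevaluation element is ∑ i, x_i ⊗ x_i♯, where x_i♯ corresponds to the dual basis; products
of functionals separate points, so it suffices to test on them. -/
lemma sum_fmul_symm {ι : Type*} [Fintype ι] (b : Module.Basis ι K (Fib Ω X)) :
    ∑ i, fmul Ω X X' (b i) ((pairEquiv Ω X X').symm (b.coord i)) = coevElt Ω X X' := by
  refine eq_of_dualMul_eq fun φ ψ => ?_
  rw [dualMul_coevElt, map_sum, ← sum_fleft_symm, map_sum]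
  simp only [dualMul_fmul]
  rw [Finset.sum_comm]
  refine Finset.sum_congr rfl fun ν _ => ?_
  rw [← b.sum_dual_apply_smul_coord (φ ∘ₗ fright Ω X (idem K ν))]
  simp only [map_sum, map_smul, smul_eq_mul, LinearMap.comp_apply]

/-- Dually, evaluation followed by the sum of coordinates is the canonical element built from a
basis of Ω(X). -/
lemma sum_dualMul_flip {ι : Type*} [Fintype ι] (b : Module.Basis ι K (Fib Ω X)) :
    ∑ i, dualMul ((pairForm Ω X X').flip (b i)) (b.coord i) =
      unitDual Ω 1 ∘ₗ fmap Ω (ε_ X X') := fmul_ind fun m' m => by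
  have h (ν : V) : ∑ i, pairForm Ω X X' (fright Ω X' (idem K ν) m') (b i) *
      b.coord i (fleft Ω X (idem K ν) m) =
        unitDual Ω 1 (fmap Ω (ε_ X X') (fmul Ω X' X (fright Ω X' (idem K ν) m')
          (fleft Ω X (idem K ν) m))) := by
    rw [← pairForm_apply]
    conv_rhs => rw [← b.sum_repr (fleft Ω X (idem K ν) m)]
    simp only [map_sum, map_smul, smul_eq_mul, Module.Basis.coord_apply, mul_comm]
  simp only [LinearMap.sum_apply, dualMul_fmul, LinearMap.comp_apply]
  rw [Finset.sum_comm, ← sum_fmul_fright_fleft, map_sum, map_sum]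
  exact Finset.sum_congr rfl fun ν _ => h ν

end

variable (Ω) in
/-- The map `κ_X(φ ⊗ x) ↦ κ_{X'}(⟨·, x⟩ ⊗ φ♯)` for a right dual `X'` of `X`. -/
def antipodeAux (X X' : C) [ExactPairing X X'] :
    Module.Dual K (Fib Ω X) →ₗ[K] Fib Ω X →ₗ[K] Coend Ω :=
  (coef Ω X').flip.compl₁₂ (pairEquiv Ω X X').symm.toLinearMap (pairForm Ω X X').flip

lemma antipodeAux_apply {X X' : C} [ExactPairing X X'] (φ : Module.Dual K (Fib Ω X))
    (x : Fib Ω X) : antipodeAux Ω X X' φ x =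
      coef Ω X' ((pairForm Ω X X').flip x) ((pairEquiv Ω X X').symm φ) := rfl

/-- Replacing f by its mate moves both arguments to the other object, and dinaturality of κ along
the mate finishes. As the duals are arbitrary, f = 𝟙 shows independence of the choice of dual. -/
lemma antipodeAux_comp {X X' Y Y' : C} [ExactPairing X X'] [ExactPairing Y Y'] (f : X ⟶ Y)
    (φ : Module.Dual K (Fib Ω Y)) (x : Fib Ω X) :
    antipodeAux Ω X X' (φ ∘ₗ fmap Ω f) x = antipodeAux Ω Y Y' φ (fmap Ω f x) := by
  obtain ⟨f', hf⟩ := exists_mate (Ω := Ω) (X' := X') (Y' := Y') f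
  have h₁ : (pairEquiv Ω X X').symm (φ ∘ₗ fmap Ω f) =
      fmap Ω f' ((pairEquiv Ω Y Y').symm φ) := by
    rw [LinearEquiv.symm_apply_eq, pairEquiv_apply]
    ext m
    rw [hf, pairForm_pairEquiv_symm, LinearMap.comp_apply]
  have h₂ : (pairForm Ω X X').flip x ∘ₗ fmap Ω f' = (pairForm Ω Y Y').flip (fmap Ω f x) :=
    LinearMap.ext fun y' => hf y' x
  rw [antipodeAux_apply, antipodeAux_apply, h₁, ← coef_comp_fmap, h₂]

section

variable [RightRigidCategory C]

variable (Ω) in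
/-- The antipode of the coend. -/
def antipode : Coend Ω →ₗ[K] Coend Ω :=
  coendDesc (fun X => antipodeAux Ω X Xᘁ) (fun f φ x => antipodeAux_comp f φ x)

lemma antipode_coef {X X' : C} [ExactPairing X X'] (φ : Module.Dual K (Fib Ω X)) (x : Fib Ω X) :
    antipode Ω (coef Ω X φ x) =
      coef Ω X' ((pairForm Ω X X').flip x) ((pairEquiv Ω X X').symm φ) := by
  have h := antipodeAux_comp (X' := Xᘁ) (Y' := X') (𝟙 X) φ x
  rw [fmap_id, show φ ∘ₗ fmap Ω (𝟙 X) = φ from LinearMap.ext fun x => by simp] at h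
  exact (coendDesc_coef _ _ X φ x).trans h

variable [PreservesFiniteLimits Ω] [PreservesFiniteColimits Ω]

/-- The product collapses to one coefficient of X' ⊗ X whose functional is the evaluation form;
dinaturality along evaluation moves it to the unit object. -/
lemma antipode_mul_coend (h : Coend Ω) :
    LinearMap.mul' K (Coend Ω) ((antipode Ω).rTensor (Coend Ω) (coendComul Ω h)) =
      ∑ ν, coendCounit Ω (h * coendIncl Ω (FaceE.mk 1 (idem K ν))) •
        coendIncl Ω (FaceE.mk 1 (idem K ν)) := by
  obtain ⟨X, φ, x, rfl⟩ := coef_surjective h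
  have hr (ν : V) : coef Ω X φ x * coendIncl Ω (FaceE.mk 1 (idem K ν)) =
      coef Ω X φ (fright Ω X (idem K ν) x) := by
    refine (coef_mul_coendIncl Ω 1 (idem K ν) φ x).trans ?_
    rw [map_one]
    rfl
  simp only [hr, coendCounit_coef]
  rw [coendComul_coef, coact_apply]
  simp only [map_sum, LinearMap.rTensor_tmul, LinearMap.mul'_apply]
  simp only [antipode_coef (X' := Xᘁ), coef_mul_coef]
  rw [← LinearMap.sum_apply, ← map_sum, sum_dualMul_flip, coef_comp_fmap, fmap_evaluation_fmul,
    map_sum]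
  simp only [pairForm_pairEquiv_symm, map_smul, coendIncl_mk]

/-- The mirror argument: the vectors sum to the coevaluation element, and dinaturality along
coevaluation moves the coefficient to the unit object. -/
lemma mul_antipode_coend (h : Coend Ω) :
    LinearMap.mul' K (Coend Ω) ((antipode Ω).lTensor (Coend Ω) (coendComul Ω h)) =
      ∑ ν, coendCounit Ω (coendIncl Ω (FaceE.mk 1 (idem K ν)) * h) •
        coendIncl Ω (FaceE.mk (idem K ν) 1) := by
  obtain ⟨X, φ, x, rfl⟩ := coef_surjective h
  have hl (ν : V) : coendIncl Ω (FaceE.mk 1 (idem K ν)) * coef Ω X φ x =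
      coef Ω X φ (fleft Ω X (idem K ν) x) := by
    refine (coendIncl_mul_coef Ω 1 (idem K ν) φ x).trans ?_
    rw [map_one]
    rfl
  -- The functional pulled back to Ω(𝟙) = R is determined by its values at the idempotents, where
  -- the zigzag identities give φ(ν x).
  have hη : dualMul φ ((pairForm Ω X Xᘁ).flip x) ∘ₗ fmap Ω (η_ X Xᘁ) =
      ∑ ν, φ (fleft Ω X (idem K ν) x) • unitDual Ω (idem K ν) := by
    rw [← sum_unitDual (dualMul φ ((pairForm Ω X Xᘁ).flip x) ∘ₗ fmap Ω (η_ X Xᘁ))]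
    refine Finset.sum_congr rfl fun ν _ => ?_
    rw [LinearMap.comp_apply, ← mul_one (idem K ν), ← fleft_funit, fmap_fleft, mul_one,
      dualMul_fleft]
    refine congrArg (· • _) ((dualMul_coevElt X Xᘁ _ _).trans ?_)
    rw [LinearMap.flip_apply, pairForm_pairEquiv_symm, LinearMap.comp_apply]
  simp only [hl, coendCounit_coef]
  rw [coendComul_coef, coact_apply]
  simp only [map_sum, LinearMap.rTensor_tmul, LinearMap.lTensor_tmul, LinearMap.mul'_apply]
  simp only [antipode_coef (X' := Xᘁ), coef_mul_coef]
  rw [← map_sum, sum_fmul_symm, coevElt, ← coef_comp_fmap, hη, map_sum, LinearMap.sum_apply]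
  simp only [map_smul, LinearMap.smul_apply, coendIncl_mk]

/-- The first axiom replaces S(a₁)a₂ by elements of R. Their left action on coefficients of X'
reassembles φ♯ through `sum_fleft_symm`. -/
lemma antipode_mul_antipode_coend (h : Coend Ω) :
    LinearMap.mul' K (Coend Ω) (TensorProduct.map
      (LinearMap.mul' K (Coend Ω) ∘ₗ (antipode Ω).rTensor (Coend Ω)) (antipode Ω)
        ((coendComul Ω).rTensor (Coend Ω) (coendComul Ω h))) = antipode Ω h := by
  obtain ⟨X, φ, x, rfl⟩ := coef_surjective h
  have hl (ν : V) (ψ : Module.Dual K (Fib Ω Xᘁ)) (y : Fib Ω Xᘁ) :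
      coendIncl Ω (FaceE.mk 1 (idem K ν)) * coef Ω Xᘁ ψ y =
        coef Ω Xᘁ ψ (fleft Ω Xᘁ (idem K ν) y) := by
    refine (coendIncl_mul_coef Ω 1 (idem K ν) ψ y).trans ?_
    rw [map_one]
    rfl
  have hr (ν : V) (y : Fib Ω X) : coef Ω X φ y * coendIncl Ω (FaceE.mk 1 (idem K ν)) =
      coef Ω X φ (fright Ω X (idem K ν) y) := by
    refine (coef_mul_coendIncl Ω 1 (idem K ν) φ y).trans ?_
    rw [map_one]
    rfl
  rw [coendComul_coef, coact_apply]
  simp only [map_sum, LinearMap.rTensor_tmul, TensorProduct.map_tmul, LinearMap.mul'_apply,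
    LinearMap.comp_apply, antipode_mul_coend]
  simp only [antipode_coef (X' := Xᘁ), Finset.sum_mul, smul_mul_assoc, hl, hr, coendCounit_coef]
  rw [Finset.sum_comm, ← sum_fleft_symm φ, map_sum]
  refine Finset.sum_congr rfl fun ν _ => ?_
  rw [← (Module.finBasis K (Fib Ω X)).sum_dual_apply_smul_coord (φ ∘ₗ fright Ω X (idem K ν))]
  simp only [map_sum, map_smul, LinearMap.comp_apply]

end

/-! ### Bijectivity of the antipode -/

variable [RigidCategory C] [PreservesFiniteLimits Ω] [PreservesFiniteColimits Ω]

/-- X is a right dual of ᘁX, and by finite-dimensionality every functional on Ω(X) is pairing with a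
vector of Ω(ᘁX). -/
lemma antipode_surjective : Function.Surjective (antipode Ω) := fun h => by
  obtain ⟨X, φ, x, rfl⟩ := coef_surjective h
  obtain ⟨y, hy⟩ := exists_pairForm_flip_eq (X := ᘁX) φ
  refine ⟨coef Ω (ᘁX) (pairForm Ω (ᘁX) X x) y, ?_⟩
  rw [antipode_coef (X' := X), hy, ← pairEquiv_apply, LinearEquiv.symm_apply_apply]

/-- If S(κ_X(φ ⊗ x)) = 0, the vanishing criterion gives f : W ⟶ Xᘁ. Its left mate g : X ⟶ ᘁW kills
x, while φ factors through Ω(g), so dinaturality along g makes κ_X(φ ⊗ x) zero. -/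
lemma antipode_injective :
    Function.Injective (antipode Ω) :=
  (injective_iff_map_eq_zero _).2 fun h hh => by
    obtain ⟨X, φ, x, rfl⟩ := coef_surjective h
    rw [antipode_coef (X' := Xᘁ)] at hh
    obtain ⟨W, f, s, hs, hf⟩ := coef_eq_zero hh
    obtain ⟨g, hg⟩ := exists_mate' (Ω := Ω) (X := X) (Y := ᘁW) f
    have hx : fmap Ω g x = 0 := eq_zero_of_pairForm_flip (X' := W) fun s' => by
      rw [← hg]
      exact LinearMap.congr_fun hf s'
    have hφ : φ = pairForm Ω (ᘁW) W s ∘ₗ fmap Ω g := by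
      ext m
      rw [LinearMap.comp_apply, ← hg, hs, pairForm_pairEquiv_symm]
    rw [hφ, coef_comp_fmap, hx, map_zero]

lemma exists_bijective_antipode :
    ∃ S : faceAlg Ω →ₗ[K] faceAlg Ω, (faceAlg Ω).IsAntipode S ∧ Function.Bijective S :=
  ⟨antipode Ω, ⟨antipode_mul_coend, mul_antipode_coend, antipode_mul_antipode_coend⟩,
    antipode_injective, antipode_surjective⟩

end Antipode

end VTannaka

end

/-! ### The reconstruction theorem -/

theorem mainTheorem1 {K V : Type u} [Field K] [Fintype V] [DecidableEq V] [Nonempty V]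
    {C : Type u₁} [Category.{v₁} C] [EssentiallySmall.{u} C]
    [Abelian C] [Linear K C] [MonoidalCategory C] [MonoidalPreadditive C]
    (Ω : C ⥤ FinBimod K (FaceR K V)) [Ω.Monoidal] [Ω.Additive] [Ω.Linear K] [Ω.Faithful]
    [PreservesFiniteLimits Ω] [PreservesFiniteColimits Ω] :
    HasCoend (coendDiagram Ω) ∧
    ∀ c : Cowedge (coendDiagram Ω), Nonempty (IsColimit c) →
      ∃ (H : FaceAlg K V) (e : c.pt ≅ H.bimod),
        -- `com(H)` is a tensor category over `K`
        (MonoidalPreadditive H.Com ∧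
          ∃ A : Abelian H.Com, A.toPreadditive = FaceAlg.Com.instPreadditive) ∧
        -- `Ω`, with the coactions `m ↦ ∑ i, m_i ⊗ κ_X(m^i ⊗ m)` on the `Ω(X)`, is an equivalence of
        -- tensor categories from `C` to `com(H)`
        (∃ (F : C ⥤ H.Com) (_ : F.Monoidal) (α : F ⋙ FaceAlg.Com.forget H ≅ Ω ⋙ toBimod K V),
          F.IsEquivalence ∧ F.Additive ∧ F.Linear K ∧ NatTrans.IsMonoidal α.hom ∧
          ∀ (X : C) (m : F.obj X),
            LinearMap.rTensor H (FaceAlg.Com.linFrom (α.hom.app X)) ((F.obj X).δ m) =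
              FaceAlg.coaction (Ω.obj X) (c.π X ≫ e.hom)
                (FaceAlg.Com.linFrom (α.hom.app X) m)) ∧
        -- if `C` is rigid, then `H` has a bijective antipode
        (Nonempty (RigidCategory C) →
          ∃ S : H →ₗ[K] H, H.IsAntipode S ∧ Function.Bijective S) := by
  refine ⟨hasCoend Ω, fun c ⟨hc⟩ => ?_⟩
  obtain ⟨e, he⟩ := exists_iso_faceAlg Ω c hc
  refine ⟨faceAlg Ω, e, ⟨inferInstance, exists_abelian_com Ω⟩,
    ⟨comFunctor Ω, inferInstance, comFunctorIso Ω, inferInstance, inferInstance, inferInstance,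
      inferInstance, fun X m => ?_⟩, fun ⟨_⟩ => exists_bijective_antipode⟩
  -- Transport along e turns the structure map of c into the explicit κ_X; since α is the identity
  -- on elements, both sides are then the same coaction.
  refine Eq.trans ?_ (congrArg (fun κ => FaceAlg.coaction (Ω.obj X) κ m) (he X)).symm
  refine Eq.trans ?_ (LinearMap.congr_fun (coaction_kappa Ω X) m).symm
  exact LinearMap.congr_fun (LinearMap.rTensor_id (Coend Ω) (Fib Ω X)) (coact Ω X m)
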